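/- Let $P=\{p_1,\dots,p_n\}$ be a set of $n\ge 2$ distinct points of the Riemann sphere $S^2=\mathbb C\cup\{\infty\}$ (equivalently, the divisor $[p_1]+\dots+[p_n]$). Let $S$ be the spin structure of $S^2$, i.e. the holomorphic line bundle with $S\otimes S$ the canonical bundle. Let $\mathcal F$ be the space of meromorphic sections $s$ of $S$ with $(s)\ge -P$, that is, holomorphic off $P$ and with at most a simple pole at each point of $P$. Let $\mathcal K\subset\mathcal F$ be the subspace of those sections whose expansion at each $p\in P$, in a holomorphic coordinate $\zeta$ centred at $p$, has no constant term: $s=(c/\zeta+O(\zeta))\sqrt{d\zeta}$. Then $\mathcal K$ is a finite-dimensional complex vector space, and (i) $n-\dim\mathcal K$ is even; (ii) suppose there is a complete conformal minimal immersion $X:S^2\setminus P\to\mathbb R^3$ with finite total curvature and an embedded planar end at each of the $n$ points of $P$; or, more generally, such a branched minimal immersion, all of whose branch points have even order and whose image does not lie in a plane. Then $$2\le\dim\mathcal K\le\sqrt n .$$ Here a branch point of order $m\ge1$ is a point at which $dX$ vanishes exactly to order $m$. The end at $p$ is an embedded planar end if $X$ is an injective immersion on a punctured neighbourhood of $p$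 and, as $q\to p$, $|X(q)|\to\infty$ and $X(q)$ is asymptotic to an affine plane (the distance of $X(q)$ from that plane tends to $0$). -/

import Mathlib

open Set Filter Topology Asymptotics MeasureTheory
open scoped OnePoint Laplacian

noncomputable section

/-! The Riemann sphere is `OnePoint ℂ`, with the coordinate `z` on `ℂ` and `w = 1 / z` around `∞`. -/

namespace RiemannSphere

/-- The inverse of the holomorphic coordinate `ζ` centred at `p`: `ζ = z - a` for `p = a ∈ ℂ`,
and `ζ = w = 1 / z` for `p = ∞`. -/
def param (p : OnePoint ℂ) (ζ : ℂ) : OnePoint ℂ :=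
  OnePoint.elim p (if ζ = 0 then ∞ else ((ζ⁻¹ : ℂ) : OnePoint ℂ))
    (fun a => ((a + ζ : ℂ) : OnePoint ℂ))

/-! ### Spinors

`S` is the spin structure of the sphere, the line bundle with `S ⊗ S` the canonical bundle. It has
the local frames `√dz` over `ℂ` and `√dw` around `∞`. From `dz = - w⁻² dw` they are related by
`√dz = i w⁻¹ √dw`. A (set-theoretic) section `s` of `S` is described by a function
`s : OnePoint ℂ → ℂ`: `s a` is the coefficient of `√dz` at `a ∈ ℂ`, and `s ∞` is the coefficient
of `√dw` at `∞`. -/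

/-- The coefficient of the section `s` in the local frame `√dζ`, as a function of the coordinate
`ζ` centred at `p`. -/
def coeff (s : OnePoint ℂ → ℂ) (p : OnePoint ℂ) (ζ : ℂ) : ℂ :=
  OnePoint.elim p
    (if ζ = 0 then s ∞ else Complex.I * ζ⁻¹ * s ((ζ⁻¹ : ℂ) : OnePoint ℂ))
    (fun a => s ((a + ζ : ℂ) : OnePoint ℂ))

theorem coeff_add (s t : OnePoint ℂ → ℂ) (p : OnePoint ℂ) :
    coeff (s + t) p = coeff s p + coeff t p := by
  funext ζ
  induction p using OnePoint.rec with
  | infty => by_cases h : ζ = 0 <;> simp [coeff, h, mul_add]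
  | coe a => simp [coeff]

theorem coeff_smul (k : ℂ) (s : OnePoint ℂ → ℂ) (p : OnePoint ℂ) :
    coeff (k • s) p = k • coeff s p := by
  funext ζ
  induction p using OnePoint.rec with
  | infty =>
    by_cases h : ζ = 0
    · simp [coeff, h]
    · simp [coeff, h]; ring
  | coe a => simp [coeff]

theorem coeff_zero (p : OnePoint ℂ) : coeff 0 p = 0 := by
  have h := coeff_smul 0 0 p
  simpa using h

/-- The space `F` of meromorphic sections `s` of `S` with `(s) ≥ - P`: the holomorphic sections
over the complement of `P` that have at most a simple pole at each point of `P`. Such a section is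
recorded by its values off `P`; the function describing it is given the value `0` at the points
of `P`. -/
def spinorF (P : Finset (OnePoint ℂ)) : Submodule ℂ (OnePoint ℂ → ℂ) where
  carrier := {s | (∀ p ∉ P, AnalyticAt ℂ (coeff s p) 0) ∧
    ∀ p ∈ P, s p = 0 ∧ ∃ (c : ℂ) (h : ℂ → ℂ), AnalyticAt ℂ h 0 ∧
      ∀ᶠ ζ in 𝓝[≠] 0, coeff s p ζ = c / ζ + h ζ}
  zero_mem' := by
    refine ⟨fun p _ => ?_, fun p _ => ⟨rfl, 0, 0, analyticAt_const, ?_⟩⟩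
    · rw [coeff_zero]; exact analyticAt_const
    · rw [coeff_zero]; exact Eventually.of_forall fun ζ => by simp
  add_mem' := by
    rintro s t ⟨hs, hs'⟩ ⟨ht, ht'⟩
    refine ⟨fun p hp => ?_, fun p hp => ?_⟩
    · rw [coeff_add]; exact (hs p hp).add (ht p hp)
    · obtain ⟨h0, c, h, hh, he⟩ := hs' p hp
      obtain ⟨k0, d, k, hk, ke⟩ := ht' p hp
      refine ⟨by simp [h0, k0], c + d, h + k, hh.add hk, ?_⟩
      filter_upwards [he, ke] with ζ h1 h2
      rw [coeff_add, Pi.add_apply, h1, h2, Pi.add_apply]; ring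
  smul_mem' := by
    rintro a s ⟨hs, hs'⟩
    refine ⟨fun p hp => ?_, fun p hp => ?_⟩
    · rw [coeff_smul]; exact (hs p hp).const_smul
    · obtain ⟨h0, c, h, hh, he⟩ := hs' p hp
      refine ⟨by simp [h0], a * c, a • h, hh.const_smul, ?_⟩
      filter_upwards [he] with ζ h1
      rw [coeff_smul, Pi.smul_apply, h1, Pi.smul_apply, smul_eq_mul, smul_eq_mul]; ring

/-- The space `K` of those `s` in `F` whose expansion at each point of `P`, in the coordinate `ζ`
centred there, has no constant term: `s = (c / ζ + O(ζ)) √dζ`. -/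
def spinorK (P : Finset (OnePoint ℂ)) : Submodule ℂ (OnePoint ℂ → ℂ) where
  carrier := {s | s ∈ spinorF P ∧
    ∀ p ∈ P, ∃ (c : ℂ) (h : ℂ → ℂ), AnalyticAt ℂ h 0 ∧ h 0 = 0 ∧
      ∀ᶠ ζ in 𝓝[≠] 0, coeff s p ζ = c / ζ + h ζ}
  zero_mem' := by
    refine ⟨zero_mem _, fun p _ => ⟨0, 0, analyticAt_const, rfl, ?_⟩⟩
    rw [coeff_zero]; exact Eventually.of_forall fun ζ => by simp
  add_mem' := by
    rintro s t ⟨hs, hs'⟩ ⟨ht, ht'⟩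
    refine ⟨add_mem hs ht, fun p hp => ?_⟩
    obtain ⟨c, h, hh, h0, he⟩ := hs' p hp
    obtain ⟨d, k, hk, k0, ke⟩ := ht' p hp
    refine ⟨c + d, h + k, hh.add hk, by simp [h0, k0], ?_⟩
    filter_upwards [he, ke] with ζ h1 h2
    rw [coeff_add, Pi.add_apply, h1, h2, Pi.add_apply]; ring
  smul_mem' := by
    rintro a s ⟨hs, hs'⟩
    refine ⟨Submodule.smul_mem _ a hs, fun p hp => ?_⟩
    obtain ⟨c, h, hh, h0, he⟩ := hs' p hp
    refine ⟨a * c, a • h, hh.const_smul, by simp [h0], ?_⟩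
    filter_upwards [he] with ζ h1
    rw [coeff_smul, Pi.smul_apply, h1, Pi.smul_apply, smul_eq_mul, smul_eq_mul]; ring

/-! ### Minimal surfaces

A map `X` from the sphere minus `P` to `ℝ³` is given by a function on the sphere; its values at
the points of `P` play no role. -/

/-- Euclidean three-space. -/
abbrev E3 := EuclideanSpace ℝ (Fin 3)

/-- `X` in the coordinate `ζ` centred at `p`. -/
def localRep (X : OnePoint ℂ → E3) (p : OnePoint ℂ) : ℂ → E3 := fun ζ => X (param p ζ)

/-- The differential of `X` vanishes at `p` exactly to order `m`: `p` is a branch point of order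
`m` if `m ≥ 1`, and `X` is an immersion at `p` if `m = 0`. -/
def HasBranchOrder (X : OnePoint ℂ → E3) (p : OnePoint ℂ) (m : ℕ) : Prop :=
  (fun ζ : ℂ => fderiv ℝ (localRep X p) ζ) =Θ[𝓝 0] (fun ζ : ℂ => ζ ^ m)

/-- A branched minimal immersion of the sphere minus `P`: `X` is harmonic, (weakly) conformal, and
an immersion except at branch points of finite order. -/
structure IsBranchedMinimal (P : Finset (OnePoint ℂ)) (X : OnePoint ℂ → E3) : Prop where
  harmonic : ∀ p ∉ P, InnerProductSpace.HarmonicAt (localRep X p) 0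
  conformal_norm : ∀ p ∉ P,
    ‖fderiv ℝ (localRep X p) 0 1‖ = ‖fderiv ℝ (localRep X p) 0 Complex.I‖
  conformal_inner : ∀ p ∉ P,
    inner ℝ (fderiv ℝ (localRep X p) 0 1) (fderiv ℝ (localRep X p) 0 Complex.I) = 0
  branch : ∀ p ∉ P, ∃ m : ℕ, HasBranchOrder X p m

/-- Every branch point has even order: the differential vanishes to order `2k`. -/
def EvenBranching (P : Finset (OnePoint ℂ)) (X : OnePoint ℂ → E3) : Prop :=
  ∀ p ∉ P, ∃ k : ℕ, HasBranchOrder X p (2 * k)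

/-- There are no branch points. -/
def Unbranched (P : Finset (OnePoint ℂ)) (X : OnePoint ℂ → E3) : Prop :=
  ∀ p ∉ P, HasBranchOrder X p 0

/-- The image of `X` lies in an affine plane. -/
def LiesInPlane (P : Finset (OnePoint ℂ)) (X : OnePoint ℂ → E3) : Prop :=
  ∃ (ν : E3) (c : ℝ), ν ≠ 0 ∧ ∀ p ∉ P, inner ℝ ν (X p) = c

/-- Completeness of the induced metric: every path in the sphere minus `P` that diverges (that is,
tends to `P`) has infinite length. -/
def IsCompleteSurface (P : Finset (OnePoint ℂ)) (X : OnePoint ℂ → E3) : Prop :=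
  ∀ γ : ℝ → OnePoint ℂ, ContinuousOn γ (Ico 0 1) → (∀ t ∈ Ico (0 : ℝ) 1, γ t ∉ P) →
    Tendsto γ (𝓝[<] 1) (𝓝ˢ (P : Set (OnePoint ℂ))) →
    eVariationOn (fun t => X (γ t)) (Ico 0 1) = ⊤

/-- The factor `λ` of the induced metric `λ |dz|²` on `ℂ`. -/
def metricFactor (X : OnePoint ℂ → E3) (z : ℂ) : ℝ :=
  ‖fderiv ℝ (fun z : ℂ => X (z : OnePoint ℂ)) z 1‖ ^ 2

/-- The Gauss curvature `- Δ (log λ) / (2 λ)` of the induced metric `λ |dz|²`. -/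
def gaussCurvature (X : OnePoint ℂ → E3) (z : ℂ) : ℝ :=
  -(Δ (fun z : ℂ => Real.log (metricFactor X z))) z / (2 * metricFactor X z)

/-- Finite total curvature: the Gauss curvature is integrable for the area form `λ dx dy` (the
point `∞` and the branch points have measure zero). -/
def FiniteTotalCurvature (P : Finset (OnePoint ℂ)) (X : OnePoint ℂ → E3) : Prop :=
  IntegrableOn (fun z : ℂ => gaussCurvature X z * metricFactor X z)
    {z : ℂ | (z : OnePoint ℂ) ∉ P}

/-- `X` has an embedded planar end at the puncture `p`: a small punctured neighbourhood of `p` is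
immersed injectively, and `X` tends to infinity in `ℝ³` and is asymptotic to an affine plane
`⟨ν, x⟩ = c` at `p`. -/
def HasEmbeddedPlanarEnd (X : OnePoint ℂ → E3) (p : OnePoint ℂ) : Prop :=
  (∃ r > 0, InjOn (localRep X p) (Metric.ball 0 r \ {0}) ∧
    ∀ ζ ∈ Metric.ball (0 : ℂ) r \ {0}, Function.Injective (fderiv ℝ (localRep X p) ζ)) ∧
  Tendsto (fun ζ => ‖localRep X p ζ‖) (𝓝[≠] 0) atTop ∧
  ∃ (ν : E3) (c : ℝ), ‖ν‖ = 1 ∧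
    Tendsto (fun ζ => inner ℝ ν (localRep X p ζ)) (𝓝[≠] 0) (𝓝 c)

/-- `X` is a complete branched minimal immersion of the sphere minus `P` with finite total
curvature and an embedded planar end at each point of `P`. -/
structure IsPlanarEndedSurface (P : Finset (OnePoint ℂ)) (X : OnePoint ℂ → E3) : Prop where
  minimal : IsBranchedMinimal P X
  complete : IsCompleteSurface P X
  finiteCurvature : FiniteTotalCurvature P X
  ends : ∀ p ∈ P, HasEmbeddedPlanarEnd X p

end RiemannSphere

end

/-!
The spinors on the sphere with simple poles at `P` are the combinations `∑ c_q K(·, q)` of Cauchy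
kernels `K(x, q) = 1 / (x - q)` (`RiemannSphere.exists_eq_sectionOfResidues`, by Liouville's theorem).
Their constant terms at the points of `P` are given by the matrix `A = (K(p, q))` with zero diagonal,
so that the space `K` is isomorphic to the kernel of `A` (`RiemannSphere.spinorK_eq_map`). This gives
finite dimension, and since `A` is skew-symmetric its rank `n - dim K` is even
(`Matrix.even_card_sub_finrank_ker_of_skew`).

The upper bound `m² ≤ n` for `m = dim K` holds for every `P`. After a Möbius transformation `P` lies
in `ℂ`, and multiplication by `∏ (z - p)` turns `K` into an `m`-dimensional space of polynomials of
degree less than `n`, in which a polynomial vanishing at a point of `P` vanishes there doubly. The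
Wronskian of such a space is nonzero of degree at most `m (n - m)`, and at each of the `n` points it
vanishes to order at least `m - 1`; comparing, `n (m - 1) ≤ m (n - m)`
(`Polynomial.sq_finrank_le_of_double_roots`).

For the lower bound let `φ` be the complex gradient `2 ∂X/∂z` of the surface. It is holomorphic by
harmonicity and isotropic by conformality. At an end, the component of `X` normal to the asymptotic
plane has a limit, so the corresponding component `q` of `φ` extends holomorphically. The other two
components combine into isotropic parts `A`, `B` with `A B = - q²`, and `q / B` is the Gauss map. The
curvature form is `- 4` times its spherical area form
(`RiemannSphere.IsBranchedMinimal.gaussCurvature_mul_metricFactor`), so finite total curvature bounds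
the spherical area of the Gauss map, and a length-area argument on small circles shows that the Gauss
map or its inverse is bounded (`eventually_norm_le_or_ge_of_finite_sphericalArea`). Hence `A` or `B`
extends holomorphically. The projection of `X` to the asymptotic plane is then `F + conj G` with `G`
holomorphic and `F` meromorphic, and injectivity of `X` forces the pole of `F` to be simple: around a
pole of order `d ≥ 2` the projection has `d` sheets, and the differences of heights between
consecutive sheets add up to zero, so that two sheets meet (`not_injOn_of_two_le_pole_order`).
Therefore `φ` has a double pole without residue at each end
(`RiemannSphere.gradComponent_expansion_at_end`).

Globally `φ` is thus rational with double poles at `P`. Because the branch points have even order, the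
isotropic components of `φ` have even order everywhere, and they are squares `s²` and `- t²` of
spinors `s, t` with simple poles, while the third component is `s t`
(`RiemannSphere.HasDoublePoles.exists_spinors`). Absence of residues in `s²`, `t²` and `s t` means
exactly that `s` and `t` have no constant terms, so both lie in `K`. If they were linearly dependent,
then `φ` would have a constant direction and `X` would be planar; without branch points this is
impossible, because `φ` would have no zeros in `ℂ` and too high an order at `∞`
(`RiemannSphere.IsPlanarEndedSurface.two_le_finrank`).
-/


/-! ### Kernels of skew-symmetric matrices -/

/-- The rank of a skew-symmetric matrix is even: on a complement of the kernel the associated form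
is nondegenerate, and a skew-symmetric matrix of odd size has determinant zero. -/
theorem Matrix.even_card_sub_finrank_ker_of_skew {ι : Type*} [Fintype ι] [DecidableEq ι]
    (A : Matrix ι ι ℂ) (hA : A.transpose = -A) :
    Even ((Fintype.card ι : ℤ) - (Module.finrank ℂ (LinearMap.ker A.mulVecLin) : ℤ)) := by
  obtain ⟨W, hW⟩ := Submodule.exists_isCompl (LinearMap.ker A.mulVecLin)
  have hsum := Submodule.finrank_add_eq_of_isCompl hW
  rw [Module.finrank_fintype_fun_eq_card] at hsum
  set r := Module.finrank ℂ W with hr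
  let b : Module.Basis (Fin r) ℂ W := Module.finBasis ℂ W
  have hskew : ∀ u v : ι → ℂ, u ⬝ᵥ A.mulVec v = -(v ⬝ᵥ A.mulVec u) := by
    intro u v
    rw [Matrix.dotProduct_mulVec, ← Matrix.mulVec_transpose, hA, Matrix.neg_mulVec,
      neg_dotProduct, dotProduct_comm]
  -- the Gram matrix of the form on the complement
  let M : Matrix (Fin r) (Fin r) ℂ :=
    Matrix.of fun i j => (b i : ι → ℂ) ⬝ᵥ A.mulVec (b j : ι → ℂ)
  have hM : M.transpose = -M := by
    ext i j
    simpa [M] using hskew (b j) (b i)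
  have hdet : M.det ≠ 0 := by
    intro h0
    obtain ⟨x, hx0, hx⟩ := Matrix.exists_mulVec_eq_zero_iff.mpr h0
    set y : W := ∑ j, x j • b j with hy
    have hyi : ∀ i, (b i : ι → ℂ) ⬝ᵥ A.mulVec (y : ι → ℂ) = 0 := by
      intro i
      have h1 : M.mulVec x i = 0 := by rw [hx]; rfl
      have h2 : A.mulVec (y : ι → ℂ) = ∑ j, x j • A.mulVec (b j : ι → ℂ) := by
        change A.mulVecLin (y : ι → ℂ) = _
        rw [hy, Submodule.coe_sum, map_sum]
        simp
      rw [h2, dotProduct_sum, ← h1]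
      simp [Matrix.mulVec, dotProduct, M, Finset.mul_sum, mul_left_comm, mul_comm]
    have hyW : ∀ w ∈ W, w ⬝ᵥ A.mulVec (y : ι → ℂ) = 0 := by
      intro w hw
      have h1 := congrArg (Subtype.val) (b.sum_repr ⟨w, hw⟩)
      rw [Submodule.coe_sum] at h1
      simp only [Submodule.coe_smul] at h1
      rw [← h1, sum_dotProduct]
      exact Finset.sum_eq_zero fun i _ => by rw [smul_dotProduct, hyi, smul_zero]
    have hyA : A.mulVec (y : ι → ℂ) = 0 := by
      apply dotProduct_eq_zero
      intro w
      rw [dotProduct_comm]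
      have hw : w ∈ LinearMap.ker A.mulVecLin ⊔ W := by rw [hW.sup_eq_top]; trivial
      obtain ⟨k, hk, w', hw', rfl⟩ := Submodule.mem_sup.mp hw
      have hk' : A.mulVec k = 0 := hk
      rw [add_dotProduct, hyW w' hw', hskew, hk', dotProduct_zero, neg_zero, add_zero]
    have hy0 : (y : ι → ℂ) = 0 := by
      have : (y : ι → ℂ) ∈ LinearMap.ker A.mulVecLin ⊓ W := ⟨hyA, y.2⟩
      rw [hW.inf_eq_bot] at this
      exact this
    have hy0' : ∑ j, x j • b j = 0 := by rw [← hy]; exact Subtype.ext hy0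
    exact hx0 (funext fun j =>
      Fintype.linearIndependent_iff.mp b.linearIndependent x hy0' j)
  have hre : Even r := by
    by_contra hodd
    rw [Nat.not_even_iff_odd] at hodd
    have h1 : M.det = -M.det := by
      conv_lhs => rw [← Matrix.det_transpose, hM, Matrix.det_neg, Fintype.card_fin, hodd.neg_one_pow]
      ring
    exact hdet (self_eq_neg.mp h1)
  have : ((Fintype.card ι : ℤ) - (Module.finrank ℂ (LinearMap.ker A.mulVecLin) : ℤ)) = (r : ℤ) := by
    rw [← hsum]; push_cast; ring
  rw [this]
  exact_mod_cast hre

/-! ### Adapted bases and the Wronskian -/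

/-- A finite-dimensional space `W` separated by a sequence of functionals `ℓ 0, ℓ 1, …` has a basis
whose orders of vanishing (the index of the first functional that is nonzero on a given vector) are
pairwise distinct. -/
theorem exists_strictMono_order_basis {K V : Type*} [Field K] [AddCommGroup V] [Module K V]
    (ℓ : ℕ → V →ₗ[K] K) (m : ℕ) : ∀ (W : Submodule K V) [FiniteDimensional K W],
    (∀ v ∈ W, (∀ i, ℓ i v = 0) → v = 0) → Module.finrank K W = m →
    ∃ (b : Fin m → V) (e : Fin m → ℕ), (∀ j, b j ∈ W) ∧ LinearIndependent K b ∧ StrictMono e ∧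
      (∀ j, ∀ i < e j, ℓ i (b j) = 0) ∧ ∀ j, ℓ (e j) (b j) ≠ 0 := by
  induction m with
  | zero =>
    intro W _ _ _
    exact ⟨Fin.elim0, Fin.elim0, fun j => j.elim0, linearIndependent_empty_type,
      fun j => j.elim0, fun j => j.elim0, fun j => j.elim0⟩
  | succ m ih =>
    intro W _ hsep hm
    have hex : ∃ i, ∃ v ∈ W, ℓ i v ≠ 0 := by
      by_contra! hall
      have hW : W = ⊥ := (Submodule.eq_bot_iff W).mpr fun v hv => hsep v hv fun i => hall i v hv
      rw [hW, finrank_bot] at hm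
      omega
    classical
    set k := Nat.find hex with hk
    obtain ⟨v, hvW, hv⟩ := Nat.find_spec hex
    have hmin : ∀ i < k, ∀ w ∈ W, ℓ i w = 0 := by
      intro i hi w hw
      have := Nat.find_min hex hi
      push Not at this
      exact this w hw
    let f : W →ₗ[K] K := (ℓ k).comp W.subtype
    have hf : Function.Surjective f := by
      apply LinearMap.surjective
      intro h0
      exact hv (by simpa [f] using LinearMap.congr_fun h0 ⟨v, hvW⟩)
    have hker : Module.finrank K (LinearMap.ker f) = m := by
      have := LinearMap.finrank_range_add_finrank_ker f
      rw [LinearMap.range_eq_top.mpr hf, finrank_top, Module.finrank_self, hm] at this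
      omega
    let W' : Submodule K V := (LinearMap.ker f).map W.subtype
    have hW'mem : ∀ w ∈ W', w ∈ W ∧ ℓ k w = 0 := by
      rintro w ⟨u, hu, rfl⟩
      exact ⟨u.2, hu⟩
    have hW' : Module.finrank K W' = m := by
      rw [← hker]
      exact Submodule.finrank_map_subtype_eq _ _
    obtain ⟨b, e, hb, hli, hmono, hz, hnz⟩ :=
      ih W' (fun w hw h => hsep w (hW'mem w hw).1 h) hW'
    have hke : ∀ j, k < e j := by
      intro j
      by_contra! hle
      rcases hle.lt_or_eq with h | h
      · exact hnz j (hmin _ h _ (hW'mem _ (hb j)).1)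
      · exact hnz j (by rw [h]; exact (hW'mem _ (hb j)).2)
    refine ⟨Fin.cons v b, Fin.cons k e, ?_, ?_, ?_, ?_, ?_⟩
    · exact Fin.cases hvW fun j => by simpa using (hW'mem _ (hb j)).1
    · rw [linearIndependent_finCons]
      refine ⟨hli, fun hmem => hv ?_⟩
      have hle : Submodule.span K (Set.range b) ≤ LinearMap.ker (ℓ k) := by
        rw [Submodule.span_le]
        rintro _ ⟨j, rfl⟩
        exact (hW'mem _ (hb j)).2
      exact hle hmem
    · intro i j
      refine Fin.cases ?_ (fun j => ?_) j
      · intro h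
        exact absurd h (Fin.not_lt_zero i)
      · refine Fin.cases ?_ (fun i => ?_) i
        · intro _
          simpa using hke j
        · intro h
          simpa using hmono (Fin.succ_lt_succ_iff.mp h)
    · exact Fin.cases (fun i hi => hmin i (by simpa using hi) v hvW) fun j => by simpa using hz j
    · exact Fin.cases (by simpa using hv) fun j => by simpa using hnz j

namespace Polynomial

/-- The Wronskian determinant of a finite family of polynomials. -/
noncomputable def wronskianDet {m : ℕ} (f : Fin m → ℂ[X]) : ℂ[X] :=
  (Matrix.of fun i j : Fin m => derivative^[(i : ℕ)] (f j)).det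

theorem wronskianDet_sum_smul {m : ℕ} (g : Fin m → ℂ[X]) (M : Matrix (Fin m) (Fin m) ℂ) :
    wronskianDet (fun j => ∑ i, M i j • g i) = wronskianDet g * C M.det := by
  have h : (Matrix.of fun i j : Fin m => derivative^[(i : ℕ)] (∑ k, M k j • g k)) =
      (Matrix.of fun i j : Fin m => derivative^[(i : ℕ)] (g j)) * C.mapMatrix M := by
    ext1 i j
    simp only [Matrix.of_apply, Matrix.mul_apply, RingHom.mapMatrix_apply, Matrix.map_apply]
    rw [iterate_derivative_sum]
    refine Finset.sum_congr rfl fun k _ => ?_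
    rw [iterate_derivative_smul, smul_eq_C_mul, mul_comm]
  rw [wronskianDet, h, Matrix.det_mul, ← RingHom.map_det]
  rfl

/-- The Wronskian of a family vanishing at `x` to orders `0, ≥ 2, ≥ 3, …` (or more) vanishes there
to order at least `m - 1`. -/
theorem X_sub_C_pow_dvd_wronskianDet {m : ℕ} (g : Fin m → ℂ[X]) (e : Fin m → ℕ) (x : ℂ)
    (hdvd : ∀ j, (X - C x) ^ e j ∣ g j) (he : ∀ j : Fin m, 0 < (j : ℕ) → (j : ℕ) + 1 ≤ e j) :
    (X - C x) ^ (m - 1) ∣ wronskianDet g := by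
  rw [wronskianDet, Matrix.det_apply]
  refine Finset.dvd_sum fun σ _ => ?_
  rw [Units.smul_def, zsmul_eq_mul]
  refine Dvd.dvd.mul_left ?_ _
  have h1 : ∏ j, (X - C x) ^ (e j - (σ j : ℕ)) ∣
      ∏ j, (Matrix.of fun i j : Fin m => derivative^[(i : ℕ)] (g j)) (σ j) j :=
    Finset.prod_dvd_prod_of_dvd _ _ fun j _ =>
      pow_sub_dvd_iterate_derivative_of_pow_dvd _ (hdvd j)
  refine Dvd.dvd.trans ?_ h1
  rw [Finset.prod_pow_eq_pow_sum]
  refine pow_dvd_pow _ ?_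
  have h2 : ∑ j, e j ≤ ∑ j, (e j - (σ j : ℕ)) + ∑ j, (σ j : ℕ) := by
    rw [← Finset.sum_add_distrib]
    exact Finset.sum_le_sum fun j _ => le_tsub_add
  have h3 : ∑ j, (σ j : ℕ) = ∑ j : Fin m, (j : ℕ) := Equiv.sum_comp σ fun j : Fin m => (j : ℕ)
  have h4 : ∑ j : Fin m, (j : ℕ) + (m - 1) ≤ ∑ j, e j := by
    cases m with
    | zero => simp
    | succ m =>
      rw [Fin.sum_univ_succ, Fin.sum_univ_succ (f := e)]
      have : ∑ j : Fin m, ((j.succ : ℕ) + 1) ≤ ∑ j : Fin m, e j.succ :=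
        Finset.sum_le_sum fun j _ => he _ (by simp)
      rw [Finset.sum_add_distrib] at this
      simp at this ⊢
      omega
  omega

/-- If the degrees `N - e j` of the polynomials `b j` are pairwise distinct, then the leading
coefficient of their Wronskian is essentially a Vandermonde determinant in the degrees. -/
theorem wronskianDet_ne_zero_and_natDegree_le {m N : ℕ} (b : Fin m → ℂ[X]) (e : Fin m → ℕ)
    (he : StrictMono e) (heN : ∀ j, e j ≤ N) (hdeg : ∀ j, (b j).natDegree ≤ N - e j)
    (hlc : ∀ j, (b j).coeff (N - e j) ≠ 0) :
    wronskianDet b ≠ 0 ∧ (wronskianDet b).natDegree + m * (m - 1) ≤ m * N := by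
  -- The Euler-type rescaling `X ^ i` of the rows and `X ^ e j` of the columns makes all entries
  -- have degree at most `N`, so that coefficients of degree `N` can be read off entrywise.
  set T : Matrix (Fin m) (Fin m) ℂ[X] :=
    Matrix.of fun i j => X ^ (i : ℕ) * (X ^ e j * derivative^[(i : ℕ)] (b j)) with hT
  have hTdet : T.det = X ^ (∑ i : Fin m, (i : ℕ)) * (X ^ (∑ j, e j) * wronskianDet b) := by
    have h1 := Matrix.det_mul_column (fun i : Fin m => (X : ℂ[X]) ^ (i : ℕ))
      (Matrix.of fun i j : Fin m => X ^ e j * derivative^[(i : ℕ)] (b j))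
    have h2 := Matrix.det_mul_row (fun j : Fin m => (X : ℂ[X]) ^ e j)
      (Matrix.of fun i j : Fin m => derivative^[(i : ℕ)] (b j))
    simp only [Matrix.of_apply] at h1 h2
    rw [hT, h1, h2, Finset.prod_pow_eq_pow_sum, Finset.prod_pow_eq_pow_sum]
    rfl
  have hTdeg : ∀ i j, (T i j).natDegree ≤ N := by
    intro i j
    have hTij : T i j = X ^ (i : ℕ) * (X ^ e j * derivative^[(i : ℕ)] (b j)) := rfl
    by_cases hi : (b j).natDegree < i
    · rw [hTij, iterate_derivative_eq_zero hi]; simp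
    · rw [hTij]
      refine natDegree_mul_le.trans ?_
      have h1 := natDegree_mul_le (p := (X : ℂ[X]) ^ e j) (q := derivative^[(i : ℕ)] (b j))
      have h2 := natDegree_iterate_derivative (b j) i
      rw [natDegree_X_pow] at h1 ⊢
      have := hdeg j
      have := heN j
      omega
  have hTcoeff : ∀ i j, (T i j).coeff N =
      (b j).coeff (N - e j) * (descPochhammer ℂ (i : ℕ)).eval ((N - e j : ℕ) : ℂ) := by
    intro i j
    have hTij : T i j = derivative^[(i : ℕ)] (b j) * X ^ ((i : ℕ) + e j) := by
      rw [pow_add, hT, Matrix.of_apply]; ring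
    rw [descPochhammer_eval_eq_descFactorial, hTij, coeff_mul_X_pow', coeff_iterate_derivative]
    split_ifs with h
    · rw [show N - ((i : ℕ) + e j) + i = N - e j by omega, nsmul_eq_mul, mul_comm]
    · have := heN j
      rw [Nat.descFactorial_eq_zero_iff_lt.mpr (by omega)]
      simp
  have hcoeff : T.det.coeff (m * N) =
      (Matrix.of fun i j : Fin m => (T i j).coeff N).det := by
    rw [Matrix.det_apply, Matrix.det_apply, finsetSum_coeff]
    refine Finset.sum_congr rfl fun σ _ => ?_
    rw [Units.smul_def, Units.smul_def, coeff_smul]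
    congr 1
    have := coeff_prod_of_natDegree_le (s := Finset.univ) (fun j => T (σ j) j) N
      (fun j _ => hTdeg _ _)
    simpa using this
  have hne : T.det.coeff (m * N) ≠ 0 := by
    rw [hcoeff]
    have h1 : (Matrix.of fun i j : Fin m => (T i j).coeff N) =
        Matrix.of fun i j : Fin m => (b j).coeff (N - e j) *
          (Matrix.of fun i j : Fin m =>
            (descPochhammer ℂ (i : ℕ)).eval ((N - e j : ℕ) : ℂ)) i j := by
      ext i j; simp [hTcoeff]
    rw [h1, Matrix.det_mul_row]
    refine mul_ne_zero (Finset.prod_ne_zero_iff.mpr fun j _ => hlc j) ?_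
    rw [← Matrix.det_transpose]
    have h2 := Matrix.det_eval_matrixOfPolynomials_eq_det_vandermonde
      (fun j : Fin m => ((N - e j : ℕ) : ℂ)) (fun i : Fin m => descPochhammer ℂ (i : ℕ))
      (fun i => descPochhammer_natDegree ℂ i) (fun i => monic_descPochhammer ℂ i)
    have h3 : (Matrix.of fun i j : Fin m =>
        (descPochhammer ℂ (i : ℕ)).eval ((N - e j : ℕ) : ℂ)).transpose =
        Matrix.of fun i j : Fin m => (descPochhammer ℂ (j : ℕ)).eval ((N - e i : ℕ) : ℂ) := by
      ext i j; rfl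
    rw [h3, ← h2, Matrix.det_vandermonde_ne_zero_iff]
    intro i j hij
    have hij' : N - e i = N - e j := Nat.cast_injective (R := ℂ) hij
    have := heN i
    have := heN j
    exact he.injective (by omega)
  have hW : wronskianDet b ≠ 0 := by
    intro h0
    rw [hTdet, h0] at hne
    simp at hne
  refine ⟨hW, ?_⟩
  have hTle : T.det.natDegree ≤ m * N := by
    rw [Matrix.det_apply]
    refine natDegree_sum_le_of_forall_le _ _ fun σ _ => ?_
    rw [Units.smul_def]
    refine (natDegree_smul_le _ _).trans ((natDegree_prod_le _ _).trans ?_)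
    refine (Finset.sum_le_sum fun j _ => hTdeg _ _).trans ?_
    simp
  rw [hTdet, natDegree_mul (pow_ne_zero _ X_ne_zero) (mul_ne_zero (pow_ne_zero _ X_ne_zero) hW),
    natDegree_mul (pow_ne_zero _ X_ne_zero) hW, natDegree_X_pow, natDegree_X_pow] at hTle
  have h1 : ∑ i : Fin m, (i : ℕ) ≤ ∑ j, e j :=
    Finset.sum_le_sum fun j _ => by
      have : ∀ k : ℕ, ∀ hk : k < m, k ≤ e ⟨k, hk⟩ := by
        intro k
        induction k with
        | zero => simp
        | succ k ih =>
          intro hk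
          exact (ih (by omega)).trans_lt (he (by simp [Fin.lt_def]))
      exact this j j.2
  have h2 : (∑ i : Fin m, (i : ℕ)) * 2 = m * (m - 1) := by
    rw [Fin.sum_univ_eq_sum_range (fun i => i), Finset.sum_range_id_mul_two]
  omega

/-- Let `V` be an `m`-dimensional space of polynomials of degree less than `n`. If at each of `n`
points every member of `V` that vanishes there has a double root, then `m ^ 2 ≤ n`: the Wronskian
of `V` has degree at most `m * (n - m)` and vanishes at each of the points to order `m - 1`. -/
theorem sq_finrank_le_of_double_roots {ι : Type*} [Fintype ι] (x : ι → ℂ)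
    (hx : Function.Injective x) (V : Submodule ℂ ℂ[X])
    (hV : V ≤ degreeLT ℂ (Fintype.card ι))
    (hdouble : ∀ g ∈ V, ∀ k, g.eval (x k) = 0 → (X - C (x k)) ^ 2 ∣ g) :
    Module.finrank ℂ V ^ 2 ≤ Fintype.card ι := by
  set n := Fintype.card ι with hn
  have hfin : FiniteDimensional ℂ V := Submodule.finiteDimensional_of_le hV
  set m := Module.finrank ℂ V with hm
  rcases Nat.eq_zero_or_pos m with hm0 | hmpos
  · rw [hm0]; simp
  have hdegV : ∀ g ∈ V, ∀ k, n ≤ k → g.coeff k = 0 := by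
    intro g hg k hk
    exact coeff_eq_zero_of_degree_lt ((mem_degreeLT.mp (hV hg)).trans_le (by exact_mod_cast hk))
  -- a basis of distinct degrees `n - 1 - e j`
  obtain ⟨b, e, hbV, hbli, hemono, hez, hene⟩ :=
    exists_strictMono_order_basis (fun i => lcoeff ℂ (n - 1 - i)) m V
      (fun g hg h => by
        ext k
        by_cases hk : n ≤ k
        · simpa using hdegV g hg k hk
        · have := h (n - 1 - k)
          rw [lcoeff_apply, show n - 1 - (n - 1 - k) = k by omega] at this
          simpa using this) hm.symm
  simp only [lcoeff_apply] at hez hene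
  have heN : ∀ j, e j ≤ n - 1 := by
    intro j
    by_contra! hlt
    have h1 := hez j (n - 1) hlt
    have h2 := hene j
    rw [show n - 1 - e j = n - 1 - (n - 1) by omega] at h2
    exact h2 h1
  have hdeg : ∀ j, (b j).natDegree ≤ n - 1 - e j := by
    intro j
    rw [natDegree_le_iff_coeff_eq_zero]
    intro k hk
    by_cases hkn : n ≤ k
    · exact hdegV _ (hbV j) k hkn
    · have := hez j (n - 1 - k) (by omega)
      rwa [show n - 1 - (n - 1 - k) = k by omega] at this
  obtain ⟨hW0, hWdeg⟩ := wronskianDet_ne_zero_and_natDegree_le b e hemono heN hdeg hene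
  have hroot : ∀ k, (X - C (x k)) ^ (m - 1) ∣ wronskianDet b := by
    intro k
    -- a basis of distinct vanishing orders `o j` at `x k`, where the order `1` does not occur
    obtain ⟨g, o, hgV, hgli, homono, hoz, hone⟩ :=
      exists_strictMono_order_basis
        (fun i => (lcoeff ℂ i).comp (taylor (x k))) m V
        (fun g hg h => by
          have : taylor (x k) g = 0 := by
            ext i
            simpa using h i
          exact taylor_injective (x k) (by simpa using this)) hm.symm
    have hoz' : ∀ j, ∀ i < o j, (taylor (x k) (g j)).coeff i = 0 := hoz
    have hdvd : ∀ j, (X - C (x k)) ^ o j ∣ g j := by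
      intro j
      rw [X_sub_C_pow_dvd_iff, X_pow_dvd_iff]
      exact hoz' j
    have hspan : ∀ j, b j ∈ Submodule.span ℂ (Set.range g) := by
      have h1 : Submodule.span ℂ (Set.range g) = V := by
        apply Submodule.eq_of_le_of_finrank_eq
        · rw [Submodule.span_le]; rintro _ ⟨j, rfl⟩; exact hgV j
        · rw [finrank_span_eq_card hgli, Fintype.card_fin]
      intro j; rw [h1]; exact hbV j
    have hM : ∀ j, ∃ c : Fin m → ℂ, ∑ i, c i • g i = b j := fun j =>
      (Submodule.mem_span_range_iff_exists_fun ℂ).mp (hspan j)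
    choose M hM using hM
    have hb : b = fun j => ∑ i, (Matrix.of fun i j => M j i) i j • g i := by
      funext j; simp [hM]
    rw [hb, wronskianDet_sum_smul]
    refine Dvd.dvd.mul_right (X_sub_C_pow_dvd_wronskianDet g o (x k) hdvd ?_) _
    have h0 : ∀ j : Fin m, 0 < (j : ℕ) → 2 ≤ o j := by
      intro j hj
      have h1 : 0 < o j := (Nat.zero_le _).trans_lt (homono (show (⟨0, hmpos⟩ : Fin m) < j from hj))
      have h2 : (g j).eval (x k) = 0 := by
        have := hoz' j 0 h1
        rwa [taylor_coeff_zero] at this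
      by_contra! hlt
      have h3 := hdouble _ (hgV j) k h2
      have h4 : o j = 1 := by omega
      have h5 := hone j
      rw [h4] at h5
      apply h5
      obtain ⟨q, hq⟩ := h3
      change (taylor (x k) (g j)).coeff 1 = 0
      rw [taylor_coeff_one, hq]
      simp [derivative_pow]
    intro j hj
    obtain ⟨i, hi⟩ := j
    simp only at hj ⊢
    induction i with
    | zero => omega
    | succ i ih =>
      rcases Nat.eq_zero_or_pos i with rfl | hi0
      · exact h0 _ hj
      · have h1 := ih (by omega) hi0
        have h2 : o ⟨i, by omega⟩ < o ⟨i + 1, hi⟩ := homono (by simp [Fin.lt_def])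
        omega
  have hprod : ∏ k, (X - C (x k)) ^ (m - 1) ∣ wronskianDet b := by
    refine Finset.prod_dvd_of_coprime ?_ fun k _ => hroot k
    intro k _ l _ hkl
    exact (pairwise_coprime_X_sub_C hx hkl).pow
  have hle := natDegree_le_of_dvd hprod hW0
  have hpd : (∏ k, (X - C (x k)) ^ (m - 1)).natDegree = n * (m - 1) := by
    rw [natDegree_prod_of_monic _ _ fun k _ => (monic_X_sub_C _).pow _]
    simp [hn]
  rw [hpd] at hle
  obtain ⟨m', hm'⟩ : ∃ m', m = m' + 1 := ⟨m - 1, by omega⟩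
  have hnpos : 1 ≤ n := by
    by_contra! h
    have : V = ⊥ := by
      rw [Submodule.eq_bot_iff]
      intro g hg; ext k; simpa using hdegV g hg k (by omega)
    rw [this, finrank_bot] at hm
    omega
  obtain ⟨n', hn'⟩ : ∃ n', n = n' + 1 := ⟨n - 1, by omega⟩
  generalize (wronskianDet b).natDegree = d at hle hWdeg
  rw [hm', hn'] at hle hWdeg ⊢
  simp only [Nat.add_sub_cancel] at hle hWdeg
  nlinarith

end Polynomial

/-! ### The matrix of constant terms -/

namespace RiemannSphere

open Polynomial in
/-- For distinct points `x k`, a vector in the kernel of `1 / (x k - x j)` is the vector of residues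
of a function `∑ c j / (z - x j)` without constant terms at its poles; clearing denominators gives
polynomials to which the Wronskian bound applies. -/
theorem sq_finrank_ker_inv_sub_le {ι : Type*} [Fintype ι] [DecidableEq ι] (x : ι → ℂ)
    (hx : Function.Injective x) :
    Module.finrank ℂ (LinearMap.ker (Matrix.of fun k j => (x k - x j)⁻¹).mulVecLin) ^ 2
      ≤ Fintype.card ι := by
  let E : (ι → ℂ) →ₗ[ℂ] ℂ[X] :=
    ∑ j, ((LinearMap.proj j : (ι → ℂ) →ₗ[ℂ] ℂ).smulRight
      (∏ l ∈ Finset.univ.erase j, (X - C (x l))))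
  have hE : ∀ c, E c = ∑ j, c j • ∏ l ∈ Finset.univ.erase j, (X - C (x l)) := fun c => by
    simp [E, LinearMap.sum_apply]
  have hsplit : ∀ c k, E c = C (c k) * ∏ l ∈ Finset.univ.erase k, (X - C (x l)) +
      (X - C (x k)) * ∑ j ∈ Finset.univ.erase k,
        c j • ∏ l ∈ (Finset.univ.erase j).erase k, (X - C (x l)) := by
    intro c k
    rw [hE, ← Finset.add_sum_erase _ _ (Finset.mem_univ k), Finset.mul_sum, smul_eq_C_mul]
    congr 1
    refine Finset.sum_congr rfl fun j hj => ?_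
    have hkj : k ∈ Finset.univ.erase j :=
      Finset.mem_erase.mpr ⟨(Finset.ne_of_mem_erase hj).symm, Finset.mem_univ _⟩
    rw [← Finset.mul_prod_erase _ _ hkj, mul_smul_comm]
  have hprod : ∀ k, (∏ l ∈ Finset.univ.erase k, (x k - x l)) ≠ 0 := fun k =>
    Finset.prod_ne_zero_iff.mpr fun l hl =>
      sub_ne_zero.mpr fun h => Finset.ne_of_mem_erase hl (hx h).symm
  have heval : ∀ c k, (E c).eval (x k) = c k * ∏ l ∈ Finset.univ.erase k, (x k - x l) := by
    intro c k
    rw [hsplit c k]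
    simp [eval_prod]
  have hinj : Function.Injective E := by
    rw [← LinearMap.ker_eq_bot, LinearMap.ker_eq_bot']
    intro c hc
    funext k
    have := heval c k
    rw [hc, eval_zero] at this
    exact (mul_eq_zero.mp this.symm).resolve_right (hprod k)
  set N := LinearMap.ker (Matrix.of fun k j => (x k - x j)⁻¹).mulVecLin with hN
  have hfr : Module.finrank ℂ (N.map E) = Module.finrank ℂ N :=
    LinearEquiv.finrank_eq (Submodule.equivMapOfInjective E hinj N).symm
  rw [← hfr]
  apply sq_finrank_le_of_double_roots x hx
  · rintro _ ⟨c, -, rfl⟩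
    rw [hE]
    refine Submodule.sum_mem _ fun j _ => Submodule.smul_mem _ _ ?_
    rw [mem_degreeLT]
    refine (degree_le_natDegree).trans_lt ?_
    rw [natDegree_prod_of_monic _ _ fun k _ => monic_X_sub_C _]
    have : 0 < Fintype.card ι := Fintype.card_pos_iff.mpr ⟨j⟩
    simp only [natDegree_X_sub_C, Finset.sum_const, smul_eq_mul, mul_one,
      Finset.card_erase_of_mem (Finset.mem_univ j), Finset.card_univ]
    exact_mod_cast Nat.sub_lt this one_pos
  · rintro _ ⟨c, hc, rfl⟩ k hk
    have hck : c k = 0 := by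
      rw [heval] at hk
      exact (mul_eq_zero.mp hk).resolve_right (hprod k)
    rw [hsplit c k, hck, C_0, zero_mul, zero_add, pow_two]
    refine mul_dvd_mul_left _ (dvd_iff_isRoot.mpr ?_)
    have hrow : ∑ j, (x k - x j)⁻¹ * c j = 0 := by
      have := congrFun (show (Matrix.of fun k j => (x k - x j)⁻¹).mulVec c = 0 from hc) k
      simpa [Matrix.mulVec, dotProduct] using this
    rw [IsRoot.def, eval_finsetSum, ← mul_zero (∏ l ∈ Finset.univ.erase k, (x k - x l)), ← hrow,
      Finset.mul_sum, ← Finset.add_sum_erase _ _ (Finset.mem_univ k), hck]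
    simp only [mul_zero, zero_add]
    refine Finset.sum_congr rfl fun j hj => ?_
    have hjk : j ∈ Finset.univ.erase k := hj
    have hne : x k - x j ≠ 0 :=
      sub_ne_zero.mpr fun h => Finset.ne_of_mem_erase hj (hx h).symm
    rw [Finset.erase_right_comm, eval_smul, eval_prod, ← Finset.mul_prod_erase _ _ hjk]
    simp only [eval_sub, eval_X, eval_C, smul_eq_mul]
    field_simp

/-- The kernel `1 / (x - y)` on the sphere: for fixed `y` it is, as a function of `x`, the section
of the spin bundle with a simple pole at `y`. The values involving `∞` are the limits of
`1 / (x - y)` in the frames `√dz` and `√dw`, up to a factor chosen so that the kernel is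
skew-symmetric; the value on the diagonal is `0`. -/
noncomputable def cauchyKernel (x y : OnePoint ℂ) : ℂ :=
  OnePoint.elim x (OnePoint.elim y 0 (fun _ => -1))
    (fun a => OnePoint.elim y 1 (fun b => (a - b)⁻¹))

@[simp] theorem cauchyKernel_coe_coe (a b : ℂ) :
    cauchyKernel (a : OnePoint ℂ) (b : OnePoint ℂ) = (a - b)⁻¹ := rfl

@[simp] theorem cauchyKernel_coe_infty (a : ℂ) : cauchyKernel (a : OnePoint ℂ) ∞ = 1 := rfl

@[simp] theorem cauchyKernel_infty_coe (b : ℂ) : cauchyKernel ∞ (b : OnePoint ℂ) = -1 := rfl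

@[simp] theorem cauchyKernel_infty_infty : cauchyKernel ∞ ∞ = 0 := rfl

theorem cauchyKernel_swap (x y : OnePoint ℂ) : cauchyKernel y x = -cauchyKernel x y := by
  induction x using OnePoint.rec with
  | infty => induction y using OnePoint.rec <;> simp
  | coe a =>
    induction y using OnePoint.rec with
    | infty => simp
    | coe b => rw [cauchyKernel_coe_coe, cauchyKernel_coe_coe, ← neg_sub, inv_neg]

/-- The skew-symmetric matrix that sends the residues of a section in `F` to its constant terms. -/
noncomputable def cauchyMatrix (P : Finset (OnePoint ℂ)) : Matrix P P ℂ :=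
  Matrix.of fun p q => cauchyKernel p q

theorem cauchyMatrix_transpose (P : Finset (OnePoint ℂ)) :
    (cauchyMatrix P).transpose = -cauchyMatrix P := by
  ext p q
  exact cauchyKernel_swap _ _

/-- A Möbius transformation that moves all the points of `P` into `ℂ` changes the matrix of constant
terms only by invertible diagonal factors. -/
theorem sq_finrank_ker_cauchyMatrix_le (P : Finset (OnePoint ℂ)) :
    Module.finrank ℂ (LinearMap.ker (cauchyMatrix P).mulVecLin) ^ 2 ≤ P.card := by
  classical
  obtain ⟨a, ha⟩ : ∃ a : ℂ, (a : OnePoint ℂ) ∉ P := by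
    by_contra! h
    exact (Set.infinite_range_of_injective OnePoint.coe_injective)
      (P.finite_toSet.subset (by rintro _ ⟨a, rfl⟩; exact h a))
  let x : OnePoint ℂ → ℂ := fun p => OnePoint.elim p 0 (fun b => (b - a)⁻¹)
  let d : OnePoint ℂ → ℂ := fun p => OnePoint.elim p (-1) (fun b => b - a)
  have hba : ∀ b : ℂ, (b : OnePoint ℂ) ∈ P → b - a ≠ 0 := fun b hb h =>
    ha (by rwa [sub_eq_zero.mp h] at hb)
  have hd : ∀ p ∈ P, d p ≠ 0 := by
    intro p hp
    induction p using OnePoint.rec with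
    | infty => simp [d]
    | coe b => exact hba b hp
  have hx : Function.Injective fun p : P => x p := by
    rintro ⟨p, hp⟩ ⟨q, hq⟩ h
    rw [Subtype.mk.injEq]
    change x p = x q at h
    induction p using OnePoint.rec with
    | infty =>
      induction q using OnePoint.rec with
      | infty => rfl
      | coe b => exact absurd h.symm (inv_ne_zero (hba b hq))
    | coe c =>
      induction q using OnePoint.rec with
      | infty => exact absurd h (inv_ne_zero (hba c hp))
      | coe b =>
        have : c - a = b - a := inv_injective h
        rw [sub_left_inj.mp this]
  have hmat : (Matrix.of fun p q : P => (x p - x q)⁻¹) =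
      Matrix.diagonal (fun p : P => -d p) * cauchyMatrix P * Matrix.diagonal fun p : P => d p := by
    ext ⟨p, hp⟩ ⟨q, hq⟩
    rw [Matrix.mul_diagonal, Matrix.diagonal_mul]
    simp only [cauchyMatrix, Matrix.of_apply]
    induction p using OnePoint.rec with
    | infty =>
      induction q using OnePoint.rec with
      | infty => simp [x]
      | coe b => simp [x, d]
    | coe c =>
      have hc := hba c hp
      induction q using OnePoint.rec with
      | infty => simp [x, d]
      | coe b =>
        have hb := hba b hq
        simp only [x, d, OnePoint.elim_some, cauchyKernel_coe_coe]
        by_cases hcb : c = b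
        · simp [hcb]
        · have h1 : c - b ≠ 0 := sub_ne_zero.mpr hcb
          have h2 : (c - a)⁻¹ - (b - a)⁻¹ = -(c - b) * ((c - a)⁻¹ * (b - a)⁻¹) := by
            field_simp; ring
          rw [h2, mul_inv, mul_inv, inv_inv, inv_inv, inv_neg]
          ring
  have hdet : ∀ f : P → ℂ, (∀ p, f p ≠ 0) → IsUnit (Matrix.diagonal f).det := fun f hf => by
    rw [Matrix.det_diagonal]
    exact (Finset.prod_ne_zero_iff.mpr fun p _ => hf p).isUnit
  have hrank : (Matrix.of fun p q : P => (x p - x q)⁻¹).rank = (cauchyMatrix P).rank := by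
    rw [hmat, Matrix.rank_mul_eq_left_of_isUnit_det _ _ (hdet _ fun p => hd p p.2),
      Matrix.rank_mul_eq_right_of_isUnit_det _ _ (hdet _ fun p => neg_ne_zero.mpr (hd p p.2))]
  have h1 := sq_finrank_ker_inv_sub_le (fun p : P => x p) hx
  have h2 := LinearMap.finrank_range_add_finrank_ker (cauchyMatrix P).mulVecLin
  have h3 := LinearMap.finrank_range_add_finrank_ker
    (Matrix.of fun p q : P => (x p - x q)⁻¹).mulVecLin
  rw [Fintype.card_coe] at h1
  simp only [Matrix.rank] at hrank
  have h4 : Module.finrank ℂ (LinearMap.ker (cauchyMatrix P).mulVecLin) =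
    Module.finrank ℂ (LinearMap.ker (Matrix.of fun p q : P => (x p - x q)⁻¹).mulVecLin) := by
    omega
  rw [h4]
  exact h1

end RiemannSphere

/-! ### Liouville's theorem with principal parts -/

/-- A function that agrees, near every point and away from that point, with a function analytic
there, is entire up to a correction of its values at the exceptional points. -/
theorem exists_differentiable_of_removable (f : ℂ → ℂ)
    (hf : ∀ z, ∃ g : ℂ → ℂ, AnalyticAt ℂ g z ∧ f =ᶠ[𝓝[≠] z] g) :
    ∃ G : ℂ → ℂ, Differentiable ℂ G ∧ ∀ z, ContinuousAt f z → G z = f z := by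
  choose g hg hfg using hf
  refine ⟨fun z => g z z, fun z => ?_, fun z hz => ?_⟩
  · have h1 : (fun w => g w w) =ᶠ[𝓝 z] g z := by
      have h2 : ∀ᶠ w in 𝓝[≠] z, g w w = g z w := by
        filter_upwards [eventually_eventually_nhdsWithin.mpr (hfg z),
          (hg z).eventually_analyticAt.filter_mono nhdsWithin_le_nhds, self_mem_nhdsWithin]
          with w hw hgw hwz
        have h3 : f =ᶠ[𝓝[≠] w] g z := by
          have h4 : f =ᶠ[𝓝 w] g z := by
            rw [IsOpen.nhdsWithin_eq isOpen_compl_singleton hwz] at hw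
            exact hw
          exact h4.filter_mono nhdsWithin_le_nhds
        exact tendsto_nhds_unique_of_eventuallyEq
          ((hg w).continuousAt.tendsto.mono_left nhdsWithin_le_nhds)
          (hgw.continuousAt.tendsto.mono_left nhdsWithin_le_nhds) ((hfg w).symm.trans h3)
      rw [eventually_nhdsWithin_iff] at h2
      filter_upwards [h2] with w hw
      by_cases hwz : w = z
      · rw [hwz]
      · exact hw hwz
    exact (hg z).differentiableAt.congr_of_eventuallyEq h1
  · exact tendsto_nhds_unique_of_eventuallyEq
      ((hg z).continuousAt.tendsto.mono_left nhdsWithin_le_nhds)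
      (hz.tendsto.mono_left nhdsWithin_le_nhds) (hfg z).symm

/-- A meromorphic function on `ℂ` that is bounded at infinity and whose principal parts are pure
poles `c p / (z - p) ^ k` is the sum of a constant and of its principal parts. -/
theorem exists_eq_const_add_sum_principal_parts (S : Finset ℂ) (f : ℂ → ℂ) (c : ℂ → ℂ) (k : ℕ)
    (hk : k ≠ 0) (hf : ∀ z ∉ S, AnalyticAt ℂ f z)
    (hS : ∀ p ∈ S, ∃ h : ℂ → ℂ, AnalyticAt ℂ h 0 ∧
      ∀ᶠ ζ in 𝓝[≠] (0 : ℂ), f (p + ζ) = c p / ζ ^ k + h ζ)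
    (hinf : f =O[Bornology.cobounded ℂ] (fun _ => (1 : ℝ))) :
    ∃ κ : ℂ, ∀ z ∉ S, f z = κ + ∑ p ∈ S, c p / (z - p) ^ k := by
  classical
  set F : ℂ → ℂ := fun z => f z - ∑ p ∈ S, c p / (z - p) ^ k with hF
  have hR : ∀ p z : ℂ, z ≠ p → AnalyticAt ℂ (fun z => c p / (z - p) ^ k) z := fun p z h =>
    analyticAt_const.div ((analyticAt_id.sub analyticAt_const).pow k)
      (pow_ne_zero _ (sub_ne_zero.mpr h))
  have hFan : ∀ z ∉ S, AnalyticAt ℂ F z := fun z hz =>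
    (hf z hz).sub (Finset.analyticAt_fun_sum _ fun p hp => hR p z fun h => hz (h ▸ hp))
  obtain ⟨G, hG, hGF⟩ := exists_differentiable_of_removable F (by
    intro z
    by_cases hz : z ∈ S
    · obtain ⟨h, hh, he⟩ := hS z hz
      refine ⟨fun w => h (w - z) - ∑ p ∈ S.erase z, c p / (w - p) ^ k, ?_, ?_⟩
      · refine AnalyticAt.sub ?_ (Finset.analyticAt_fun_sum _ fun p hp =>
          hR p z (Finset.ne_of_mem_erase hp).symm)
        refine AnalyticAt.fun_comp (g := h) ?_ (analyticAt_id.sub analyticAt_const)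
        simpa using hh
      · have ht : Tendsto (fun w : ℂ => w - z) (𝓝[≠] z) (𝓝[≠] 0) := by
          refine tendsto_nhdsWithin_iff.mpr ⟨?_, ?_⟩
          · have : Tendsto (fun w : ℂ => w - z) (𝓝 z) (𝓝 (z - z)) :=
              (continuous_id.sub continuous_const).tendsto z
            rw [sub_self] at this
            exact this.mono_left nhdsWithin_le_nhds
          · filter_upwards [self_mem_nhdsWithin] with w hw
            exact sub_ne_zero.mpr hw
        filter_upwards [ht.eventually he] with w hw
        rw [hF]
        simp only
        rw [← Finset.add_sum_erase _ _ hz, ← add_sub_cancel z w, hw, add_sub_cancel]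
        ring
    · exact ⟨F, hFan z hz, EventuallyEq.rfl⟩)
  have hRinf : ∀ p : ℂ, Tendsto (fun z => c p / (z - p) ^ k) (Bornology.cobounded ℂ) (𝓝 0) := by
    intro p
    have h1 : Tendsto (fun z : ℂ => z - p) (Bornology.cobounded ℂ) (Bornology.cobounded ℂ) :=
      tendsto_sub_const_cobounded p
    have h2 := ((tendsto_inv₀_cobounded (α := ℂ)).comp h1).pow k
    have h3 := h2.const_mul (c p)
    rw [zero_pow hk, mul_zero] at h3
    refine h3.congr fun z => ?_
    simp [div_eq_mul_inv]
  have hSinf : ∀ᶠ z in Bornology.cobounded ℂ, z ∉ S := S.finite_toSet.isBounded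
  have hGO : G =O[Bornology.cobounded ℂ] (fun _ => (1 : ℝ)) := by
    have h1 : F =O[Bornology.cobounded ℂ] (fun _ => (1 : ℝ)) := by
      refine hinf.sub ?_
      have := tendsto_finsetSum S fun p _ => hRinf p
      exact this.isBigO_one ℝ
    refine h1.congr' ?_ EventuallyEq.rfl
    filter_upwards [hSinf] with z hz
    exact (hGF z (hFan z hz).continuousAt).symm
  have hb : Bornology.IsBounded (Set.range G) := by
    obtain ⟨C, hC⟩ := hGO.bound
    obtain ⟨r, -, hr⟩ := (Filter.hasBasis_cobounded_norm (E := ℂ)).mem_iff.mp hC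
    obtain ⟨C', hC'⟩ := (isCompact_closedBall (0 : ℂ) r).exists_bound_of_continuousOn
      hG.continuous.continuousOn
    rw [isBounded_iff_forall_norm_le]
    refine ⟨max C C', ?_⟩
    rintro _ ⟨z, rfl⟩
    by_cases hz : r ≤ ‖z‖
    · have := hr hz
      simp at this
      exact this.trans (le_max_left _ _)
    · exact (hC' z (by simp; linarith)).trans (le_max_right _ _)
  refine ⟨G 0, fun z hz => ?_⟩
  rw [hG.apply_eq_apply_of_bounded hb 0 z, hGF z (hFan z hz).continuousAt, hF]
  ring

/-! ### Sections of the spin bundle with simple poles -/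

namespace RiemannSphere

/-- The points of `P` in the finite plane. -/
noncomputable def finitePoints (P : Finset (OnePoint ℂ)) : Finset ℂ :=
  P.preimage (fun z : ℂ => (z : OnePoint ℂ)) (OnePoint.coe_injective.injOn)

@[simp] theorem mem_finitePoints {P : Finset (OnePoint ℂ)} {z : ℂ} :
    z ∈ finitePoints P ↔ (z : OnePoint ℂ) ∈ P := by
  simp [finitePoints]

open Classical in
theorem sum_eq_sum_finitePoints (P : Finset (OnePoint ℂ)) {M : Type*} [AddCommMonoid M]
    (F : OnePoint ℂ → M) :
    ∑ q ∈ P, F q = ∑ b ∈ finitePoints P, F (b : OnePoint ℂ) + if ∞ ∈ P then F ∞ else 0 := by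
  have h1 : P.filter (fun q => q ≠ ∞) =
      (finitePoints P).map ⟨fun z : ℂ => (z : OnePoint ℂ), OnePoint.coe_injective⟩ := by
    ext q
    induction q using OnePoint.rec <;> simp
  have h2 : P.filter (fun q => ¬ q ≠ ∞) = if ∞ ∈ P then {∞} else ∅ := by
    ext q
    split_ifs with h
    · simp only [Finset.mem_filter, Finset.mem_singleton, not_not]
      exact ⟨fun h => h.2, fun hq => ⟨hq ▸ h, hq⟩⟩
    · simp only [Finset.mem_filter, not_not, Finset.notMem_empty, iff_false, not_and]
      exact fun hq hq' => h (hq' ▸ hq)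
  rw [← Finset.sum_filter_add_sum_filter_not P (fun q => q ≠ ∞), h1, h2, Finset.sum_map]
  congr 1
  split_ifs <;> simp

@[simp] theorem param_coe (a ζ : ℂ) : param (a : OnePoint ℂ) ζ = ((a + ζ : ℂ) : OnePoint ℂ) := rfl

theorem param_infty {ζ : ℂ} (h : ζ ≠ 0) : param ∞ ζ = ((ζ⁻¹ : ℂ) : OnePoint ℂ) := by
  simp [param, h]

@[simp] theorem param_zero (p : OnePoint ℂ) : param p 0 = p := by
  induction p using OnePoint.rec <;> simp [param]

@[simp] theorem coeff_coe (s : OnePoint ℂ → ℂ) (a ζ : ℂ) :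
    coeff s (a : OnePoint ℂ) ζ = s ((a + ζ : ℂ) : OnePoint ℂ) := rfl

theorem coeff_infty (s : OnePoint ℂ → ℂ) {ζ : ℂ} (h : ζ ≠ 0) :
    coeff s ∞ ζ = Complex.I * ζ⁻¹ * s ((ζ⁻¹ : ℂ) : OnePoint ℂ) := by
  simp [coeff, h]

theorem coeff_apply_zero (s : OnePoint ℂ → ℂ) (p : OnePoint ℂ) : coeff s p 0 = s p := by
  induction p using OnePoint.rec <;> simp [coeff]

theorem eventually_param_ne (p q : OnePoint ℂ) : ∀ᶠ ζ in 𝓝[≠] (0 : ℂ), param p ζ ≠ q := by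
  induction p using OnePoint.rec with
  | infty =>
    induction q using OnePoint.rec with
    | infty =>
      filter_upwards [self_mem_nhdsWithin] with ζ hζ
      rw [param_infty hζ]; exact OnePoint.coe_ne_infty _
    | coe b =>
      have h1 : ∀ᶠ ζ in 𝓝[≠] (0 : ℂ), ζ ≠ b⁻¹ := by
        by_cases hb : b⁻¹ = 0
        · rw [hb]; exact self_mem_nhdsWithin
        · exact (isOpen_ne.eventually_mem (Ne.symm hb)).filter_mono nhdsWithin_le_nhds
      filter_upwards [h1, self_mem_nhdsWithin] with ζ hζ h0
      rw [param_infty h0]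
      intro h
      rw [OnePoint.coe_eq_coe] at h
      exact hζ (by rw [← h, inv_inv])
  | coe a =>
    induction q using OnePoint.rec with
    | infty => exact Eventually.of_forall fun ζ => OnePoint.coe_ne_infty _
    | coe b =>
      have h1 : ∀ᶠ ζ in 𝓝[≠] (0 : ℂ), ζ ≠ b - a := by
        by_cases hb : b - a = 0
        · rw [hb]; exact self_mem_nhdsWithin
        · exact (isOpen_ne.eventually_mem (Ne.symm hb)).filter_mono nhdsWithin_le_nhds
      filter_upwards [h1] with ζ hζ h
      rw [param_coe, OnePoint.coe_eq_coe] at h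
      exact hζ (by rw [← h]; ring)

theorem eventually_param_notMem (P : Finset (OnePoint ℂ)) (p : OnePoint ℂ) :
    ∀ᶠ ζ in 𝓝[≠] (0 : ℂ), param p ζ ∉ P := by
  have h := (Filter.eventually_all_finset P).mpr fun q _ => eventually_param_ne p q
  filter_upwards [h] with ζ hζ hmem
  exact hζ _ hmem rfl

theorem eventually_coe_notMem (P : Finset (OnePoint ℂ)) {a : ℂ} (ha : (a : OnePoint ℂ) ∉ P) :
    ∀ᶠ z : ℂ in 𝓝 a, (z : OnePoint ℂ) ∉ P := by
  have h : ∀ᶠ z : ℂ in 𝓝 a, z ∉ finitePoints P :=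
    (finitePoints P).finite_toSet.isClosed.isOpen_compl.eventually_mem (by simpa using ha)
  exact h.mono fun z hz => by simpa using hz

/-- The principal part and the constant term of a Laurent expansion are unique. -/
theorem simple_pole_expansion_unique {c c' : ℂ} {h h' : ℂ → ℂ} (hh : AnalyticAt ℂ h 0)
    (hh' : AnalyticAt ℂ h' 0) (he : ∀ᶠ ζ in 𝓝[≠] (0 : ℂ), c / ζ + h ζ = c' / ζ + h' ζ) :
    c = c' ∧ h 0 = h' 0 := by
  have ht : ∀ {g : ℂ → ℂ}, AnalyticAt ℂ g 0 → Tendsto g (𝓝[≠] 0) (𝓝 (g 0)) := fun hg =>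
    hg.continuousAt.tendsto.mono_left nhdsWithin_le_nhds
  have hid : Tendsto (fun ζ : ℂ => ζ) (𝓝[≠] 0) (𝓝 0) := nhdsWithin_le_nhds
  have h1 : c = c' := by
    have e1 : Tendsto (fun ζ => c + ζ * h ζ) (𝓝[≠] 0) (𝓝 (c + 0 * h 0)) :=
      tendsto_const_nhds.add (hid.mul (ht hh))
    have e2 : Tendsto (fun ζ => c' + ζ * h' ζ) (𝓝[≠] 0) (𝓝 (c' + 0 * h' 0)) :=
      tendsto_const_nhds.add (hid.mul (ht hh'))
    have := tendsto_nhds_unique_of_eventuallyEq e1 e2 (by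
      filter_upwards [he, self_mem_nhdsWithin] with ζ hζ h0
      have h0 : ζ ≠ 0 := h0
      have := congrArg (ζ * ·) hζ
      simp only [mul_add, mul_div_cancel₀ _ h0] at this
      exact this)
    simpa using this
  subst h1
  exact ⟨rfl, tendsto_nhds_unique_of_eventuallyEq (ht hh) (ht hh') (by
    filter_upwards [he] with ζ hζ
    exact add_left_cancel hζ)⟩

/-- The factor that normalizes the values of `cauchyKernel · q` at `p` to the frame at `p`. -/
noncomputable def frameFactor (p : OnePoint ℂ) : ℂ := OnePoint.elim p (-Complex.I) (fun _ => 1)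

theorem frameFactor_ne_zero (p : OnePoint ℂ) : frameFactor p ≠ 0 := by
  induction p using OnePoint.rec <;> simp [frameFactor]

/-- The residue at its pole `p` of the section `cauchyKernel · p`. -/
noncomputable def poleFactor (p : OnePoint ℂ) : ℂ := OnePoint.elim p Complex.I (fun _ => 1)

theorem poleFactor_ne_zero (p : OnePoint ℂ) : poleFactor p ≠ 0 := by
  induction p using OnePoint.rec <;> simp [poleFactor]

open Classical in
theorem cauchyKernel_expansion (p q : OnePoint ℂ) :
    ∃ h : ℂ → ℂ, AnalyticAt ℂ h 0 ∧ h 0 = frameFactor p * cauchyKernel p q ∧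
      ∀ᶠ ζ in 𝓝[≠] (0 : ℂ), coeff (fun x => cauchyKernel x q) p ζ =
        (if p = q then poleFactor p else 0) / ζ + h ζ := by
  induction p using OnePoint.rec with
  | infty =>
    induction q using OnePoint.rec with
    | infty =>
      refine ⟨0, analyticAt_const, by simp, ?_⟩
      filter_upwards [self_mem_nhdsWithin] with ζ hζ
      rw [coeff_infty _ hζ]
      simp [poleFactor, div_eq_mul_inv]
    | coe b =>
      refine ⟨fun ζ => Complex.I * (1 - b * ζ)⁻¹, ?_, by simp [frameFactor], ?_⟩
      · refine analyticAt_const.mul (AnalyticAt.inv ?_ (by simp))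
        exact analyticAt_const.sub (analyticAt_const.mul analyticAt_id)
      · filter_upwards [self_mem_nhdsWithin] with ζ hζ
        have hζ : ζ ≠ 0 := hζ
        rw [coeff_infty _ hζ]
        have : 1 - b * ζ = ζ * (ζ⁻¹ - b) := by field_simp
        rw [this, mul_inv]
        simp [mul_assoc]
  | coe a =>
    induction q using OnePoint.rec with
    | infty => exact ⟨fun _ => 1, analyticAt_const, by simp [frameFactor],
        Eventually.of_forall fun ζ => by simp⟩
    | coe b =>
      by_cases hab : a = b
      · subst hab
        exact ⟨0, analyticAt_const, by simp, Eventually.of_forall fun ζ => by simp [poleFactor]⟩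
      · refine ⟨fun ζ => (a + ζ - b)⁻¹, ?_, by simp [frameFactor], Eventually.of_forall fun ζ => ?_⟩
        · refine AnalyticAt.inv ?_ (by simpa using sub_ne_zero.mpr hab)
          exact (analyticAt_const.add analyticAt_id).sub analyticAt_const
        · simp [hab]

open Classical in
/-- The section of the spin bundle with residues `c q` (up to the factors `poleFactor q`) at the
points `q` of `P`. -/
noncomputable def sectionOfResidues (P : Finset (OnePoint ℂ)) :
    (P → ℂ) →ₗ[ℂ] (OnePoint ℂ → ℂ) where
  toFun c x := if x ∈ P then 0 else frameFactor x * ∑ q : P, c q * cauchyKernel x q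
  map_add' c d := by
    funext x
    by_cases hx : x ∈ P <;> simp [hx, add_mul, Finset.sum_add_distrib, mul_add]
  map_smul' k c := by
    funext x
    by_cases hx : x ∈ P
    · simp [hx]
    · simp only [hx, if_false, Pi.smul_apply, smul_eq_mul, RingHom.id_apply]
      rw [Finset.mul_sum, Finset.mul_sum, Finset.mul_sum]
      exact Finset.sum_congr rfl fun q _ => by ring

theorem sectionOfResidues_of_mem {P : Finset (OnePoint ℂ)} (c : P → ℂ) {x : OnePoint ℂ}
    (hx : x ∈ P) : sectionOfResidues P c x = 0 := by
  simp [sectionOfResidues, hx]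

theorem sectionOfResidues_of_notMem {P : Finset (OnePoint ℂ)} (c : P → ℂ) {x : OnePoint ℂ}
    (hx : x ∉ P) : sectionOfResidues P c x = frameFactor x * ∑ q : P, c q * cauchyKernel x q := by
  simp [sectionOfResidues, hx]

open Classical in
theorem sectionOfResidues_expansion {P : Finset (OnePoint ℂ)} (c : P → ℂ) (p : OnePoint ℂ) :
    ∃ h : ℂ → ℂ, AnalyticAt ℂ h 0 ∧ h 0 = frameFactor p * ∑ q : P, c q * cauchyKernel p q ∧
      ∀ᶠ ζ in 𝓝[≠] (0 : ℂ), coeff (sectionOfResidues P c) p ζ =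
        (if hp : p ∈ P then c ⟨p, hp⟩ * poleFactor p else 0) / ζ + h ζ := by
  choose h hh h0 he using fun q : P => cauchyKernel_expansion p q
  refine ⟨fun ζ => ∑ q, c q * h q ζ, ?_, ?_, ?_⟩
  · exact Finset.analyticAt_fun_sum _ fun q _ => analyticAt_const.mul (hh q)
  · simp only [h0]
    rw [Finset.mul_sum]
    exact Finset.sum_congr rfl fun q _ => by ring
  · have hall := Filter.eventually_all.mpr he
    filter_upwards [hall, eventually_param_notMem P p, self_mem_nhdsWithin] with ζ hζ hP hne
    have hne : ζ ≠ 0 := hne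
    have h1 : coeff (sectionOfResidues P c) p ζ =
        ∑ q : P, c q * coeff (fun x => cauchyKernel x q) p ζ := by
      induction p using OnePoint.rec with
      | infty =>
        rw [param_infty hne] at hP
        rw [coeff_infty _ hne, sectionOfResidues_of_notMem c hP, Finset.mul_sum, Finset.mul_sum]
        refine Finset.sum_congr rfl fun q _ => ?_
        rw [coeff_infty _ hne]
        simp only [frameFactor, OnePoint.elim_some]
        ring
      | coe a =>
        rw [param_coe] at hP
        rw [coeff_coe, sectionOfResidues_of_notMem c hP]
        simp [frameFactor]
    rw [h1]
    simp only [hζ, mul_add, Finset.sum_add_distrib]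
    congr 1
    by_cases hp : p ∈ P
    · rw [dif_pos hp, Finset.sum_eq_single (⟨p, hp⟩ : P)]
      · simp [mul_div_assoc]
      · intro q _ hq
        have : p ≠ q := fun h => hq (Subtype.ext h.symm)
        simp [this]
      · simp
    · rw [dif_neg hp, zero_div]
      refine Finset.sum_eq_zero fun q _ => ?_
      have : p ≠ q := fun h => hp (h ▸ q.2)
      simp [this]

theorem sectionOfResidues_mem (P : Finset (OnePoint ℂ)) (c : P → ℂ) :
    sectionOfResidues P c ∈ spinorF P := by
  classical
  refine ⟨fun p hp => ?_, fun p hp => ⟨sectionOfResidues_of_mem c hp, ?_⟩⟩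
  · obtain ⟨h, hh, h0, he⟩ := sectionOfResidues_expansion c p
    refine hh.congr ?_
    rw [dif_neg hp] at he
    rw [eventually_nhdsWithin_iff] at he
    filter_upwards [he] with ζ hζ
    by_cases hz : ζ = 0
    · rw [hz, h0, coeff_apply_zero, sectionOfResidues_of_notMem c hp]
    · rw [hζ hz, zero_div, zero_add]
  · obtain ⟨h, hh, -, he⟩ := sectionOfResidues_expansion c p
    exact ⟨_, h, hh, he⟩

theorem sectionOfResidues_injective (P : Finset (OnePoint ℂ)) :
    Function.Injective (sectionOfResidues P) := by
  classical
  rw [← LinearMap.ker_eq_bot, LinearMap.ker_eq_bot']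
  intro c hc
  funext ⟨p, hp⟩
  obtain ⟨h, hh, -, he⟩ := sectionOfResidues_expansion c p
  rw [hc, coeff_zero, dif_pos hp] at he
  have := (simple_pole_expansion_unique (c := 0) (h := fun _ => 0) analyticAt_const hh
    (by filter_upwards [he] with ζ hζ; simpa using hζ)).1
  exact (mul_eq_zero.mp this.symm).resolve_right (poleFactor_ne_zero p)

theorem analyticAt_of_analyticAt_translate {f : ℂ → ℂ} {a : ℂ}
    (h : AnalyticAt ℂ (fun ζ => f (a + ζ)) 0) : AnalyticAt ℂ f a := by
  have h1 : AnalyticAt ℂ ((fun ζ => f (a + ζ)) ∘ fun z => z - a) a :=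
    AnalyticAt.comp (by simpa using h) (analyticAt_id.sub analyticAt_const)
  refine h1.congr (Eventually.of_forall fun z => ?_)
  simp

theorem tendsto_cobounded_of_tendsto_inv {f : ℂ → ℂ} {l : Filter ℂ}
    (h : Tendsto (fun w => f w⁻¹) (𝓝[≠] 0) l) : Tendsto f (Bornology.cobounded ℂ) l := by
  have h1 := h.comp (Filter.tendsto_inv₀_cobounded' (α := ℂ))
  refine h1.congr fun z => ?_
  simp

/-- The sections in `F` are the combinations of Cauchy kernels: the difference between a section and
the sum of its principal parts is constant by Liouville's theorem. -/
theorem exists_eq_sectionOfResidues {P : Finset (OnePoint ℂ)} {s : OnePoint ℂ → ℂ}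
    (hs : s ∈ spinorF P) : ∃ c : P → ℂ, sectionOfResidues P c = s := by
  classical
  obtain ⟨hsan, hspole⟩ := hs
  have hex : ∀ p : OnePoint ℂ, ∃ c : ℂ, p ∈ P → ∃ h : ℂ → ℂ, AnalyticAt ℂ h 0 ∧
      ∀ᶠ ζ in 𝓝[≠] 0, coeff s p ζ = c / ζ + h ζ := by
    intro p
    by_cases hp : p ∈ P
    · obtain ⟨c, h, hh, he⟩ := (hspole p hp).2
      exact ⟨c, fun _ => ⟨h, hh, he⟩⟩
    · exact ⟨0, fun h => absurd h hp⟩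
  choose r hr using hex
  set f : ℂ → ℂ := fun z => s z with hf
  have hinf : ∃ L : ℂ, Tendsto f (Bornology.cobounded ℂ) (𝓝 L) ∧ (∞ ∉ P → L = 0) := by
    have hid : Tendsto (fun ζ : ℂ => ζ) (𝓝[≠] 0) (𝓝 0) := nhdsWithin_le_nhds
    have hw : ∀ w : ℂ, w ≠ 0 → f w⁻¹ = -Complex.I * (w * coeff s ∞ w) := by
      intro w hw
      rw [coeff_infty _ hw]
      have : -Complex.I * (w * (Complex.I * w⁻¹ * s ((w⁻¹ : ℂ) : OnePoint ℂ))) =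
        -(Complex.I * Complex.I) * (w * w⁻¹) * s ((w⁻¹ : ℂ) : OnePoint ℂ) := by ring
      rw [this, mul_inv_cancel₀ hw, Complex.I_mul_I]
      simp [hf]
    by_cases hP : ∞ ∈ P
    · obtain ⟨h, hh, he⟩ := hr ∞ hP
      refine ⟨-Complex.I * (r ∞ + 0 * h 0), tendsto_cobounded_of_tendsto_inv ?_, fun h => absurd hP h⟩
      have ht : Tendsto (fun w => -Complex.I * (r ∞ + w * h w)) (𝓝[≠] 0)
          (𝓝 (-Complex.I * (r ∞ + 0 * h 0))) :=
        (tendsto_const_nhds.add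
          (hid.mul (hh.continuousAt.tendsto.mono_left nhdsWithin_le_nhds))).const_mul _
      refine ht.congr' ?_
      filter_upwards [he, self_mem_nhdsWithin] with w he hw0
      have hw0 : w ≠ 0 := hw0
      rw [hw w hw0, he, mul_add w, mul_div_cancel₀ _ hw0]
    · refine ⟨-Complex.I * (0 * coeff s ∞ 0), tendsto_cobounded_of_tendsto_inv ?_, fun _ => by simp⟩
      have ht : Tendsto (fun w => -Complex.I * (w * coeff s ∞ w)) (𝓝[≠] 0)
          (𝓝 (-Complex.I * (0 * coeff s ∞ 0))) :=
        (hid.mul ((hsan ∞ hP).continuousAt.tendsto.mono_left nhdsWithin_le_nhds)).const_mul _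
      refine ht.congr' ?_
      filter_upwards [self_mem_nhdsWithin] with w hw0
      rw [hw w hw0]
  obtain ⟨L, hL, hL0⟩ := hinf
  obtain ⟨κ, hκ⟩ := exists_eq_const_add_sum_principal_parts (finitePoints P) f
    (fun p => r p) 1 one_ne_zero
    (fun z hz => analyticAt_of_analyticAt_translate (hsan z (by simpa using hz)))
    (fun p hp => by
      obtain ⟨h, hh, he⟩ := hr p (by simpa using hp)
      refine ⟨h, hh, ?_⟩
      filter_upwards [he] with ζ hζ
      rw [pow_one, ← hζ]; rfl)
    (hL.isBigO_one ℝ)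
  simp only [pow_one] at hκ
  have hκ0 : ∞ ∉ P → κ = 0 := by
    intro hP
    have h1 : Tendsto (fun z : ℂ => κ + ∑ p ∈ finitePoints P, r p / (z - p))
        (Bornology.cobounded ℂ) (𝓝 (κ + ∑ p ∈ finitePoints P, 0)) := by
      refine tendsto_const_nhds.add (tendsto_finsetSum _ fun p _ => ?_)
      have h2 : Tendsto (fun z : ℂ => z - p) (Bornology.cobounded ℂ) (Bornology.cobounded ℂ) :=
        tendsto_sub_const_cobounded p
      have := ((tendsto_inv₀_cobounded (α := ℂ)).comp h2).const_mul (r p)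
      rw [mul_zero] at this
      exact this
    have h2 : ∀ᶠ z in Bornology.cobounded ℂ, z ∉ finitePoints P :=
      (finitePoints P).finite_toSet.isBounded
    have := tendsto_nhds_unique_of_eventuallyEq hL h1 (by
      filter_upwards [h2] with z hz
      exact hκ z hz)
    simpa [hL0 hP] using this.symm
  let c : P → ℂ := fun q => OnePoint.elim (q : OnePoint ℂ) κ (fun b => r b)
  have hfin : ∀ z : ℂ, (z : OnePoint ℂ) ∉ P → sectionOfResidues P c z = s z := by
    intro z hz
    rw [sectionOfResidues_of_notMem c hz]
    have h1 : ∑ q : P, c q * cauchyKernel z q =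
        ∑ q ∈ P, OnePoint.elim q κ (fun b => r b) * cauchyKernel z q :=
      Finset.sum_coe_sort P (fun q => OnePoint.elim q κ (fun b => r b) * cauchyKernel z q)
    have h2 := hκ z (by simpa using hz)
    rw [h1, sum_eq_sum_finitePoints]
    simp only [hf] at h2
    rw [h2]
    simp only [frameFactor, OnePoint.elim_some, OnePoint.elim_infty, one_mul,
      cauchyKernel_coe_coe, cauchyKernel_coe_infty, mul_one, div_eq_mul_inv]
    rw [add_comm]
    congr 1
    split_ifs with h
    · rfl
    · exact (hκ0 h).symm
  refine ⟨c, funext fun x => ?_⟩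
  by_cases hx : x ∈ P
  · rw [sectionOfResidues_of_mem c hx, (hspole x hx).1]
  · induction x using OnePoint.rec with
    | coe z => exact hfin z hx
    | infty =>
      have h1 := (sectionOfResidues_mem P c).1 ∞ hx
      have h2 := hsan ∞ hx
      have hle : 𝓝[≠] (0 : ℂ) ≤ 𝓝 0 := nhdsWithin_le_nhds
      rw [← coeff_apply_zero (sectionOfResidues P c), ← coeff_apply_zero s]
      refine tendsto_nhds_unique_of_eventuallyEq
        (h1.continuousAt.tendsto.mono_left hle) (h2.continuousAt.tendsto.mono_left hle) ?_
      filter_upwards [self_mem_nhdsWithin, eventually_param_notMem P ∞] with w hw hwP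
      rw [param_infty hw] at hwP
      rw [coeff_infty _ hw, coeff_infty _ hw, hfin _ hwP]

/-- `K` corresponds to the kernel of the skew-symmetric matrix of constant terms. -/
theorem spinorK_eq_map (P : Finset (OnePoint ℂ)) :
    spinorK P = (LinearMap.ker (cauchyMatrix P).mulVecLin).map (sectionOfResidues P) := by
  classical
  have hrow : ∀ (c : P → ℂ) (p : P), (cauchyMatrix P).mulVec c p =
      ∑ q : P, c q * cauchyKernel p q := fun c p => by
    simp [Matrix.mulVec, dotProduct, cauchyMatrix, mul_comm]
  ext s
  constructor
  · rintro ⟨hF, hK⟩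
    obtain ⟨c, rfl⟩ := exists_eq_sectionOfResidues hF
    refine ⟨c, ?_, rfl⟩
    change (cauchyMatrix P).mulVec c = 0
    funext p
    obtain ⟨d, k, hk, hk0, hke⟩ := hK p p.2
    obtain ⟨h, hh, h0, he⟩ := sectionOfResidues_expansion c p
    have := (simple_pole_expansion_unique hh hk (by
      filter_upwards [he, hke] with ζ h1 h2
      rw [← h1, ← h2])).2
    rw [h0, hk0] at this
    rw [hrow, Pi.zero_apply]
    exact (mul_eq_zero.mp this).resolve_left (frameFactor_ne_zero _)
  · rintro ⟨c, hc, rfl⟩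
    refine ⟨sectionOfResidues_mem P c, fun p hp => ?_⟩
    obtain ⟨h, hh, h0, he⟩ := sectionOfResidues_expansion c p
    refine ⟨_, h, hh, ?_, he⟩
    have hc' : (cauchyMatrix P).mulVec c = 0 := hc
    rw [h0, ← hrow c ⟨p, hp⟩, hc', Pi.zero_apply, mul_zero]

theorem finrank_spinorK (P : Finset (OnePoint ℂ)) :
    Module.finrank ℂ (spinorK P) = Module.finrank ℂ (LinearMap.ker (cauchyMatrix P).mulVecLin) := by
  rw [spinorK_eq_map]
  exact (LinearEquiv.finrank_eq (Submodule.equivMapOfInjective _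
    (sectionOfResidues_injective P) _)).symm

theorem finiteDimensional_spinorK (P : Finset (OnePoint ℂ)) :
    FiniteDimensional ℂ (spinorK P) := by
  rw [spinorK_eq_map]
  infer_instance

end RiemannSphere

/-! ### Isolated singularities of finite spherical area -/

theorem deriv_continuousOn_of_differentiableOn {g : ℂ → ℂ} {s : Set ℂ} (hs : IsOpen s)
    (hg : DifferentiableOn ℂ g s) : ContinuousOn (deriv g) s :=
  (hg.deriv hs).continuousOn

theorem isOpen_puncturedBall (r : ℝ) : IsOpen (Metric.ball (0 : ℂ) r \ {0}) :=
  Metric.isOpen_ball.sdiff isClosed_singleton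

theorem puncturedBall_mem_nhdsWithin {r : ℝ} (hr : 0 < r) :
    Metric.ball (0 : ℂ) r \ {0} ∈ 𝓝[≠] (0 : ℂ) :=
  sdiff_mem_nhdsWithin_compl (Metric.ball_mem_nhds _ hr) _

theorem exists_puncturedBall_of_eventually {p : ℂ → Prop} (h : ∀ᶠ ζ in 𝓝[≠] (0 : ℂ), p ζ) :
    ∃ r > 0, ∀ ζ ∈ Metric.ball (0 : ℂ) r \ {0}, p ζ := by
  rw [eventually_nhdsWithin_iff, Metric.eventually_nhds_iff_ball] at h
  obtain ⟨r, hr, h⟩ := h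
  exact ⟨r, hr, fun ζ hζ => h ζ hζ.1 hζ.2⟩

/-- If a circle is mapped by `g` across the annulus `1 / 2 ≤ |w| ≤ 2`, then its image has spherical
length bounded below, hence by the arithmetic-geometric mean inequality the mean of the spherical
area density over the circle is bounded below by a multiple of `1 / ρ ^ 2`. -/
theorem le_integral_sphericalDensity_circle {g : ℂ → ℂ} {r ρ : ℝ} (hρ : 0 < ρ) (hρr : ρ < r)
    (hg : DifferentiableOn ℂ g (Metric.ball 0 r \ {0})) {ζ₁ ζ₂ : ℂ} (h₁ : ‖ζ₁‖ = ρ)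
    (h₂ : ‖ζ₂‖ = ρ) (hg₁ : 2 < ‖g ζ₁‖) (hg₂ : ‖g ζ₂‖ < 1 / 2) :
    0.18 / (Real.pi * ρ ^ 2) ≤ ∫ θ in (-Real.pi)..Real.pi,
      ‖deriv g (ρ * Complex.exp (θ * Complex.I))‖ ^ 2 /
        (1 + ‖g (ρ * Complex.exp (θ * Complex.I))‖ ^ 2) ^ 2 := by
  set c : ℝ → ℂ := fun θ => ρ * Complex.exp (θ * Complex.I) with hc
  have hcnorm : ∀ θ, ‖c θ‖ = ρ := fun θ => by
    simp [hc, Complex.norm_exp_ofReal_mul_I, abs_of_pos hρ]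
  have hcmem : ∀ θ, c θ ∈ Metric.ball (0 : ℂ) r \ {0} := fun θ => by
    refine ⟨by simpa [hcnorm θ] using hρr, fun h => ?_⟩
    have := hcnorm θ
    rw [h, norm_zero] at this
    linarith
  have hopen := isOpen_puncturedBall r
  have hcderiv : ∀ θ, HasDerivAt c (c θ * Complex.I) θ := fun θ => by
    have h1 : HasDerivAt (fun θ : ℝ => (θ : ℂ) * Complex.I) (1 * Complex.I) θ :=
      (Complex.ofRealCLM.hasDerivAt).mul_const _
    have := (h1.cexp).const_mul (ρ : ℂ)
    rw [one_mul, ← mul_assoc] at this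
    exact this
  have hccont : Continuous c := continuous_iff_continuousAt.mpr fun θ => (hcderiv θ).continuousAt
  have hgc : Continuous fun θ => g (c θ) :=
    hg.continuousOn.comp_continuous hccont hcmem
  have hg'c : Continuous fun θ => deriv g (c θ) :=
    (deriv_continuousOn_of_differentiableOn hopen hg).comp_continuous hccont hcmem
  have hgder : ∀ θ, HasDerivAt (fun θ => g (c θ)) (deriv g (c θ) * (c θ * Complex.I)) θ := fun θ =>
    ((hg.differentiableAt (hopen.mem_nhds (hcmem θ))).hasDerivAt).comp_of_eq θ (hcderiv θ) rfl
  set e : ℝ → ℝ := fun θ => ‖deriv g (c θ)‖ ^ 2 / (1 + ‖g (c θ)‖ ^ 2) ^ 2 with he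
  have hecont : Continuous e := (hg'c.norm.pow 2).div ((continuous_const.add (hgc.norm.pow 2)).pow 2)
    fun θ => by positivity
  -- `ψ` is a smooth spherical height function; it is below `1 / 5` at `ζ₁` and exceeds `4 / 5`
  -- at `ζ₂`.
  set ψ : ℝ → ℝ := fun θ => (1 + ‖g (c θ)‖ ^ 2)⁻¹ with hψ
  -- `|ψ'| ≤ ρ √e ≤ ε / 2 + ρ² e / (2 ε)`, and with this `ε` the constant term contributes `0.3`,
  -- half of the variation `3 / 5` of `ψ`, over the whole circle.
  set ε : ℝ := 0.3 / Real.pi with hε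
  have hπ := Real.pi_pos
  have hεpos : 0 < ε := by positivity
  set φ : ℝ → ℝ := fun θ => ε / 2 + ρ ^ 2 / (2 * ε) * e θ with hφ
  have hφcont : Continuous φ := continuous_const.add (continuous_const.mul hecont)
  have hφnn : ∀ θ, 0 ≤ φ θ := fun θ => by
    have : 0 ≤ e θ := by positivity
    positivity
  have hψder : ∀ θ, ∃ d, HasDerivAt ψ d θ ∧ |d| ≤ φ θ := by
    intro θ
    have h1 := (hgder θ).norm_sq
    have h2 := (h1.const_add 1).inv (by positivity)
    refine ⟨_, h2, ?_⟩
    set a := ‖g (c θ)‖ with ha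
    set b := ‖deriv g (c θ)‖ with hb
    have hin : |inner ℝ (g (c θ)) (deriv g (c θ) * (c θ * Complex.I))| ≤ a * (b * ρ) := by
      refine (abs_real_inner_le_norm _ _).trans ?_
      rw [norm_mul, norm_mul, hcnorm, Complex.norm_I, mul_one]
    rw [abs_div, abs_neg, abs_mul, abs_of_pos (by positivity : (0 : ℝ) < (1 + a ^ 2) ^ 2),
      div_le_iff₀ (by positivity)]
    have hb0 : 0 ≤ b := norm_nonneg _
    have ha0 : 0 ≤ a := norm_nonneg _
    have hx : φ θ * (1 + a ^ 2) ^ 2 = ε / 2 * (1 + a ^ 2) ^ 2 + (ρ * b) ^ 2 / (2 * ε) := by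
      change (ε / 2 + ρ ^ 2 / (2 * ε) * (b ^ 2 / (1 + a ^ 2) ^ 2)) * (1 + a ^ 2) ^ 2 = _
      field_simp
    rw [hx]
    have h3 : ρ * b * (1 + a ^ 2) ≤ ε / 2 * (1 + a ^ 2) ^ 2 + (ρ * b) ^ 2 / (2 * ε) := by
      have : 0 ≤ (ε * (1 + a ^ 2) - ρ * b) ^ 2 / (2 * ε) := by positivity
      have h4 : (ε * (1 + a ^ 2) - ρ * b) ^ 2 / (2 * ε) =
        ε / 2 * (1 + a ^ 2) ^ 2 + (ρ * b) ^ 2 / (2 * ε) - ρ * b * (1 + a ^ 2) := by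
        field_simp; ring
      linarith
    have h5 : |(2 : ℝ)| * |inner ℝ (g (c θ)) (deriv g (c θ) * (c θ * Complex.I))| ≤
        ρ * b * (1 + a ^ 2) := by
      rw [abs_two]
      nlinarith [mul_nonneg (mul_nonneg hρ.le hb0) (sq_nonneg (a - 1))]
    exact h5.trans h3
  choose d hd hdφ using hψder
  have hψcont : Continuous ψ := continuous_iff_continuousAt.mpr fun θ => (hd θ).continuousAt
  have hφtot : ∀ α β : ℝ, -Real.pi ≤ α → α ≤ β → β ≤ Real.pi →
      |ψ β - ψ α| ≤ 0.3 + ρ ^ 2 / (2 * ε) * ∫ θ in (-Real.pi)..Real.pi, e θ := by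
    intro α β hα hαβ hβ
    have hle : ∫ θ in α..β, φ θ ≤ ∫ θ in (-Real.pi)..Real.pi, φ θ :=
      intervalIntegral.integral_mono_interval hα hαβ hβ
        (Eventually.of_forall hφnn) (hφcont.intervalIntegrable _ _)
    have htot : ∫ θ in (-Real.pi)..Real.pi, φ θ =
        0.3 + ρ ^ 2 / (2 * ε) * ∫ θ in (-Real.pi)..Real.pi, e θ := by
      have hi : IntervalIntegrable (fun θ => ρ ^ 2 / (2 * ε) * e θ) volume (-Real.pi) Real.pi :=
        (continuous_const.mul hecont).intervalIntegrable _ _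
      simp only [hφ]
      rw [intervalIntegral.integral_add (continuous_const.intervalIntegrable _ _) hi,
        intervalIntegral.integral_const, intervalIntegral.integral_const_mul]
      congr 1
      rw [hε, smul_eq_mul]
      field_simp
      ring
    rw [← htot]
    refine le_trans (abs_le'.mpr ⟨?_, ?_⟩) hle
    · exact intervalIntegral.sub_le_integral_of_hasDeriv_right_of_le hαβ hψcont.continuousOn
        (fun x _ => (hd x).hasDerivWithinAt) hφcont.continuousOn.integrableOn_Icc
        (fun x _ => (le_abs_self _).trans (hdφ x))
    · have := intervalIntegral.sub_le_integral_of_hasDeriv_right_of_le hαβ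
        hψcont.neg.continuousOn
        (fun x _ => (hd x).neg.hasDerivWithinAt) hφcont.continuousOn.integrableOn_Icc
        (fun x _ => (neg_le_abs _).trans (hdφ x))
      simp only [Pi.neg_apply] at this
      linarith
  have hrep : ∀ ζ : ℂ, ‖ζ‖ = ρ → c ζ.arg = ζ := fun ζ hζ => by
    simp only [hc]
    rw [← hζ]
    exact Complex.norm_mul_exp_arg_mul_I ζ
  have hdiff : 0.6 ≤ |ψ (ζ₂.arg) - ψ (ζ₁.arg)| := by
    refine le_trans ?_ (le_abs_self _)
    have e1 : ψ ζ₁.arg ≤ 1 / 5 := by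
      simp only [hψ]
      rw [hrep _ h₁, ← one_div]
      exact one_div_le_one_div_of_le (by norm_num) (by nlinarith)
    have e2 : 4 / 5 ≤ ψ ζ₂.arg := by
      simp only [hψ]
      rw [hrep _ h₂, show (4 / 5 : ℝ) = (5 / 4)⁻¹ by norm_num]
      refine inv_anti₀ (by positivity) ?_
      nlinarith [norm_nonneg (g ζ₂)]
    norm_num at e1 e2 ⊢
    linarith
  have hfin : 0.6 ≤ 0.3 + ρ ^ 2 / (2 * ε) * ∫ θ in (-Real.pi)..Real.pi, e θ := by
    refine hdiff.trans ?_
    rcases le_total ζ₁.arg ζ₂.arg with h | h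
    · exact hφtot _ _ (Complex.neg_pi_lt_arg _).le h (Complex.arg_le_pi _)
    · rw [abs_sub_comm]
      exact hφtot _ _ (Complex.neg_pi_lt_arg _).le h (Complex.arg_le_pi _)
  have h3 : 0.3 ≤ ρ ^ 2 / (2 * ε) * ∫ θ in (-Real.pi)..Real.pi, e θ := by
    norm_num at hfin ⊢
    linarith
  have h4 : ρ ^ 2 / (2 * ε) = ρ ^ 2 * Real.pi / 0.6 := by
    rw [hε]; field_simp; norm_num
  rw [h4] at h3
  rw [div_le_iff₀ (by positivity)]
  rw [div_mul_eq_mul_div, le_div_iff₀ (by norm_num)] at h3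
  norm_num at h3 ⊢
  linarith

/-- A holomorphic function of finite spherical area near an isolated singularity is bounded by `2`,
or bounded below by `1 / 2`, on arbitrarily small circles: otherwise each small circle contributes
at least `c / ρ` to the area. -/
theorem exists_circle_norm_le_or_ge {g : ℂ → ℂ} {r : ℝ} (hr : 0 < r)
    (hg : DifferentiableOn ℂ g (Metric.ball 0 r \ {0}))
    (harea : ∫⁻ ζ in Metric.ball (0 : ℂ) r \ {0},
      ENNReal.ofReal (‖deriv g ζ‖ ^ 2 / (1 + ‖g ζ‖ ^ 2) ^ 2) ≠ ⊤) :
    ∃ᶠ ρ in 𝓝[>] (0 : ℝ), (∀ ζ, ‖ζ‖ = ρ → ‖g ζ‖ ≤ 2) ∨ (∀ ζ, ‖ζ‖ = ρ → 1 / 2 ≤ ‖g ζ‖) := by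
  intro hcon
  obtain ⟨δ₀, hδ₀, hδ⟩ := (mem_nhdsGT_iff_exists_Ioo_subset).mp hcon
  have hδ₀ : 0 < δ₀ := hδ₀
  set δ := min δ₀ r with hδdef
  have hδpos : 0 < δ := lt_min hδ₀ hr
  have hcross : ∀ ρ ∈ Ioo 0 δ, ∃ ζ₁ ζ₂ : ℂ, ‖ζ₁‖ = ρ ∧ ‖ζ₂‖ = ρ ∧ 2 < ‖g ζ₁‖ ∧ ‖g ζ₂‖ < 1 / 2 := by
    intro ρ hρ
    have := hδ ⟨hρ.1, hρ.2.trans_le (min_le_left _ _)⟩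
    simp only [mem_ofPred_eq, not_or, not_forall, not_le] at this
    obtain ⟨⟨ζ₁, h1, h1'⟩, ⟨ζ₂, h2, h2'⟩⟩ := this
    exact ⟨ζ₁, ζ₂, h1, h2, h1', h2'⟩
  set E : ℂ → ℝ := fun ζ => ‖deriv g ζ‖ ^ 2 / (1 + ‖g ζ‖ ^ 2) ^ 2 with hE
  set B := Metric.ball (0 : ℂ) r \ {0} with hB
  have hBo : IsOpen B := isOpen_puncturedBall r
  have hEcont : ContinuousOn E B :=
    ((deriv_continuousOn_of_differentiableOn hBo hg).norm.pow 2).div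
      ((continuousOn_const.add (hg.continuousOn.norm.pow 2)).pow 2) fun ζ _ => by positivity
  have hE0 : ∀ ζ, 0 ≤ E ζ := fun ζ => by positivity
  set T : Set (ℝ × ℝ) := Ioo 0 δ ×ˢ Ioo (-Real.pi) Real.pi with hT
  have hTmeas : MeasurableSet T := measurableSet_Ioo.prod measurableSet_Ioo
  have hsymm : ∀ q : ℝ × ℝ,
      Complex.polarCoord.symm q = q.1 * Complex.exp (q.2 * Complex.I) := fun q => by
    rw [Complex.polarCoord_symm_apply, Complex.exp_mul_I]
    simp
  have hTB : ∀ q ∈ T, Complex.polarCoord.symm q ∈ B := by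
    rintro ⟨ρ, θ⟩ ⟨hρ, -⟩
    have hn : ‖Complex.polarCoord.symm (ρ, θ)‖ = ρ := by
      rw [Complex.norm_polarCoord_symm]; exact abs_of_pos hρ.1
    refine ⟨?_, fun h => ?_⟩
    · rw [mem_ball_zero_iff, hn]; exact hρ.2.trans_le (min_le_right _ _)
    · rw [h, norm_zero] at hn; exact hρ.1.ne hn
  have hsymmcont : Continuous fun q : ℝ × ℝ => Complex.polarCoord.symm q := by
    simp only [hsymm]; fun_prop
  set H : ℝ × ℝ → ENNReal := fun q => ENNReal.ofReal (q.1 * E (Complex.polarCoord.symm q)) with hH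
  have hpolar : ∫⁻ q in T, H q ≤ ∫⁻ ζ in B, ENNReal.ofReal (E ζ) := by
    rw [← lintegral_indicator hBo.measurableSet, ← Complex.lintegral_comp_polarCoord_symm]
    have hsub : T ⊆ Complex.polarCoord.target := by
      rw [Complex.polarCoord_target]
      exact Set.prod_mono Ioo_subset_Ioi_self subset_rfl
    refine le_trans ?_ (lintegral_mono_set hsub)
    refine setLIntegral_mono' hTmeas fun q hq => ?_
    rw [indicator_of_mem (hTB q hq), smul_eq_mul, ← ENNReal.ofReal_mul hq.1.1.le]
  have hHmeas : AEMeasurable H ((volume.restrict (Ioo 0 δ)).prod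
      (volume.restrict (Ioo (-Real.pi) Real.pi))) := by
    rw [Measure.prod_restrict, ← Measure.volume_eq_prod]
    have : ContinuousOn (fun q : ℝ × ℝ => q.1 * E (Complex.polarCoord.symm q)) T :=
      continuous_fst.continuousOn.mul (hEcont.comp hsymmcont.continuousOn hTB)
    exact (this.aemeasurable hTmeas).ennreal_ofReal
  have hfub : ∫⁻ q in T, H q =
      ∫⁻ ρ in Ioo 0 δ, ∫⁻ θ in Ioo (-Real.pi) Real.pi, H (ρ, θ) := by
    rw [hT, Measure.volume_eq_prod, ← Measure.prod_restrict, lintegral_prod _ hHmeas]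
  have hinner : ∀ ρ ∈ Ioo 0 δ, ENNReal.ofReal (0.18 / Real.pi * ρ⁻¹) ≤
      ∫⁻ θ in Ioo (-Real.pi) Real.pi, H (ρ, θ) := by
    intro ρ hρ
    obtain ⟨ζ₁, ζ₂, h1, h2, h3, h4⟩ := hcross ρ hρ
    have hle := le_integral_sphericalDensity_circle hρ.1 (hρ.2.trans_le (min_le_right _ _)) hg
      h1 h2 h3 h4
    have hcont : Continuous fun θ : ℝ => E (ρ * Complex.exp (θ * Complex.I)) := by
      refine hEcont.comp_continuous (by fun_prop) fun θ => ?_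
      have hn : ‖(ρ : ℂ) * Complex.exp (θ * Complex.I)‖ = ρ := by
        simp [Complex.norm_exp_ofReal_mul_I, abs_of_pos hρ.1]
      refine ⟨?_, fun h => ?_⟩
      · rw [mem_ball_zero_iff, hn]; exact hρ.2.trans_le (min_le_right _ _)
      · rw [h, norm_zero] at hn; exact hρ.1.ne hn
    have hint : IntegrableOn (fun θ : ℝ => ρ * E (ρ * Complex.exp (θ * Complex.I)))
        (Ioo (-Real.pi) Real.pi) :=
      ((continuous_const.mul hcont).continuousOn.integrableOn_Icc).mono_set Ioo_subset_Icc_self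
    have h5 : ∫⁻ θ in Ioo (-Real.pi) Real.pi, H (ρ, θ) = ENNReal.ofReal
        (∫ θ in Ioo (-Real.pi) Real.pi, ρ * E (ρ * Complex.exp (θ * Complex.I))) := by
      rw [ofReal_integral_eq_lintegral_ofReal hint
        (Eventually.of_forall fun θ => mul_nonneg hρ.1.le (hE0 _))]
      simp only [hH, hsymm]
    rw [h5]
    refine ENNReal.ofReal_le_ofReal ?_
    rw [integral_const_mul, ← integral_Ioc_eq_integral_Ioo,
      ← intervalIntegral.integral_of_le (by linarith [Real.pi_pos])]
    have h6 := mul_le_mul_of_nonneg_left hle hρ.1.le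
    refine le_trans (le_of_eq ?_) h6
    have := hρ.1.ne'
    have := Real.pi_pos.ne'
    field_simp
  have hlow : ∫⁻ ρ in Ioo 0 δ, ENNReal.ofReal (0.18 / Real.pi * ρ⁻¹) ≠ ⊤ := by
    refine ne_top_of_le_ne_top harea (le_trans ?_ hpolar)
    rw [hfub]
    exact setLIntegral_mono' measurableSet_Ioo hinner
  have hmeas : AEStronglyMeasurable (fun ρ : ℝ => 0.18 / Real.pi * ρ⁻¹)
      (volume.restrict (Ioo 0 δ)) :=
    (measurable_const.mul measurable_inv).aestronglyMeasurable
  have hintg : IntegrableOn (fun ρ : ℝ => 0.18 / Real.pi * ρ⁻¹) (Ioo 0 δ) := by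
    refine (lintegral_ofReal_ne_top_iff_integrable hmeas ?_).mp hlow
    rw [EventuallyLE, ae_restrict_iff' measurableSet_Ioo]
    refine Eventually.of_forall fun ρ hρ => ?_
    have := hρ.1
    have := Real.pi_pos
    simp only [Pi.zero_apply]
    positivity
  have hinv : IntegrableOn (fun ρ : ℝ => ρ ^ (-1 : ℝ)) (Ioo 0 δ) := by
    have h1 : IntegrableOn (fun ρ : ℝ => Real.pi / 0.18 * (0.18 / Real.pi * ρ⁻¹)) (Ioo 0 δ) :=
      hintg.const_mul (Real.pi / 0.18)
    refine h1.congr_fun (fun ρ hρ => ?_) measurableSet_Ioo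
    have := Real.pi_pos.ne'
    simp only
    rw [Real.rpow_neg_one]
    field_simp
  rw [intervalIntegral.integrableOn_Ioo_rpow_iff hδpos] at hinv
  exact lt_irrefl _ hinv

/-- A bound on arbitrarily small circles propagates to a punctured neighbourhood by the maximum
principle. -/
theorem norm_le_of_frequently_circle {g : ℂ → ℂ} {r : ℝ} (hr : 0 < r) {C : ℝ}
    (hg : DifferentiableOn ℂ g (Metric.ball 0 r \ {0}))
    (h : ∃ᶠ ρ in 𝓝[>] (0 : ℝ), ∀ ζ, ‖ζ‖ = ρ → ‖g ζ‖ ≤ C) :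
    ∀ᶠ ζ in 𝓝[≠] (0 : ℂ), ‖g ζ‖ ≤ C := by
  have hex : ∀ δ > 0, ∃ ρ, 0 < ρ ∧ ρ < δ ∧ ∀ ζ, ‖ζ‖ = ρ → ‖g ζ‖ ≤ C := by
    intro δ hδ
    obtain ⟨ρ, hρ, hρ'⟩ := (h.and_eventually (Ioo_mem_nhdsGT hδ)).exists
    exact ⟨ρ, hρ'.1, hρ'.2, hρ⟩
  obtain ⟨R, hR0, hRr, hR⟩ := hex r hr
  filter_upwards [puncturedBall_mem_nhdsWithin hR0] with ζ hζ
  have hζ0 : 0 < ‖ζ‖ := norm_pos_iff.mpr hζ.2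
  obtain ⟨ρ, hρ0, hρζ, hρ⟩ := hex _ hζ0
  set U : Set ℂ := Metric.ball 0 R \ Metric.closedBall 0 ρ with hU
  have hUo : IsOpen U := Metric.isOpen_ball.sdiff Metric.isClosed_closedBall
  have hcl : closure U ⊆ Metric.closedBall 0 R \ Metric.ball 0 ρ := by
    refine closure_minimal ?_ (Metric.isClosed_closedBall.sdiff Metric.isOpen_ball)
    rintro z ⟨h1, h2⟩
    exact ⟨Metric.ball_subset_closedBall h1, fun h => h2 (Metric.ball_subset_closedBall h)⟩
  refine Complex.norm_le_of_forall_mem_frontier_norm_le (U := U)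
    (Metric.isBounded_ball.subset sdiff_subset) ?_ ?_ (subset_closure ⟨hζ.1, by simpa using hρζ⟩)
  · refine DifferentiableOn.diffContOnCl (hg.mono fun z hz => ?_)
    obtain ⟨h1, h2⟩ := hcl hz
    simp only [Metric.mem_closedBall, dist_zero_right, Metric.mem_ball, not_lt] at h1 h2
    refine ⟨by simpa using h1.trans_lt hRr, fun h => ?_⟩
    rw [h, norm_zero] at h2
    linarith
  · intro z hz
    rw [frontier, hUo.interior_eq] at hz
    obtain ⟨h1, h2⟩ := hcl hz.1
    simp only [Metric.mem_closedBall, dist_zero_right, Metric.mem_ball, not_lt] at h1 h2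
    by_cases hzR : ‖z‖ = R
    · exact hR z hzR
    · by_cases hzρ : ‖z‖ = ρ
      · exact hρ z hzρ
      · refine absurd ⟨?_, ?_⟩ hz.2
        · simpa using lt_of_le_of_ne h1 hzR
        · simpa using lt_of_le_of_ne h2 (Ne.symm hzρ)

/-- A function without zeros and of finite spherical area near an isolated singularity is bounded
there, or its inverse is. -/
theorem eventually_norm_le_or_ge_of_finite_sphericalArea {g : ℂ → ℂ} {r : ℝ} (hr : 0 < r)
    (hg : DifferentiableOn ℂ g (Metric.ball 0 r \ {0}))
    (hg0 : ∀ ζ ∈ Metric.ball (0 : ℂ) r \ {0}, g ζ ≠ 0)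
    (harea : ∫⁻ ζ in Metric.ball (0 : ℂ) r \ {0},
      ENNReal.ofReal (‖deriv g ζ‖ ^ 2 / (1 + ‖g ζ‖ ^ 2) ^ 2) ≠ ⊤) :
    (∀ᶠ ζ in 𝓝[≠] (0 : ℂ), ‖g ζ‖ ≤ 2) ∨ (∀ᶠ ζ in 𝓝[≠] (0 : ℂ), 1 / 2 ≤ ‖g ζ‖) := by
  rcases (Filter.frequently_or_distrib.mp (exists_circle_norm_le_or_ge hr hg harea)) with h | h
  · exact Or.inl (norm_le_of_frequently_circle hr hg h)
  · right
    have hinv : ∃ᶠ ρ in 𝓝[>] (0 : ℝ), ∀ ζ, ‖ζ‖ = ρ → ‖(g ζ)⁻¹‖ ≤ 2 := by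
      refine h.mono fun ρ hρ ζ hζ => ?_
      rw [norm_inv]
      have := inv_anti₀ (by norm_num) (hρ ζ hζ)
      norm_num at this ⊢
      exact this
    filter_upwards [norm_le_of_frequently_circle hr (hg.fun_inv hg0) hinv,
      puncturedBall_mem_nhdsWithin hr] with ζ hζ hζr
    have hpos : 0 < ‖g ζ‖ := norm_pos_iff.mpr (hg0 ζ hζr)
    rw [norm_inv, inv_le_comm₀ hpos (by norm_num)] at hζ
    norm_num at hζ ⊢
    exact hζ

/-! ### Removable singularities and poles -/

theorem exists_analyticAt_of_tendsto_mul_zero {φ : ℂ → ℂ}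
    (hφ : ∀ᶠ ζ in 𝓝[≠] (0 : ℂ), DifferentiableAt ℂ φ ζ)
    (hlim : Tendsto (fun ζ => ζ * φ ζ) (𝓝[≠] 0) (𝓝 0)) :
    ∃ h : ℂ → ℂ, AnalyticAt ℂ h 0 ∧ φ =ᶠ[𝓝[≠] 0] h := by
  obtain ⟨r, hr, hd⟩ := exists_puncturedBall_of_eventually hφ
  have ho : (fun z => φ z - φ 0) =o[𝓝[≠] (0 : ℂ)] fun z => (z - 0)⁻¹ := by
    rw [isLittleO_iff_tendsto']
    · have h1 : Tendsto (fun z : ℂ => z * φ z - z * φ 0) (𝓝[≠] 0) (𝓝 (0 - 0 * φ 0)) :=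
        hlim.sub (Tendsto.mul_const (φ 0) nhdsWithin_le_nhds)
      rw [zero_mul, sub_zero] at h1
      refine h1.congr fun z => ?_
      rw [sub_zero, div_inv_eq_mul]
      ring
    · filter_upwards [self_mem_nhdsWithin] with z hz h
      exact absurd (by simpa using h) hz
  have h1 := Complex.differentiableOn_update_limUnder_of_isLittleO
    (Metric.ball_mem_nhds (0 : ℂ) hr) (fun z hz => (hd z hz).differentiableWithinAt) ho
  refine ⟨_, h1.analyticAt (Metric.ball_mem_nhds _ hr), ?_⟩
  filter_upwards [self_mem_nhdsWithin] with z hz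
  rw [Function.update_of_ne hz]

theorem exists_analyticAt_of_bounded {φ : ℂ → ℂ} {C : ℝ}
    (hφ : ∀ᶠ ζ in 𝓝[≠] (0 : ℂ), DifferentiableAt ℂ φ ζ) (hb : ∀ᶠ ζ in 𝓝[≠] (0 : ℂ), ‖φ ζ‖ ≤ C) :
    ∃ h : ℂ → ℂ, AnalyticAt ℂ h 0 ∧ φ =ᶠ[𝓝[≠] 0] h := by
  refine exists_analyticAt_of_tendsto_mul_zero hφ ?_
  have h0 : Tendsto (fun ζ : ℂ => ‖ζ‖ * C) (𝓝[≠] 0) (𝓝 0) := by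
    have : Tendsto (fun ζ : ℂ => ‖ζ‖ * C) (𝓝 0) (𝓝 (‖(0 : ℂ)‖ * C)) :=
      (continuous_norm.mul continuous_const).tendsto 0
    rw [norm_zero, zero_mul] at this
    exact this.mono_left nhdsWithin_le_nhds
  refine squeeze_zero_norm' ?_ h0
  filter_upwards [hb] with ζ hζ
  rw [norm_mul]
  exact mul_le_mul_of_nonneg_left hζ (norm_nonneg _)

/-- A holomorphic function that tends to infinity at an isolated singularity has a pole there. -/
theorem exists_pole_of_tendsto_norm_atTop {F : ℂ → ℂ}
    (hF : ∀ᶠ ζ in 𝓝[≠] (0 : ℂ), DifferentiableAt ℂ F ζ)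
    (hlim : Tendsto (fun ζ => ‖F ζ‖) (𝓝[≠] 0) atTop) :
    ∃ (d : ℕ) (κ : ℂ → ℂ), 1 ≤ d ∧ AnalyticAt ℂ κ 0 ∧ κ 0 ≠ 0 ∧
      ∀ᶠ ζ in 𝓝[≠] (0 : ℂ), F ζ = κ ζ / ζ ^ d := by
  have hlarge : ∀ᶠ ζ in 𝓝[≠] (0 : ℂ), 1 ≤ ‖F ζ‖ := hlim.eventually_ge_atTop 1
  have hne : ∀ᶠ ζ in 𝓝[≠] (0 : ℂ), F ζ ≠ 0 := hlarge.mono fun ζ h h0 => by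
    rw [h0, norm_zero] at h; linarith
  obtain ⟨k, hk, hkF⟩ := exists_analyticAt_of_bounded (φ := fun ζ => (F ζ)⁻¹) (C := 1)
    (by filter_upwards [hF, hne] with ζ h1 h2 using h1.fun_inv h2)
    (by filter_upwards [hlarge] with ζ h; rw [norm_inv]; exact inv_le_one_of_one_le₀ h)
  have hk0 : k 0 = 0 := by
    have h1 : Tendsto k (𝓝[≠] 0) (𝓝 (k 0)) := hk.continuousAt.tendsto.mono_left nhdsWithin_le_nhds
    have h2 : Tendsto (fun ζ => (F ζ)⁻¹) (𝓝[≠] 0) (𝓝 0) := by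
      rw [tendsto_zero_iff_norm_tendsto_zero]
      simp only [norm_inv]
      exact hlim.inv_tendsto_atTop
    exact tendsto_nhds_unique h1 (h2.congr' hkF)
  have hnz : ¬ ∀ᶠ z in 𝓝 (0 : ℂ), k z = 0 := by
    intro h
    have h' := h.filter_mono (nhdsWithin_le_nhds (s := {0}ᶜ))
    obtain ⟨ζ, h1, h2, h3⟩ := (h'.and (hkF.and hne)).exists
    rw [h1] at h2
    exact h3 (inv_eq_zero.mp h2)
  obtain ⟨d, g, hg, hg0, hgk⟩ := hk.exists_eventuallyEq_pow_smul_nonzero_iff.mpr hnz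
  refine ⟨d, fun ζ => (g ζ)⁻¹, ?_, hg.fun_inv hg0, inv_ne_zero hg0, ?_⟩
  · rcases Nat.eq_zero_or_pos d with rfl | h
    · have := hgk.self_of_nhds
      rw [hk0] at this
      simp at this
      exact absurd this.symm hg0
    · exact h
  · filter_upwards [hkF, hgk.filter_mono nhdsWithin_le_nhds] with ζ h1 h2
    rw [h2, sub_zero, smul_eq_mul] at h1
    rw [← inv_inv (F ζ), h1, mul_inv, div_eq_mul_inv, mul_comm]

/-- The planar part `κ ζ / ζ ^ d + conj (G ζ)` of a surface near an end covers a neighbourhood of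
infinity `d` times. In the coordinate `w` in which it is `w ^ (-d)`, the height difference between
the sheets over `w` and `ω w`, where `ω` is a primitive `d`-th root of unity, has mean zero on the
orbits of `ω`, so it vanishes somewhere if `d ≥ 2`. -/
theorem not_injOn_of_two_le_pole_order {κ G : ℂ → ℂ} (hκ : AnalyticAt ℂ κ 0) (hκ0 : κ 0 ≠ 0)
    (hG : AnalyticAt ℂ G 0) {d : ℕ} (hd : 2 ≤ d) {f : ℂ → ℝ} {r : ℝ} (hr : 0 < r)
    (hf : ContinuousOn f (Metric.ball 0 r \ {0})) :
    ¬ InjOn (fun ζ => (κ ζ / ζ ^ d + (starRingEnd ℂ) (G ζ), f ζ)) (Metric.ball 0 r \ {0}) := by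
  intro hinj
  have hd0 : (d : ℂ) ≠ 0 := by exact_mod_cast (by omega : d ≠ 0)
  set u : ℂ → ℂ := fun ζ => κ ζ + ζ ^ d * (starRingEnd ℂ) (G ζ) with hu
  have hu0 : u 0 = κ 0 := by simp [hu, zero_pow (by omega : d ≠ 0)]
  have hcu : ContDiffAt ℝ 1 u 0 := by
    have h1 : ContDiffAt ℝ 1 κ 0 := (hκ.contDiffAt (n := 1)).restrict_scalars ℝ
    have h2 : ContDiffAt ℝ 1 G 0 := (hG.contDiffAt (n := 1)).restrict_scalars ℝ
    have h3 : ContDiffAt ℝ 1 (fun ζ => (starRingEnd ℂ) (G ζ)) 0 :=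
      Complex.conjCLE.contDiff.contDiffAt.comp 0 h2
    exact h1.add ((contDiffAt_id.pow d).mul h3)
  -- `w ζ = ζ * κ₂ ζ` is a `C¹` coordinate in which the planar part is `κ 0 / w ^ d`
  set κ₂ : ℂ → ℂ := fun ζ => Complex.exp (-(Complex.log (u ζ / κ 0)) / d) with hκ₂
  have hκ₂0 : κ₂ 0 = 1 := by simp [hκ₂, hu0, div_self hκ0]
  have hcκ₂ : ContDiffAt ℝ 1 κ₂ 0 := by
    have h1 : ContDiffAt ℝ 1 (fun ζ => u ζ / κ 0) 0 := hcu.div_const _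
    have h2 : ContDiffAt ℝ 1 Complex.log (u 0 / κ 0) := by
      rw [hu0, div_self hκ0]
      exact (Complex.contDiffAt_log (n := 1) Complex.one_mem_slitPlane).restrict_scalars ℝ
    have h3 : ContDiffAt ℝ 1 (fun ζ => Complex.log (u ζ / κ 0)) 0 :=
      ContDiffAt.comp (g := Complex.log) 0 h2 h1
    exact (h3.neg.div_const _).cexp
  set w : ℂ → ℂ := fun ζ => ζ * κ₂ ζ with hw
  have hcw : ContDiffAt ℝ 1 w 0 := contDiffAt_id.mul hcκ₂
  have hw0 : w 0 = 0 := by simp [hw]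
  have hdw : HasFDerivAt w ((ContinuousLinearEquiv.refl ℝ ℂ : ℂ ≃L[ℝ] ℂ) : ℂ →L[ℝ] ℂ) 0 := by
    have h1 := (hasFDerivAt_id (𝕜 := ℝ) (0 : ℂ)).mul (hcκ₂.differentiableAt one_ne_zero).hasFDerivAt
    refine h1.congr_fderiv ?_
    ext v
    all_goals simp [hκ₂0]
  have hsw : HasStrictFDerivAt w ((ContinuousLinearEquiv.refl ℝ ℂ : ℂ ≃L[ℝ] ℂ) : ℂ →L[ℝ] ℂ) 0 :=
    hcw.hasStrictFDerivAt' hdw one_ne_zero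
  have hwd : ∀ ζ, u ζ ≠ 0 → ζ ≠ 0 → w ζ ^ d * u ζ = κ 0 * ζ ^ d := by
    intro ζ hζ h0
    have h1 : κ₂ ζ ^ d = (u ζ / κ 0)⁻¹ := by
      rw [hκ₂]
      simp only
      rw [← Complex.exp_nat_mul, mul_div_cancel₀ _ hd0, Complex.exp_neg,
        Complex.exp_log (div_ne_zero hζ hκ0)]
    simp only [hw]
    rw [mul_pow, h1]
    field_simp
  set τ := hsw.localInverse w _ 0 with hτ
  have hτ0 : τ 0 = 0 := by
    have := hsw.localInverse_apply_image
    rwa [hw0] at this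
  have hτright : ∀ᶠ y in 𝓝 (0 : ℂ), w (τ y) = y := by
    have := hsw.eventually_right_inverse
    rwa [hw0] at this
  have hτcont : ∀ᶠ y in 𝓝 (0 : ℂ), ContinuousAt τ y := by
    have h1 := hsw.image_mem_toOpenPartialHomeomorph_target
    rw [hw0] at h1
    filter_upwards [(hsw.toOpenPartialHomeomorph w).open_target.mem_nhds h1] with y hy
    exact (hsw.toOpenPartialHomeomorph w).continuousAt_symm hy
  have hτlim : Tendsto τ (𝓝 0) (𝓝 0) := by
    have := hτcont.self_of_nhds
    rwa [ContinuousAt, hτ0] at this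
  have hτball : ∀ᶠ y in 𝓝 (0 : ℂ), τ y ∈ Metric.ball (0 : ℂ) r :=
    hτlim.eventually_mem (Metric.ball_mem_nhds _ hr)
  have hτu : ∀ᶠ y in 𝓝 (0 : ℂ), u (τ y) ≠ 0 :=
    hτlim.eventually (hcu.continuousAt.eventually_ne (by rwa [hu0]))
  obtain ⟨ρ', hρ', hall⟩ := Metric.eventually_nhds_iff_ball.mp
    (hτright.and (hτcont.and (hτball.and hτu)))
  set ρ := ρ' / 2 with hρ
  have hρ0 : 0 < ρ := by positivity
  set Sρ : Set ℂ := Metric.sphere 0 ρ with hSρ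
  have hmem : ∀ y ∈ Sρ, y ∈ Metric.ball (0 : ℂ) ρ' := fun y hy => by
    rw [mem_sphere_zero_iff_norm] at hy
    rw [mem_ball_zero_iff, hy, hρ]; linarith
  have hy0 : ∀ y ∈ Sρ, y ≠ 0 := fun y hy h => by
    rw [mem_sphere_zero_iff_norm, h, norm_zero] at hy
    linarith
  have hτmem : ∀ y ∈ Sρ, τ y ∈ Metric.ball (0 : ℂ) r \ {0} := fun y hy => by
    obtain ⟨h1, -, h3, -⟩ := hall y (hmem y hy)
    refine ⟨h3, fun h => hy0 y hy ?_⟩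
    rw [← h1, h, hw0]
  have hplanar : ∀ y ∈ Sρ, κ (τ y) / τ y ^ d + (starRingEnd ℂ) (G (τ y)) = κ 0 / y ^ d := by
    intro y hy
    obtain ⟨h1, -, -, h4⟩ := hall y (hmem y hy)
    have hne : τ y ≠ 0 := (hτmem y hy).2
    have h5 := hwd _ h4 hne
    rw [h1] at h5
    have h6 : κ (τ y) / τ y ^ d + (starRingEnd ℂ) (G (τ y)) = u (τ y) / τ y ^ d := by
      simp only [hu]
      field_simp
    rw [h6, div_eq_div_iff (pow_ne_zero _ hne) (pow_ne_zero _ (hy0 y hy)), ← h5]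
    ring
  set ω : ℂ := Complex.exp (2 * Real.pi * Complex.I / d) with hω
  have hprim : IsPrimitiveRoot ω d := Complex.isPrimitiveRoot_exp d (by omega)
  have hωnorm : ‖ω‖ = 1 := hprim.norm'_eq_one (by omega)
  have hωmem : ∀ y ∈ Sρ, ω * y ∈ Sρ := fun y hy => by
    rw [mem_sphere_zero_iff_norm] at hy ⊢
    rw [norm_mul, hωnorm, hy, one_mul]
  -- the height difference between the sheets over `y` and `ω y`
  set D : ℂ → ℝ := fun y => f (τ (ω * y)) - f (τ y) with hD
  have hfτ : ContinuousOn (fun y => f (τ y)) Sρ := by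
    refine hf.comp (fun y hy => ?_) hτmem
    exact (hall y (hmem y hy)).2.1.continuousWithinAt
  have hDcont : ContinuousOn D Sρ := by
    refine ContinuousOn.sub ?_ hfτ
    exact hfτ.comp (continuous_const.mul continuous_id).continuousOn hωmem
  have hDne : ∀ y ∈ Sρ, D y ≠ 0 := by
    intro y hy h
    have h1 := hinj (hτmem _ (hωmem y hy)) (hτmem y hy) (by
      simp only [Prod.mk.injEq]
      refine ⟨?_, sub_eq_zero.mp h⟩
      rw [hplanar _ (hωmem y hy), hplanar y hy, mul_pow, hprim.pow_eq_one, one_mul])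
    have h2 := (hall _ (hmem _ (hωmem y hy))).1
    rw [h1, (hall _ (hmem y hy)).1] at h2
    have h3 : ω = 1 := by
      have := mul_right_cancel₀ (hy0 y hy) ((one_mul y).trans h2)
      exact this.symm
    exact hprim.ne_one (by omega) h3
  have hρmem : (ρ : ℂ) ∈ Sρ := by
    rw [mem_sphere_zero_iff_norm, Complex.norm_real, Real.norm_of_nonneg hρ0.le]
  have hpow : ∀ j : ℕ, ω ^ j * (ρ : ℂ) ∈ Sρ := by
    intro j
    induction j with
    | zero => simpa using hρmem
    | succ j ih => rw [pow_succ', mul_assoc]; exact hωmem _ ih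
  have hsum : ∑ j ∈ Finset.range d, D (ω ^ j * ρ) = 0 := by
    have h1 : ∀ j ∈ Finset.range d, D (ω ^ j * ρ) =
        f (τ (ω ^ (j + 1) * ρ)) - f (τ (ω ^ j * ρ)) := fun j _ => by
      simp only [hD]
      rw [← mul_assoc, ← pow_succ']
    rw [Finset.sum_congr rfl h1, Finset.sum_range_sub (fun j => f (τ (ω ^ j * ρ))),
      hprim.pow_eq_one, pow_zero, sub_self]
  have hconn : IsPreconnected Sρ :=
    isPreconnected_sphere (by rw [Complex.rank_real_complex]; norm_num) _ _
  have hsign : (∀ y ∈ Sρ, 0 < D y) ∨ (∀ y ∈ Sρ, D y < 0) := by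
    by_contra hcon
    push Not at hcon
    obtain ⟨⟨y₁, hy₁, h1⟩, ⟨y₂, hy₂, h2⟩⟩ := hcon
    obtain ⟨y, hy, hy'⟩ := hconn.intermediate_value hy₁ hy₂ hDcont ⟨h1, h2⟩
    exact hDne y hy hy'
  have hdne : (Finset.range d).Nonempty := ⟨0, Finset.mem_range.mpr (by omega)⟩
  rcases hsign with h | h
  · exact (Finset.sum_pos (fun j _ => h _ (hpow j)) hdne).ne' hsum
  · exact (Finset.sum_neg (fun j _ => h _ (hpow j)) hdne).ne hsum

/-! ### The complex gradient of a harmonic function -/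

/-- The complex gradient `∂f/∂x - i ∂f/∂y = 2 ∂f/∂z` of a real function. -/
noncomputable def complexGradient (f : ℂ → ℝ) (z : ℂ) : ℂ :=
  fderiv ℝ f z 1 - Complex.I * fderiv ℝ f z Complex.I

theorem complexGradient_congr {f g : ℂ → ℝ} {z : ℂ} (h : f =ᶠ[𝓝 z] g) :
    complexGradient f z = complexGradient g z := by
  rw [complexGradient, complexGradient, h.fderiv_eq]

theorem complexGradient_sub_const (f : ℂ → ℝ) (c : ℝ) (z : ℂ) :
    complexGradient (fun z => f z - c) z = complexGradient f z := by
  rw [complexGradient, complexGradient, fderiv_sub_const]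

theorem re_complexGradient_mul (f : ℂ → ℝ) (z v : ℂ) :
    (complexGradient f z * v).re = fderiv ℝ f z v := by
  have h : fderiv ℝ f z v = v.re * fderiv ℝ f z 1 + v.im * fderiv ℝ f z Complex.I := by
    have hv : v = v.re • (1 : ℂ) + v.im • Complex.I := by
      simp [Complex.real_smul, Complex.re_add_im]
    conv_lhs => rw [hv, map_add, map_smul, map_smul]
    simp
  rw [h, complexGradient]
  simp
  ring

theorem hasFDerivAt_re_of_hasDerivAt {F : ℂ → ℂ} {F' z : ℂ} (h : HasDerivAt F F' z) :
    HasFDerivAt (fun z => (F z).re)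
      (Complex.reCLM.comp ((ContinuousLinearMap.toSpanSingleton ℂ F').restrictScalars ℝ)) z :=
  Complex.reCLM.hasFDerivAt.comp z (h.hasFDerivAt.restrictScalars ℝ)

theorem complexGradient_re_of_hasDerivAt {F : ℂ → ℂ} {F' z : ℂ} (h : HasDerivAt F F' z) :
    complexGradient (fun z => (F z).re) z = F' := by
  rw [complexGradient, (hasFDerivAt_re_of_hasDerivAt h).fderiv]
  apply Complex.ext <;> simp

open InnerProductSpace in
/-- A gradient estimate: it follows from Cauchy's estimate for `exp (F / ε)`, where `f = Re F`. -/
theorem norm_complexGradient_le {f : ℂ → ℝ} {z : ℂ} {R ε : ℝ} (hR : 0 < R) (hε : 0 < ε)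
    (hf : HarmonicOnNhd f (Metric.ball z R)) (hb : ∀ y ∈ Metric.ball z R, |f y| ≤ ε) :
    ‖complexGradient f z‖ ≤ 2 * Real.exp 2 * ε / R := by
  obtain ⟨F, hF, hFf⟩ := hf.exists_analyticOnNhd_ball_re_eq
  have hzR : z ∈ Metric.ball z R := Metric.mem_ball_self hR
  have hFz := (hF z hzR).differentiableAt.hasDerivAt
  have hgrad : complexGradient f z = deriv F z := by
    rw [← complexGradient_re_of_hasDerivAt hFz]
    refine complexGradient_congr ?_
    filter_upwards [Metric.isOpen_ball.mem_nhds hzR] with y hy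
    exact (hFf hy).symm
  rw [hgrad]
  set E : ℂ → ℂ := fun y => Complex.exp (F y / ε) with hE
  have hEd : HasDerivAt E (Complex.exp (F z / ε) * (deriv F z / ε)) z := (hFz.div_const _).cexp
  have hnorm : ∀ y ∈ Metric.ball z R, ‖E y‖ = Real.exp (f y / ε) := fun y hy => by
    rw [hE, Complex.norm_exp, ← hFf hy]
    congr 1
    rw [Complex.div_ofReal_re]
  have hcauchy := Complex.norm_deriv_le_of_forall_mem_sphere_norm_le (f := E) (c := z)
    (R := R / 2) (C := Real.exp 1) (by positivity) (by
      refine DifferentiableOn.diffContOnCl ?_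
      rw [closure_ball _ (by positivity)]
      intro y hy
      have hy' : y ∈ Metric.ball z R := Metric.closedBall_subset_ball (by linarith) hy
      exact ((hF y hy').differentiableAt.div_const _).cexp.differentiableWithinAt) (by
      intro y hy
      have hy' : y ∈ Metric.ball z R := by
        rw [Metric.mem_sphere] at hy; rw [Metric.mem_ball, hy]; linarith
      rw [hnorm y hy']
      refine Real.exp_le_exp.mpr ?_
      rw [div_le_one hε]
      exact (le_abs_self _).trans (hb y hy'))
  rw [hEd.deriv, norm_mul, norm_div, Complex.norm_real, Real.norm_of_nonneg hε.le] at hcauchy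
  have h1 : ‖Complex.exp (F z / ε)‖ = Real.exp (f z / ε) := hnorm z hzR
  have h2 : Real.exp (-1) ≤ Real.exp (f z / ε) := by
    refine Real.exp_le_exp.mpr ?_
    rw [le_div_iff₀ hε]
    have := neg_le_of_abs_le (hb z hzR)
    linarith
  rw [h1] at hcauchy
  have h3 := (mul_le_mul_of_nonneg_right h2 (by positivity : 0 ≤ ‖deriv F z‖ / ε)).trans hcauchy
  have h4 : Real.exp 2 = Real.exp 1 * Real.exp 1 := by rw [← Real.exp_add]; norm_num
  have h5 : Real.exp (-1) * Real.exp 1 = 1 := by rw [← Real.exp_add]; norm_num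
  have h6 := mul_le_mul_of_nonneg_left h3 (by positivity : 0 ≤ Real.exp 1 * ε)
  calc ‖deriv F z‖ = Real.exp 1 * ε * (Real.exp (-1) * (‖deriv F z‖ / ε)) := by
        have : Real.exp 1 * ε * (Real.exp (-1) * (‖deriv F z‖ / ε)) =
          (Real.exp (-1) * Real.exp 1) * ‖deriv F z‖ := by field_simp
        rw [this, h5, one_mul]
    _ ≤ _ := h6
    _ = _ := by rw [h4]; field_simp

open InnerProductSpace in
/-- The gradient of a harmonic function with a limit at an isolated singularity is holomorphic
there. -/
theorem exists_analyticAt_complexGradient {f : ℂ → ℝ} {r c : ℝ} (hr : 0 < r)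
    (hf : ∀ ζ ∈ Metric.ball (0 : ℂ) r \ {0}, HarmonicAt f ζ)
    (hlim : Tendsto f (𝓝[≠] 0) (𝓝 c)) :
    ∃ h : ℂ → ℂ, AnalyticAt ℂ h 0 ∧ complexGradient f =ᶠ[𝓝[≠] 0] h := by
  refine exists_analyticAt_of_tendsto_mul_zero ?_ ?_
  · filter_upwards [puncturedBall_mem_nhdsWithin hr] with ζ hζ
    exact HarmonicAt.differentiableAt_complex_partial (hf ζ hζ)
  · rw [Metric.tendsto_nhds]
    intro η hη
    set ε : ℝ := η / (4 * Real.exp 2) with hε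
    have hε0 : 0 < ε := by positivity
    obtain ⟨δ, hδ, hδf⟩ := exists_puncturedBall_of_eventually (Metric.tendsto_nhds.mp hlim ε hε0)
    filter_upwards [puncturedBall_mem_nhdsWithin (lt_min (half_pos hr) (half_pos hδ))] with ζ hζ
    have hζ0 : 0 < ‖ζ‖ := norm_pos_iff.mpr hζ.2
    have hζ1 : ‖ζ‖ < min (r / 2) (δ / 2) := by simpa using hζ.1
    have hsub : ∀ y ∈ Metric.ball ζ ‖ζ‖, y ≠ 0 ∧ ‖y‖ < r ∧ ‖y‖ < δ := by
      intro y hy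
      rw [Metric.mem_ball, dist_eq_norm] at hy
      have h1 : ‖y‖ < 2 * ‖ζ‖ := by
        have := norm_add_le (y - ζ) ζ
        rw [sub_add_cancel] at this
        linarith
      refine ⟨fun h => ?_, ?_, ?_⟩
      · rw [h, zero_sub, norm_neg] at hy; exact lt_irrefl _ hy
      · linarith [hζ1.trans_le (min_le_left _ _)]
      · linarith [hζ1.trans_le (min_le_right _ _)]
    have hest := norm_complexGradient_le (f := fun z => f z - c) hζ0 hε0
      (fun y hy => by
        have := hsub y hy
        exact (hf y ⟨by simpa using this.2.1, this.1⟩).sub (harmonicAt_const c))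
      (fun y hy => by
        have := hsub y hy
        exact (hδf y ⟨by simpa using this.2.2, this.1⟩).le)
    rw [complexGradient_sub_const] at hest
    rw [dist_zero_right, norm_mul]
    calc ‖ζ‖ * ‖complexGradient f ζ‖ ≤ ‖ζ‖ * (2 * Real.exp 2 * ε / ‖ζ‖) :=
          mul_le_mul_of_nonneg_left hest hζ0.le
      _ = η / 2 := by rw [hε]; field_simp; norm_num
      _ < η := by linarith

/-! ### The Weierstrass data at an embedded planar end -/

namespace RiemannSphere

theorem isPreconnected_puncturedBall (r : ℝ) :
    IsPreconnected (Metric.ball (0 : ℂ) r \ {0}) := by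
  rcases le_or_gt r 0 with hr | hr
  · rw [Metric.ball_eq_empty.mpr hr, empty_sdiff]
    exact isPreconnected_empty
  · have h : Metric.ball (0 : ℂ) r \ {0} = Complex.exp '' {z | z.re < Real.log r} := by
      ext ζ
      constructor
      · rintro ⟨h1, h2⟩
        refine ⟨Complex.log ζ, ?_, Complex.exp_log h2⟩
        rw [mem_ball_zero_iff] at h1
        change (Complex.log ζ).re < Real.log r
        rw [Complex.log_re]
        exact Real.log_lt_log (norm_pos_iff.mpr h2) h1
      · rintro ⟨z, hz, rfl⟩
        refine ⟨?_, Complex.exp_ne_zero z⟩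
        rw [mem_ball_zero_iff, Complex.norm_exp]
        exact (Real.lt_log_iff_exp_lt hr).mp hz
    rw [h]
    exact (convex_halfSpace_re_lt _).isPreconnected.image _ Complex.continuous_exp.continuousOn

/-- The complex gradient of the component of `Y` in the direction `u`. -/
noncomputable def gradComponent (Y : ℂ → E3) (u : E3) : ℂ → ℂ :=
  complexGradient fun ζ => inner ℝ u (Y ζ)

theorem gradComponent_eq_of_eq_sum {Y : ℂ → E3} {ζ : ℂ}
    (hY : ∀ u, DifferentiableAt ℝ (fun ζ => inner ℝ u (Y ζ)) ζ) {u u₁ u₂ u₃ : E3} {a₁ a₂ a₃ : ℝ}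
    (hu : u = a₁ • u₁ + a₂ • u₂ + a₃ • u₃) :
    gradComponent Y u ζ =
      a₁ * gradComponent Y u₁ ζ + a₂ * gradComponent Y u₂ ζ + a₃ * gradComponent Y u₃ ζ := by
  have h1 : (fun ζ => inner ℝ u (Y ζ)) = fun ζ =>
      a₁ * inner ℝ u₁ (Y ζ) + a₂ * inner ℝ u₂ (Y ζ) + a₃ * inner ℝ u₃ (Y ζ) := by
    funext ζ
    rw [hu, inner_add_left, inner_add_left, real_inner_smul_left, real_inner_smul_left,
      real_inner_smul_left]
  have h2 := (((hY u₁).hasFDerivAt.const_mul a₁).add ((hY u₂).hasFDerivAt.const_mul a₂)).add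
    ((hY u₃).hasFDerivAt.const_mul a₃)
  have h3 : fderiv ℝ (fun ζ => inner ℝ u (Y ζ)) ζ =
      a₁ • fderiv ℝ (fun ζ => inner ℝ u₁ (Y ζ)) ζ + a₂ • fderiv ℝ (fun ζ => inner ℝ u₂ (Y ζ)) ζ +
        a₃ • fderiv ℝ (fun ζ => inner ℝ u₃ (Y ζ)) ζ := by
    rw [h1]; exact h2.fderiv
  simp only [gradComponent, complexGradient]
  rw [h3]
  simp
  ring

theorem gradComponent_neg (Y : ℂ → E3) (u : E3) (ζ : ℂ) :
    gradComponent Y (-u) ζ = -gradComponent Y u ζ := by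
  have h1 : (fun ζ => inner ℝ (-u) (Y ζ)) = fun ζ => -inner ℝ u (Y ζ) := by
    funext ζ; rw [inner_neg_left]
  simp only [gradComponent, complexGradient]
  rw [h1, fderiv_fun_neg]
  simp
  ring

/-- If the antiholomorphic part of the complex coordinate `⟨u₁, Y⟩ + i ⟨u₂, Y⟩` in the asymptotic
plane is regular at the end, then this coordinate is `F + conj G` with `F` meromorphic. Injectivity
makes the pole of `F` simple, so that the gradients have double poles without residues. -/
theorem gradComponent_expansion_of_analytic {Y : ℂ → E3} {r : ℝ} (hr : 0 < r) {u₁ u₂ ν : E3}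
    (hu₁ : ‖u₁‖ = 1) (hu₂ : ‖u₂‖ = 1) (hν : ‖ν‖ = 1) (h12 : inner ℝ u₁ u₂ = 0)
    (hrep : ∀ y : E3, y = inner ℝ u₁ y • u₁ + inner ℝ u₂ y • u₂ + inner ℝ ν y • ν)
    (hharm : ∀ u, ∀ ζ ∈ Metric.ball (0 : ℂ) r \ {0},
      InnerProductSpace.HarmonicAt (fun ζ => inner ℝ u (Y ζ)) ζ)
    (hinj : InjOn Y (Metric.ball 0 r \ {0}))
    (hinf : Tendsto (fun ζ => ‖Y ζ‖) (𝓝[≠] 0) atTop) {c : ℝ}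
    (hplane : Tendsto (fun ζ => inner ℝ ν (Y ζ)) (𝓝[≠] 0) (𝓝 c))
    {h q : ℂ → ℂ} (hh : AnalyticAt ℂ h 0) (hq : AnalyticAt ℂ q 0)
    (hgh : (fun ζ => gradComponent Y u₁ ζ - Complex.I * gradComponent Y u₂ ζ) =ᶠ[𝓝[≠] 0] h)
    (hgq : gradComponent Y ν =ᶠ[𝓝[≠] 0] q) :
    ∃ v : E3 →ₗ[ℝ] ℂ, (∀ u, ∃ k : ℂ → ℂ, AnalyticAt ℂ k 0 ∧
      ∀ᶠ ζ in 𝓝[≠] 0, gradComponent Y u ζ = v u / ζ ^ 2 + k ζ) ∧ v ≠ 0 := by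
  have hdiff : ∀ ζ ∈ Metric.ball (0 : ℂ) r \ {0}, ∀ u,
      DifferentiableAt ℝ (fun ζ => inner ℝ u (Y ζ)) ζ := fun ζ hζ u =>
    (hharm u ζ hζ).1.differentiableAt two_ne_zero
  -- a primitive of the regular part
  obtain ⟨R, hR, hhR⟩ := Metric.eventually_nhds_iff_ball.mp hh.eventually_analyticAt
  have hdh : DifferentiableOn ℂ (fun ζ => h ζ / 2) (Metric.ball 0 R) := fun ζ hζ =>
    ((hhR ζ hζ).differentiableAt.div_const 2).differentiableWithinAt
  obtain ⟨G, -, hG⟩ := (hdh.isExactOn_ball).with_val_at 0 0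
  have hGan : AnalyticAt ℂ G 0 := by
    have : DifferentiableOn ℂ G (Metric.ball 0 R) := fun ζ hζ =>
      (hG ζ hζ).differentiableAt.differentiableWithinAt
    exact this.analyticAt (Metric.ball_mem_nhds _ hR)
  set f₁ : ℂ → ℝ := fun ζ => inner ℝ u₁ (Y ζ) with hf₁
  set f₂ : ℂ → ℝ := fun ζ => inner ℝ u₂ (Y ζ) with hf₂
  set f₃ : ℂ → ℝ := fun ζ => inner ℝ ν (Y ζ) with hf₃
  set F : ℂ → ℂ := fun ζ => f₁ ζ + Complex.I * f₂ ζ - (starRingEnd ℂ) (G ζ) with hF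
  have hFder : ∀ᶠ ζ in 𝓝[≠] (0 : ℂ), HasDerivAt F
      ((gradComponent Y u₁ ζ + Complex.I * gradComponent Y u₂ ζ) / 2) ζ := by
    filter_upwards [puncturedBall_mem_nhdsWithin hr, puncturedBall_mem_nhdsWithin hR, hgh]
      with ζ hζr hζR hζ
    have d₁ := (hdiff ζ hζr u₁).hasFDerivAt
    have d₂ := (hdiff ζ hζr u₂).hasFDerivAt
    have dG := Complex.conjCLE.hasFDerivAt.comp ζ ((hG ζ hζR.1).hasFDerivAt.restrictScalars ℝ)
    have e₁ := Complex.ofRealCLM.hasFDerivAt.comp ζ d₁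
    have e₂ := (Complex.ofRealCLM.hasFDerivAt.comp ζ d₂).const_mul Complex.I
    have hFr := (e₁.add e₂).sub dG
    rw [hasDerivAt_iff_hasFDerivAt]
    refine hasFDerivAt_of_restrictScalars ℝ hFr ?_
    ext1 v
    have r₁ := re_complexGradient_mul (fun ζ => inner ℝ u₁ (Y ζ)) ζ v
    have r₂ := re_complexGradient_mul (fun ζ => inner ℝ u₂ (Y ζ)) ζ v
    simp only [ContinuousLinearMap.coe_restrictScalars', ContinuousLinearMap.toSpanSingleton_apply,
      _root_.sub_apply, _root_.add_apply,
      ContinuousLinearMap.comp_apply, _root_.smul_apply, Complex.ofRealCLM_apply,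
      ContinuousLinearEquiv.coe_coe, Complex.conjCLE_apply, smul_eq_mul]
    rw [← r₁, ← r₂, ← hζ]
    simp only [gradComponent]
    generalize complexGradient (fun ζ => inner ℝ u₁ (Y ζ)) ζ = g₁
    generalize complexGradient (fun ζ => inner ℝ u₂ (Y ζ)) ζ = g₂
    rw [Complex.re_eq_add_conj, Complex.re_eq_add_conj]
    simp only [map_mul, map_div₀, map_sub, Complex.conj_I, map_ofNat]
    ring
  -- `F` tends to infinity
  have hFinf : Tendsto (fun ζ => ‖F ζ‖) (𝓝[≠] 0) atTop := by
    have hlow : ∀ ζ, (‖Y ζ‖ - |f₃ ζ|) / 2 - ‖G ζ‖ ≤ ‖F ζ‖ := by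
      intro ζ
      have h1 : ‖Y ζ‖ ≤ |f₁ ζ| + |f₂ ζ| + |f₃ ζ| := by
        conv_lhs => rw [hrep (Y ζ)]
        refine (norm_add_le _ _).trans (add_le_add ((norm_add_le _ _).trans ?_) ?_)
        · rw [norm_smul, norm_smul, hu₁, hu₂, mul_one, mul_one]
          exact le_rfl
        · rw [norm_smul, hν, mul_one]; exact le_rfl
      have h2 : ‖(f₁ ζ : ℂ) + Complex.I * f₂ ζ‖ - ‖G ζ‖ ≤ ‖F ζ‖ := by
        have := norm_sub_norm_le ((f₁ ζ : ℂ) + Complex.I * f₂ ζ) ((starRingEnd ℂ) (G ζ))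
        rwa [RCLike.norm_conj] at this
      have h3 : |f₁ ζ| ≤ ‖(f₁ ζ : ℂ) + Complex.I * f₂ ζ‖ := by
        simpa using Complex.abs_re_le_norm ((f₁ ζ : ℂ) + Complex.I * f₂ ζ)
      have h4 : |f₂ ζ| ≤ ‖(f₁ ζ : ℂ) + Complex.I * f₂ ζ‖ := by
        simpa using Complex.abs_im_le_norm ((f₁ ζ : ℂ) + Complex.I * f₂ ζ)
      linarith
    refine tendsto_atTop_mono hlow ?_
    have hb₃ : Tendsto (fun ζ => -|f₃ ζ| / 2 - ‖G ζ‖) (𝓝[≠] 0) (𝓝 (-|c| / 2 - ‖G 0‖)) :=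
      (hplane.abs.neg.div_const 2).sub
        (hGan.continuousAt.norm.tendsto.mono_left nhdsWithin_le_nhds)
    have hsum := tendsto_atTop_add_left_of_le' (𝓝[≠] (0 : ℂ)) ((-|c| / 2 - ‖G 0‖) - 1)
      (hb₃.eventually (lt_mem_nhds (sub_one_lt _)) |>.mono fun ζ hζ => hζ.le)
      (hinf.atTop_div_const two_pos)
    exact hsum.congr fun ζ => by ring
  obtain ⟨d, κ, hd1, hκ, hκ0, hFκ⟩ := exists_pole_of_tendsto_norm_atTop
    (hFder.mono fun ζ h => h.differentiableAt) hFinf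
  have hd : d = 1 := by
    by_contra hne
    obtain ⟨ρ, hρ, hρF⟩ := exists_puncturedBall_of_eventually hFκ
    have hsub : Metric.ball (0 : ℂ) (min ρ r) \ {0} ⊆ Metric.ball 0 r \ {0} := fun ζ hζ =>
      ⟨Metric.ball_subset_ball (min_le_right _ _) hζ.1, hζ.2⟩
    refine not_injOn_of_two_le_pole_order hκ hκ0 hGan (by omega : 2 ≤ d) (lt_min hρ hr)
      (f := f₃) (fun ζ hζ => ((hdiff ζ (hsub hζ) ν).continuousAt).continuousWithinAt) ?_
    intro ζ hζ ξ hξ hζξ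
    simp only [Prod.mk.injEq] at hζξ
    have key : ∀ ζ ∈ Metric.ball (0 : ℂ) (min ρ r) \ {0},
        κ ζ / ζ ^ d + (starRingEnd ℂ) (G ζ) = f₁ ζ + Complex.I * f₂ ζ := fun ζ hζ => by
      rw [← hρF ζ ⟨Metric.ball_subset_ball (min_le_left _ _) hζ.1, hζ.2⟩, hF]
      ring
    rw [key ζ hζ, key ξ hξ] at hζξ
    obtain ⟨h1, h3⟩ := hζξ
    have hre := congrArg Complex.re h1
    have him := congrArg Complex.im h1
    simp at hre him
    apply hinj (hsub hζ) (hsub hξ)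
    rw [hrep (Y ζ), hrep (Y ξ)]
    change f₁ ζ • u₁ + f₂ ζ • u₂ + f₃ ζ • ν = f₁ ξ • u₁ + f₂ ξ • u₂ + f₃ ξ • ν
    rw [hre, him, h3]
  subst hd
  set H : ℂ → ℂ := dslope κ 0 with hH
  have hHan : AnalyticAt ℂ H 0 := by
    obtain ⟨ρ, hρ, hκρ⟩ := Metric.eventually_nhds_iff_ball.mp hκ.eventually_analyticAt
    have h1 : DifferentiableOn ℂ κ (Metric.ball 0 ρ) := fun ζ hζ =>
      (hκρ ζ hζ).differentiableAt.differentiableWithinAt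
    exact ((Complex.differentiableOn_dslope (Metric.ball_mem_nhds _ hρ)).mpr h1).analyticAt
      (Metric.ball_mem_nhds _ hρ)
  have hFH : ∀ᶠ ζ in 𝓝[≠] (0 : ℂ), F ζ = κ 0 / ζ + H ζ := by
    filter_upwards [hFκ, self_mem_nhdsWithin] with ζ hζ h0
    have h0 : ζ ≠ 0 := h0
    rw [hζ, hH, dslope_of_ne _ h0, slope_def_field, pow_one]
    field_simp
    ring
  have hsum : ∀ᶠ ζ in 𝓝[≠] (0 : ℂ),
      gradComponent Y u₁ ζ + Complex.I * gradComponent Y u₂ ζ =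
        -2 * κ 0 / ζ ^ 2 + 2 * deriv H ζ := by
    filter_upwards [hFder, eventually_eventually_nhdsWithin.mpr hFH, self_mem_nhdsWithin,
      hHan.eventually_analyticAt.filter_mono nhdsWithin_le_nhds] with ζ h1 h2 h0 h3
    have h0 : ζ ≠ 0 := h0
    have h4 : F =ᶠ[𝓝 ζ] fun ζ => κ 0 / ζ + H ζ := by
      rw [IsOpen.nhdsWithin_eq isOpen_compl_singleton h0] at h2
      exact h2
    have h5 : HasDerivAt (fun ζ => κ 0 / ζ + H ζ) (κ 0 * (-(ζ ^ 2)⁻¹) + deriv H ζ) ζ := by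
      simp only [div_eq_mul_inv]
      exact ((hasDerivAt_inv h0).const_mul (κ 0)).add h3.differentiableAt.hasDerivAt
    have h6 := h1.unique (h5.congr_of_eventuallyEq h4)
    have h7 : gradComponent Y u₁ ζ + Complex.I * gradComponent Y u₂ ζ =
      2 * ((gradComponent Y u₁ ζ + Complex.I * gradComponent Y u₂ ζ) / 2) := by ring
    rw [h7, h6]
    ring
  have hv : ∀ u, ((innerₛₗ ℝ u₁).smulRight (-κ 0) +
      (innerₛₗ ℝ u₂).smulRight (Complex.I * κ 0)) u =
      (inner ℝ u₁ u : ℝ) * (-κ 0) + (inner ℝ u₂ u : ℝ) * (Complex.I * κ 0) := fun u => by simp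
  refine ⟨(innerₛₗ ℝ u₁).smulRight (-κ 0) + (innerₛₗ ℝ u₂).smulRight (Complex.I * κ 0),
    fun u => ?_, fun h0 => ?_⟩
  · refine ⟨fun ζ => (inner ℝ u₁ u : ℝ) * (deriv H ζ + h ζ / 2) +
      (inner ℝ u₂ u : ℝ) * (-Complex.I * deriv H ζ + Complex.I * h ζ / 2) +
      (inner ℝ ν u : ℝ) * q ζ, ?_, ?_⟩
    · have hH' := hHan.deriv
      have hh2 : AnalyticAt ℂ (fun ζ => h ζ / 2) 0 := hh.div analyticAt_const two_ne_zero
      have hh3 : AnalyticAt ℂ (fun ζ => Complex.I * h ζ / 2) 0 :=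
        (analyticAt_const.mul hh).div analyticAt_const two_ne_zero
      exact ((analyticAt_const.mul (hH'.add hh2)).add
        (analyticAt_const.mul ((analyticAt_const.mul hH').add hh3))).add (analyticAt_const.mul hq)
    · filter_upwards [hsum, hgh, hgq, puncturedBall_mem_nhdsWithin hr] with ζ h1 h2 h3 hζ
      rw [gradComponent_eq_of_eq_sum (hdiff ζ hζ) (hrep u), h3, hv]
      have e1 : gradComponent Y u₁ ζ = -κ 0 / ζ ^ 2 + (deriv H ζ + h ζ / 2) := by
        linear_combination h1 / 2 + h2 / 2
      have e2 : gradComponent Y u₂ ζ = Complex.I * κ 0 / ζ ^ 2 +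
          (-Complex.I * deriv H ζ + Complex.I * h ζ / 2) := by
        linear_combination -Complex.I * h1 / 2 + Complex.I * h2 / 2 +
          gradComponent Y u₂ ζ * Complex.I_sq
      rw [e1, e2]
      ring
  · have h1 : inner ℝ u₂ u₁ = 0 := by rw [real_inner_comm]; exact h12
    have h2 := hv u₁
    rw [h0, h1, real_inner_self_eq_norm_sq, hu₁] at h2
    simp at h2
    exact hκ0 h2

/-- At an embedded planar end of finite total curvature the complex gradient of the immersion has a
double pole without residue. The curvature enters through the hypothesis `hcurv` that the Gauss map
`g = q / B` has finite spherical area. -/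
theorem gradComponent_expansion_at_end {Y : ℂ → E3} {r : ℝ} (hr : 0 < r)
    (hharm : ∀ u, ∀ ζ ∈ Metric.ball (0 : ℂ) r \ {0},
      InnerProductSpace.HarmonicAt (fun ζ => inner ℝ u (Y ζ)) ζ)
    (hconf : ∀ ζ ∈ Metric.ball (0 : ℂ) r \ {0}, ∀ b : OrthonormalBasis (Fin 3) ℝ E3,
      gradComponent Y (b 0) ζ ^ 2 + gradComponent Y (b 1) ζ ^ 2 + gradComponent Y (b 2) ζ ^ 2 = 0)
    (hcurv : ∀ b : OrthonormalBasis (Fin 3) ℝ E3, ∀ δ > 0, δ ≤ r → ∀ g : ℂ → ℂ,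
      DifferentiableOn ℂ g (Metric.ball 0 δ \ {0}) →
      (∀ ζ ∈ Metric.ball (0 : ℂ) δ \ {0},
        gradComponent Y (b 0) ζ - Complex.I * gradComponent Y (b 1) ζ ≠ 0 ∧
        g ζ * (gradComponent Y (b 0) ζ - Complex.I * gradComponent Y (b 1) ζ) =
          gradComponent Y (b 2) ζ) →
      ∫⁻ ζ in Metric.ball (0 : ℂ) δ \ {0},
        ENNReal.ofReal (‖deriv g ζ‖ ^ 2 / (1 + ‖g ζ‖ ^ 2) ^ 2) ≠ ⊤)
    (hinj : InjOn Y (Metric.ball 0 r \ {0}))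
    (hinf : Tendsto (fun ζ => ‖Y ζ‖) (𝓝[≠] 0) atTop) {ν : E3} (hν : ‖ν‖ = 1) {c : ℝ}
    (hplane : Tendsto (fun ζ => inner ℝ ν (Y ζ)) (𝓝[≠] 0) (𝓝 c)) :
    ∃ v : E3 →ₗ[ℝ] ℂ, (∀ u, ∃ k : ℂ → ℂ, AnalyticAt ℂ k 0 ∧
      ∀ᶠ ζ in 𝓝[≠] 0, gradComponent Y u ζ = v u / ζ ^ 2 + k ζ) ∧ v ≠ 0 := by
  obtain ⟨b, hb⟩ : ∃ b : OrthonormalBasis (Fin 3) ℝ E3, b 2 = ν := by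
    have hon : Orthonormal ℝ (({2} : Set (Fin 3)).domRestrict fun _ => ν) := by
      refine ⟨fun _ => hν, fun i j hij => absurd ?_ hij⟩
      exact Subsingleton.elim i j
    obtain ⟨b, hb⟩ := hon.exists_orthonormalBasis_extension_of_card_eq (by simp)
    exact ⟨b, hb 2 rfl⟩
  have hbr : ∀ y : E3, y = inner ℝ (b 0) y • b 0 + inner ℝ (b 1) y • b 1 + inner ℝ ν y • ν := by
    intro y
    conv_lhs => rw [← b.sum_repr' y]
    rw [Fin.sum_univ_three, hb]
  have hb01 : inner ℝ (b 0) (b 1) = 0 := b.orthonormal.2 (by decide)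
  set A : ℂ → ℂ := fun ζ => gradComponent Y (b 0) ζ + Complex.I * gradComponent Y (b 1) ζ with hA
  set B : ℂ → ℂ := fun ζ => gradComponent Y (b 0) ζ - Complex.I * gradComponent Y (b 1) ζ with hB
  have hgd : ∀ u, ∀ ζ ∈ Metric.ball (0 : ℂ) r \ {0}, DifferentiableAt ℂ (gradComponent Y u) ζ :=
    fun u ζ hζ => HarmonicAt.differentiableAt_complex_partial (hharm u ζ hζ)
  have hAd : ∀ ζ ∈ Metric.ball (0 : ℂ) r \ {0}, DifferentiableAt ℂ A ζ := fun ζ hζ =>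
    (hgd _ ζ hζ).add ((hgd _ ζ hζ).const_mul _)
  have hBd : ∀ ζ ∈ Metric.ball (0 : ℂ) r \ {0}, DifferentiableAt ℂ B ζ := fun ζ hζ =>
    (hgd _ ζ hζ).sub ((hgd _ ζ hζ).const_mul _)
  have hAB : ∀ ζ ∈ Metric.ball (0 : ℂ) r \ {0}, A ζ * B ζ = -gradComponent Y ν ζ ^ 2 := by
    intro ζ hζ
    have := hconf ζ hζ b
    rw [hb] at this
    simp only [hA, hB]
    linear_combination this - gradComponent Y (b 1) ζ ^ 2 * Complex.I_sq
  obtain ⟨q, hq, hgq⟩ := exists_analyticAt_complexGradient hr (hharm ν) hplane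
  have hev : ∀ {φ : ℂ → ℂ}, (∀ ζ ∈ Metric.ball (0 : ℂ) r \ {0}, DifferentiableAt ℂ φ ζ) →
      ∀ᶠ ζ in 𝓝[≠] (0 : ℂ), DifferentiableAt ℂ φ ζ := fun h => by
    filter_upwards [puncturedBall_mem_nhdsWithin hr] with ζ hζ using h ζ hζ
  -- one of the two isotropic components of the gradient is regular at the end
  have hor : (∃ h, AnalyticAt ℂ h 0 ∧ A =ᶠ[𝓝[≠] 0] h) ∨ (∃ h, AnalyticAt ℂ h 0 ∧ B =ᶠ[𝓝[≠] 0] h) := by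
    rcases hq.eventually_eq_zero_or_eventually_ne_zero with hq0 | hq0
    · have h0 : ∀ᶠ ζ in 𝓝[≠] (0 : ℂ), A ζ * B ζ = 0 := by
        filter_upwards [hgq, hq0.filter_mono nhdsWithin_le_nhds, puncturedBall_mem_nhdsWithin hr]
          with ζ h1 h2 hζ
        rw [hAB ζ hζ, gradComponent, h1, h2]
        simp
      obtain ⟨δ, hδ, hδ0⟩ := exists_puncturedBall_of_eventually h0
      have hsub : Metric.ball (0 : ℂ) (min δ r) \ {0} ⊆ Metric.ball 0 r \ {0} := fun ζ hζ =>
        ⟨Metric.ball_subset_ball (min_le_right _ _) hζ.1, hζ.2⟩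
      have hopen := isOpen_puncturedBall (min δ r)
      have hAa : AnalyticOnNhd ℂ A (Metric.ball 0 (min δ r) \ {0}) :=
        DifferentiableOn.analyticOnNhd (fun ζ hζ => (hAd ζ (hsub hζ)).differentiableWithinAt) hopen
      have hBa : AnalyticOnNhd ℂ B (Metric.ball 0 (min δ r) \ {0}) :=
        DifferentiableOn.analyticOnNhd (fun ζ hζ => (hBd ζ (hsub hζ)).differentiableWithinAt) hopen
      have hmem := puncturedBall_mem_nhdsWithin (lt_min hδ hr)
      rcases hAa.eq_zero_or_eq_zero_of_smul_eq_zero hBa (fun ζ hζ =>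
        hδ0 ζ ⟨Metric.ball_subset_ball (min_le_left _ _) hζ.1, hζ.2⟩)
        (isPreconnected_puncturedBall _) with h | h
      · exact Or.inl ⟨fun _ => 0, analyticAt_const, by
          filter_upwards [hmem] with ζ hζ using h ζ hζ⟩
      · exact Or.inr ⟨fun _ => 0, analyticAt_const, by
          filter_upwards [hmem] with ζ hζ using h ζ hζ⟩
    · have hne : ∀ᶠ ζ in 𝓝[≠] (0 : ℂ), gradComponent Y ν ζ ≠ 0 := by
        filter_upwards [hgq, hq0] with ζ h1 h2
        rw [gradComponent, h1]; exact h2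
      obtain ⟨δ, hδ, hδ0⟩ := exists_puncturedBall_of_eventually hne
      have hsub : ∀ ζ ∈ Metric.ball (0 : ℂ) (min δ r) \ {0}, ζ ∈ Metric.ball (0 : ℂ) r \ {0} ∧
          gradComponent Y ν ζ ≠ 0 := fun ζ hζ =>
        ⟨⟨Metric.ball_subset_ball (min_le_right _ _) hζ.1, hζ.2⟩,
          hδ0 ζ ⟨Metric.ball_subset_ball (min_le_left _ _) hζ.1, hζ.2⟩⟩
      have hB0 : ∀ ζ ∈ Metric.ball (0 : ℂ) (min δ r) \ {0}, B ζ ≠ 0 := fun ζ hζ h => by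
        have := hAB ζ (hsub ζ hζ).1
        rw [h, mul_zero, eq_comm, neg_eq_zero, sq_eq_zero_iff] at this
        exact (hsub ζ hζ).2 this
      set g : ℂ → ℂ := fun ζ => gradComponent Y ν ζ / B ζ with hg
      have hgdiff : DifferentiableOn ℂ g (Metric.ball 0 (min δ r) \ {0}) := fun ζ hζ =>
        ((hgd ν ζ (hsub ζ hζ).1).fun_div (hBd ζ (hsub ζ hζ).1) (hB0 ζ hζ)).differentiableWithinAt
      have hg0 : ∀ ζ ∈ Metric.ball (0 : ℂ) (min δ r) \ {0}, g ζ ≠ 0 := fun ζ hζ =>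
        div_ne_zero (hsub ζ hζ).2 (hB0 ζ hζ)
      have harea := hcurv b (min δ r) (lt_min hδ hr) (min_le_right _ _) g hgdiff fun ζ hζ =>
        ⟨hB0 ζ hζ, by rw [hb]; exact div_mul_cancel₀ _ (hB0 ζ hζ)⟩
      -- `q` is bounded near the end
      have hqb : ∀ᶠ ζ in 𝓝[≠] (0 : ℂ), ‖gradComponent Y ν ζ‖ ≤ ‖q 0‖ + 1 := by
        have h1 : ∀ᶠ ζ in 𝓝 (0 : ℂ), ‖q ζ‖ < ‖q 0‖ + 1 :=
          hq.continuousAt.norm.eventually (gt_mem_nhds (lt_add_one _))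
        filter_upwards [hgq, h1.filter_mono nhdsWithin_le_nhds] with ζ h2 h3
        rw [gradComponent, h2]; exact h3.le
      have hmem := puncturedBall_mem_nhdsWithin (lt_min hδ hr)
      rcases eventually_norm_le_or_ge_of_finite_sphericalArea (lt_min hδ hr) hgdiff hg0 harea
        with h | h
      · left
        refine exists_analyticAt_of_bounded (C := 2 * (‖q 0‖ + 1)) (hev hAd) ?_
        filter_upwards [h, hqb, hmem] with ζ h1 h2 hζ
        have hA' : A ζ = -(g ζ * gradComponent Y ν ζ) := by
          have h3 := hAB ζ (hsub ζ hζ).1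
          have h4 := hB0 ζ hζ
          simp only [hg]
          field_simp
          linear_combination h3
        rw [hA', norm_neg, norm_mul]
        exact mul_le_mul h1 h2 (norm_nonneg _) (by norm_num)
      · right
        refine exists_analyticAt_of_bounded (C := 2 * (‖q 0‖ + 1)) (hev hBd) ?_
        filter_upwards [h, hqb, hmem] with ζ h1 h2 hζ
        have hBpos : 0 < ‖B ζ‖ := norm_pos_iff.mpr (hB0 ζ hζ)
        simp only [hg] at h1
        rw [norm_div, le_div_iff₀ hBpos] at h1
        linarith
  rcases hor with ⟨h, hh, hAh⟩ | ⟨h, hh, hBh⟩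
  · refine gradComponent_expansion_of_analytic hr (u₁ := b 0) (u₂ := -b 1) (ν := ν)
      (b.orthonormal.1 0) (by rw [norm_neg]; exact b.orthonormal.1 1) hν
      (by rw [inner_neg_right, hb01, neg_zero])
      (fun y => by rw [inner_neg_left, smul_neg, neg_smul, neg_neg]; exact hbr y)
      hharm hinj hinf hplane hh hq ?_ hgq
    filter_upwards [hAh] with ζ hζ
    rw [gradComponent_neg, ← hζ]
    ring
  · exact gradComponent_expansion_of_analytic hr (b.orthonormal.1 0) (b.orthonormal.1 1) hν hb01
      hbr hharm hinj hinf hplane hh hq hBh hgq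

end RiemannSphere

/-! ### Holomorphic changes of coordinates -/

open InnerProductSpace in
theorem harmonicAt_comp_analyticAt {f : ℂ → ℝ} {k : ℂ → ℂ} {z : ℂ} (hf : HarmonicAt f (k z))
    (hk : AnalyticAt ℂ k z) : HarmonicAt (f ∘ k) z := by
  obtain ⟨R, hR, hfR⟩ := Metric.eventually_nhds_iff_ball.mp hf.eventually
  obtain ⟨F, hF, hFf⟩ :=
    HarmonicOnNhd.exists_analyticOnNhd_ball_re_eq (f := f) (z := k z) (R := R) hfR
  have hkz : k z ∈ Metric.ball (k z) R := Metric.mem_ball_self hR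
  have h1 : AnalyticAt ℂ (F ∘ k) z := (hF _ hkz).comp hk
  refine (harmonicAt_congr_nhds ?_).mp h1.harmonicAt_re
  filter_upwards [hk.continuousAt.preimage_mem_nhds (Metric.isOpen_ball.mem_nhds hkz)] with y hy
  exact hFf hy

theorem complexGradient_comp {f : ℂ → ℝ} {k : ℂ → ℂ} {k' z : ℂ}
    (hf : DifferentiableAt ℝ f (k z)) (hk : HasDerivAt k k' z) :
    complexGradient (f ∘ k) z = complexGradient f (k z) * k' := by
  have h : ∀ v, fderiv ℝ (f ∘ k) z v = (complexGradient f (k z) * (k' * v)).re := fun v => by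
    rw [re_complexGradient_mul,
      (hf.hasFDerivAt.comp z (hk.hasFDerivAt.restrictScalars ℝ)).fderiv]
    simp [mul_comm]
  rw [complexGradient, h, h]
  apply Complex.ext
  · simp
  · simp [add_comm]

namespace RiemannSphere

/-- The map `X` in the coordinate `z` of the finite plane. -/
def planeRep (X : OnePoint ℂ → E3) : ℂ → E3 := fun z => X (z : OnePoint ℂ)

/-- The coordinate `z` as a function of the coordinate `ζ ≠ 0` centred at `p`. -/
noncomputable def chartMap (p : OnePoint ℂ) (ζ : ℂ) : ℂ :=
  OnePoint.elim p ζ⁻¹ (fun a => a + ζ)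

/-- The derivative of `chartMap p`. -/
noncomputable def chartDeriv (p : OnePoint ℂ) (ζ : ℂ) : ℂ :=
  OnePoint.elim p (-(ζ ^ 2)⁻¹) (fun _ => 1)

theorem param_eq_chartMap (p : OnePoint ℂ) {ζ : ℂ} (h : ζ ≠ 0) :
    param p ζ = (chartMap p ζ : OnePoint ℂ) := by
  induction p using OnePoint.rec with
  | infty => exact param_infty h
  | coe a => rfl

theorem hasDerivAt_chartMap (p : OnePoint ℂ) {ζ : ℂ} (h : ζ ≠ 0) :
    HasDerivAt (chartMap p) (chartDeriv p ζ) ζ := by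
  induction p using OnePoint.rec with
  | infty => exact hasDerivAt_inv h
  | coe a => exact (hasDerivAt_id ζ).const_add a

theorem chartDeriv_ne_zero (p : OnePoint ℂ) {ζ : ℂ} (h : ζ ≠ 0) : chartDeriv p ζ ≠ 0 := by
  induction p using OnePoint.rec with
  | infty => exact neg_ne_zero.mpr (inv_ne_zero (pow_ne_zero 2 h))
  | coe a => exact one_ne_zero

theorem chartMap_injective (p : OnePoint ℂ) : Function.Injective (chartMap p) := by
  induction p using OnePoint.rec with
  | infty => exact inv_injective
  | coe a => exact add_right_injective a

theorem analyticAt_chartMap (p : OnePoint ℂ) {ζ : ℂ} (h : ζ ≠ 0) :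
    AnalyticAt ℂ (chartMap p) ζ := by
  have : DifferentiableOn ℂ (chartMap p) {0}ᶜ := fun x hx =>
    (hasDerivAt_chartMap p hx).differentiableAt.differentiableWithinAt
  exact this.analyticAt (isOpen_compl_singleton.mem_nhds h)

theorem localRep_eventuallyEq (X : OnePoint ℂ → E3) (p : OnePoint ℂ) {ζ : ℂ} (h : ζ ≠ 0) :
    localRep X p =ᶠ[𝓝 ζ] planeRep X ∘ chartMap p := by
  filter_upwards [isOpen_compl_singleton.mem_nhds h] with x hx
  simp only [localRep, planeRep, Function.comp_apply]
  rw [param_eq_chartMap p hx]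

/-! ### The complex gradient of a minimal surface -/

theorem gradComponent_eq {Y : ℂ → E3} {ζ : ℂ} (hY : DifferentiableAt ℝ Y ζ) (u : E3) :
    gradComponent Y u ζ =
      (inner ℝ u (fderiv ℝ Y ζ 1) : ℝ) - Complex.I * (inner ℝ u (fderiv ℝ Y ζ Complex.I) : ℝ) := by
  have h : fderiv ℝ (fun ζ => inner ℝ u (Y ζ)) ζ = (innerSL ℝ u).comp (fderiv ℝ Y ζ) :=
    ((innerSL ℝ u).hasFDerivAt.comp ζ hY.hasFDerivAt).fderiv
  simp only [gradComponent, complexGradient]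
  rw [h]
  simp

/-- A conformal frame `x, y` gives an isotropic vector `x - i y`. -/
theorem sum_sq_eq_zero_of_conformal (b : OrthonormalBasis (Fin 3) ℝ E3) {x y : E3}
    (h1 : ‖x‖ = ‖y‖) (h2 : inner ℝ x y = 0) :
    ∑ i, ((inner ℝ (b i) x : ℝ) - Complex.I * (inner ℝ (b i) y : ℝ)) ^ 2 = 0 := by
  have hx := b.sum_inner_mul_inner x x
  have hy := b.sum_inner_mul_inner y y
  have hxy := b.sum_inner_mul_inner x y
  rw [real_inner_self_eq_norm_sq] at hx hy
  rw [h2] at hxy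
  rw [h1, ← hy] at hx
  simp only [Fin.sum_univ_three, real_inner_comm (b _)] at hx hy hxy ⊢
  have hx' := congrArg (fun t : ℝ => (t : ℂ)) hx
  have hxy' := congrArg (fun t : ℝ => (t : ℂ)) hxy
  push_cast at hx' hxy'
  linear_combination hx' - 2 * Complex.I * hxy' + ((inner ℝ (b 0) y : ℂ) ^ 2 +
    (inner ℝ (b 1) y : ℂ) ^ 2 + (inner ℝ (b 2) y : ℂ) ^ 2) * Complex.I_sq

theorem sum_norm_sq_gradComponent {Y : ℂ → E3} {ζ : ℂ} (hY : DifferentiableAt ℝ Y ζ)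
    (b : OrthonormalBasis (Fin 3) ℝ E3) :
    ∑ i, ‖gradComponent Y (b i) ζ‖ ^ 2 =
      ‖fderiv ℝ Y ζ 1‖ ^ 2 + ‖fderiv ℝ Y ζ Complex.I‖ ^ 2 := by
  rw [← b.sum_sq_norm_inner_right, ← b.sum_sq_norm_inner_right, ← Finset.sum_add_distrib]
  refine Finset.sum_congr rfl fun i _ => ?_
  rw [gradComponent_eq hY, ← Complex.normSq_eq_norm_sq, Complex.normSq_apply]
  simp
  ring

section Minimal

variable {P : Finset (OnePoint ℂ)} {X : OnePoint ℂ → E3}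

theorem IsBranchedMinimal.contDiffAt_planeRep (hX : IsBranchedMinimal P X) {a : ℂ}
    (ha : (a : OnePoint ℂ) ∉ P) : ContDiffAt ℝ 2 (planeRep X) a := by
  have h1 := (hX.harmonic _ ha).1
  have h2 : ContDiffAt ℝ 2 (localRep X (a : OnePoint ℂ) ∘ fun z => z - a) a :=
    ContDiffAt.comp a (by simpa using h1) (contDiffAt_id.sub contDiffAt_const)
  refine h2.congr_of_eventuallyEq (Eventually.of_forall fun z => ?_)
  simp [localRep, planeRep]

theorem IsBranchedMinimal.differentiableAt_planeRep (hX : IsBranchedMinimal P X) {a : ℂ}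
    (ha : (a : OnePoint ℂ) ∉ P) : DifferentiableAt ℝ (planeRep X) a :=
  (hX.contDiffAt_planeRep ha).differentiableAt two_ne_zero

theorem fderiv_localRep_coe (X : OnePoint ℂ → E3) (a ζ : ℂ) :
    fderiv ℝ (localRep X (a : OnePoint ℂ)) ζ = fderiv ℝ (planeRep X) (a + ζ) :=
  fderiv_comp_add_left (f := planeRep X) a

theorem IsBranchedMinimal.harmonicAt_inner (hX : IsBranchedMinimal P X) {a : ℂ}
    (ha : (a : OnePoint ℂ) ∉ P) (u : E3) :
    InnerProductSpace.HarmonicAt (fun z => inner ℝ u (planeRep X z)) a := by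
  have h1 := (hX.harmonic _ ha).comp_CLM (innerSL ℝ u)
  have h2 := harmonicAt_comp_analyticAt (k := fun z => z - a) (z := a) (by simpa using h1)
    (analyticAt_id.sub analyticAt_const)
  refine (InnerProductSpace.harmonicAt_congr_nhds (Eventually.of_forall fun z => ?_)).mp h2
  simp [localRep, planeRep]

theorem IsBranchedMinimal.analyticAt_gradComponent (hX : IsBranchedMinimal P X) {a : ℂ}
    (ha : (a : OnePoint ℂ) ∉ P) (u : E3) : AnalyticAt ℂ (gradComponent (planeRep X) u) a :=
  HarmonicAt.analyticAt_complex_partial (hX.harmonicAt_inner ha u)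

theorem IsBranchedMinimal.norm_fderiv_planeRep (hX : IsBranchedMinimal P X) {a : ℂ}
    (ha : (a : OnePoint ℂ) ∉ P) :
    ‖fderiv ℝ (planeRep X) a 1‖ = ‖fderiv ℝ (planeRep X) a Complex.I‖ := by
  have := hX.conformal_norm _ ha
  rwa [fderiv_localRep_coe, add_zero] at this

/-- The complex gradient of a conformal map is isotropic. -/
theorem IsBranchedMinimal.sum_sq_gradComponent (hX : IsBranchedMinimal P X) {a : ℂ}
    (ha : (a : OnePoint ℂ) ∉ P) (b : OrthonormalBasis (Fin 3) ℝ E3) :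
    gradComponent (planeRep X) (b 0) a ^ 2 + gradComponent (planeRep X) (b 1) a ^ 2 +
      gradComponent (planeRep X) (b 2) a ^ 2 = 0 := by
  have h2 := hX.conformal_inner _ ha
  rw [fderiv_localRep_coe, add_zero] at h2
  have := sum_sq_eq_zero_of_conformal b (hX.norm_fderiv_planeRep ha) h2
  simpa only [gradComponent_eq (hX.differentiableAt_planeRep ha), Fin.sum_univ_three] using this

theorem IsBranchedMinimal.gradComponent_localRep (hX : IsBranchedMinimal P X) (p : OnePoint ℂ)
    {ζ : ℂ} (hζ : ζ ≠ 0) (hP : param p ζ ∉ P) (u : E3) :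
    gradComponent (localRep X p) u ζ =
      gradComponent (planeRep X) u (chartMap p ζ) * chartDeriv p ζ := by
  rw [param_eq_chartMap p hζ] at hP
  have h1 : DifferentiableAt ℝ (fun z => inner ℝ u (planeRep X z)) (chartMap p ζ) :=
    (hX.harmonicAt_inner hP u).1.differentiableAt two_ne_zero
  rw [gradComponent, gradComponent, ← complexGradient_comp h1 (hasDerivAt_chartMap p hζ)]
  refine complexGradient_congr ?_
  filter_upwards [localRep_eventuallyEq X p hζ] with x hx
  rw [hx]; rfl

theorem IsBranchedMinimal.harmonicAt_inner_localRep (hX : IsBranchedMinimal P X) (p : OnePoint ℂ)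
    {ζ : ℂ} (hζ : ζ ≠ 0) (hP : param p ζ ∉ P) (u : E3) :
    InnerProductSpace.HarmonicAt (fun ζ => inner ℝ u (localRep X p ζ)) ζ := by
  rw [param_eq_chartMap p hζ] at hP
  refine (InnerProductSpace.harmonicAt_congr_nhds ?_).mp
    (harmonicAt_comp_analyticAt (hX.harmonicAt_inner hP u) (analyticAt_chartMap p hζ))
  filter_upwards [localRep_eventuallyEq X p hζ] with x hx
  rw [hx]; rfl

end Minimal

end RiemannSphere

/-! ### Finite total curvature and the spherical area of the Gauss map -/

theorem laplacian_eq_fderiv_fderiv {f : ℂ → ℝ} {z : ℂ} (hf : ContDiffAt ℝ 2 f z) :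
    Δ f z = fderiv ℝ (fun w => fderiv ℝ f w 1) z 1 +
      fderiv ℝ (fun w => fderiv ℝ f w Complex.I) z Complex.I := by
  have h1 : DifferentiableAt ℝ (fderiv ℝ f) z :=
    (hf.fderiv_right (m := 1) (by norm_num)).differentiableAt one_ne_zero
  have h2 : ∀ v, fderiv ℝ (fun w => fderiv ℝ f w v) z v = fderiv ℝ (fderiv ℝ f) z v v := fun v => by
    rw [fderiv_clm_apply h1 (differentiableAt_const v)]
    simp
  rw [InnerProductSpace.laplacian_eq_iteratedFDeriv_complexPlane, h2, h2]
  simp [iteratedFDeriv_two_apply]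

theorem contDiffAt_log_one_add_norm_sq {G : ℂ → ℂ} {z : ℂ} (hG : AnalyticAt ℂ G z) :
    ContDiffAt ℝ 2 (fun w => Real.log (1 + ‖G w‖ ^ 2)) z := by
  have h1 : ContDiffAt ℝ 2 G z := hG.contDiffAt.restrict_scalars ℝ
  exact (contDiffAt_const.add (h1.norm_sq ℝ)).log (by positivity)

/-- The Laplacian of `log (1 + |G|²)` is four times the density of the spherical area. -/
theorem laplacian_log_one_add_norm_sq {G : ℂ → ℂ} {z : ℂ} (hG : AnalyticAt ℂ G z) :
    Δ (fun w => Real.log (1 + ‖G w‖ ^ 2)) z = 4 * (‖deriv G z‖ ^ 2 / (1 + ‖G z‖ ^ 2) ^ 2) := by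
  have hpos : ∀ w, (1 + ‖G w‖ ^ 2) ≠ 0 := fun w => by positivity
  set f : ℂ → ℝ := fun w => Real.log (1 + ‖G w‖ ^ 2) with hf
  have hcd : ContDiffAt ℝ 2 f z := contDiffAt_log_one_add_norm_sq hG
  have hline : ∀ (w v : ℂ), HasDerivAt (fun t : ℝ => w + t * v) v 0 := fun w v => by
    simpa using ((Complex.ofRealCLM.hasDerivAt (x := 0)).mul_const v).const_add w
  have hcomp : ∀ {H : ℂ → ℂ} {H' w v : ℂ}, HasDerivAt H H' w →
      HasDerivAt (fun t : ℝ => H (w + t * v)) (H' * v) 0 := fun {H H' w v} h => by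
    have h' : HasDerivAt H H' (w + (0 : ℝ) * v) := by simpa using h
    exact h'.comp (0 : ℝ) (hline w v)
  have hfd : ∀ {g : ℂ → ℝ} {g' : ℝ} {w v : ℂ}, DifferentiableAt ℝ g w →
      HasDerivAt (fun t : ℝ => g (w + t * v)) g' 0 → fderiv ℝ g w v = g' :=
    fun {g g' w v} h h' => by
      have h1 : HasFDerivAt g (fderiv ℝ g w) (w + (0 : ℝ) * v) := by simpa using h.hasFDerivAt
      exact (h1.comp_hasDerivAt (0 : ℝ) (hline w v)).unique h'
  have hev : ∀ᶠ w in 𝓝 z, ∀ v, fderiv ℝ f w v =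
      2 * inner ℝ (G w) (deriv G w * v) / (1 + ‖G w‖ ^ 2) := by
    filter_upwards [hG.eventually_analyticAt] with w hw v
    have h1 := hcomp (v := v) hw.differentiableAt.hasDerivAt
    have h2 := (h1.norm_sq.const_add 1).log (hpos _)
    refine (hfd ((contDiffAt_log_one_add_norm_sq hw).differentiableAt two_ne_zero) h2).trans ?_
    simp
  have hdf : DifferentiableAt ℝ (fderiv ℝ f) z :=
    (hcd.fderiv_right (m := 1) (by norm_num)).differentiableAt one_ne_zero
  have hsecond : ∀ v, fderiv ℝ (fun w => fderiv ℝ f w v) z v =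
      2 * (inner ℝ (G z) (deriv (deriv G) z * v * v) + inner ℝ (deriv G z * v) (deriv G z * v)) /
        (1 + ‖G z‖ ^ 2) - 4 * inner ℝ (G z) (deriv G z * v) ^ 2 / (1 + ‖G z‖ ^ 2) ^ 2 := by
    intro v
    have h0 : (fun w => fderiv ℝ f w v) =ᶠ[𝓝 z]
        fun w => 2 * inner ℝ (G w) (deriv G w * v) / (1 + ‖G w‖ ^ 2) := hev.mono fun w h => h v
    rw [h0.fderiv_eq]
    have h1 := hcomp (v := v) hG.differentiableAt.hasDerivAt
    have h2 := (hcomp (v := v) hG.deriv.differentiableAt.hasDerivAt).mul_const v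
    have h3 := ((h1.inner ℝ h2).const_mul 2).div (h1.norm_sq.const_add 1) (hpos _)
    refine (hfd (h0.differentiableAt_iff.mp (hdf.clm_apply (differentiableAt_const v))) h3).trans ?_
    have := hpos z
    simp only [Complex.ofReal_zero, zero_mul, add_zero]
    field_simp
    ring
  rw [laplacian_eq_fderiv_fderiv hcd, hsecond, hsecond]
  have := hpos z
  field_simp
  simp only [Complex.inner, ← Complex.normSq_eq_norm_sq, Complex.normSq_apply]
  simp
  ring

/-- The real Jacobian of a multiplication on `ℂ`. -/
theorem det_mul_restrictScalars (c : ℂ) :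
    ((ContinuousLinearMap.toSpanSingleton ℂ c).restrictScalars ℝ).det = ‖c‖ ^ 2 := by
  have h : (((ContinuousLinearMap.toSpanSingleton ℂ c).restrictScalars ℝ : ℂ →L[ℝ] ℂ) : ℂ →ₗ[ℝ] ℂ) =
      LinearMap.mulLeft ℝ c := by
    ext; simp [mul_comm]
  rw [ContinuousLinearMap.det, h, ← Complex.normSq_eq_norm_sq, ← Algebra.norm_complex_apply,
    Algebra.norm_apply]
  rfl

namespace RiemannSphere

/-- The isotropic component `g₀ - i g₁` of the complex gradient with respect to an orthonormal
basis. -/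
noncomputable def isotropicComponent (X : OnePoint ℂ → E3) (b : OrthonormalBasis (Fin 3) ℝ E3)
    (z : ℂ) : ℂ :=
  gradComponent (planeRep X) (b 0) z - Complex.I * gradComponent (planeRep X) (b 1) z

/-- The Gauss map `g₂ / (g₀ - i g₁)` of a minimal surface with complex gradient `(g₀, g₁, g₂)`. -/
noncomputable def gaussMap (X : OnePoint ℂ → E3) (b : OrthonormalBasis (Fin 3) ℝ E3) (z : ℂ) : ℂ :=
  gradComponent (planeRep X) (b 2) z / isotropicComponent X b z

section Minimal

variable {P : Finset (OnePoint ℂ)} {X : OnePoint ℂ → E3}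

/-- The metric in terms of the isotropic components `A, B` of the complex gradient: since
`A B = - g₂²`, the sum of the `|gᵢ|²` is `(|A| + |B|)² / 2`. -/
theorem IsBranchedMinimal.metricFactor_eq (hX : IsBranchedMinimal P X) {a : ℂ}
    (ha : (a : OnePoint ℂ) ∉ P) (b : OrthonormalBasis (Fin 3) ℝ E3) :
    metricFactor X a = (‖gradComponent (planeRep X) (b 0) a +
      Complex.I * gradComponent (planeRep X) (b 1) a‖ +
      ‖gradComponent (planeRep X) (b 0) a -
      Complex.I * gradComponent (planeRep X) (b 1) a‖) ^ 2 / 4 := by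
  have h1 := sum_norm_sq_gradComponent (hX.differentiableAt_planeRep ha) b
  rw [← hX.norm_fderiv_planeRep ha, Fin.sum_univ_three] at h1
  have h2 := hX.sum_sq_gradComponent ha b
  change ‖fderiv ℝ (planeRep X) a 1‖ ^ 2 = _
  generalize gradComponent (planeRep X) (b 0) a = g₀ at *
  generalize gradComponent (planeRep X) (b 1) a = g₁ at *
  generalize gradComponent (planeRep X) (b 2) a = g₂ at *
  have h3 : ‖g₀ + Complex.I * g₁‖ * ‖g₀ - Complex.I * g₁‖ = ‖g₂‖ ^ 2 := by
    rw [← norm_mul, ← norm_pow, ← norm_neg (g₂ ^ 2)]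
    congr 1
    linear_combination h2 - g₁ ^ 2 * Complex.I_sq
  have h4 := parallelogram_law_with_norm ℝ g₀ (Complex.I * g₁)
  rw [norm_mul Complex.I, Complex.norm_I] at h4
  nlinarith

theorem IsBranchedMinimal.metricFactor_eq_gaussMap (hX : IsBranchedMinimal P X) {a : ℂ}
    (ha : (a : OnePoint ℂ) ∉ P) (b : OrthonormalBasis (Fin 3) ℝ E3)
    (hB : isotropicComponent X b a ≠ 0) :
    metricFactor X a = ‖isotropicComponent X b a‖ ^ 2 * (1 + ‖gaussMap X b a‖ ^ 2) ^ 2 / 4 := by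
  rw [hX.metricFactor_eq ha b]
  have h2 := hX.sum_sq_gradComponent ha b
  have h3 : gradComponent (planeRep X) (b 0) a + Complex.I * gradComponent (planeRep X) (b 1) a =
      -(gaussMap X b a ^ 2 * isotropicComponent X b a) := by
    rw [gaussMap]
    field_simp
    rw [isotropicComponent]
    linear_combination h2 - gradComponent (planeRep X) (b 1) a ^ 2 * Complex.I_sq
  rw [h3, norm_neg, norm_mul, norm_pow, isotropicComponent]
  ring

theorem IsBranchedMinimal.analyticAt_isotropicComponent (hX : IsBranchedMinimal P X) {a : ℂ}
    (ha : (a : OnePoint ℂ) ∉ P) (b : OrthonormalBasis (Fin 3) ℝ E3) :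
    AnalyticAt ℂ (isotropicComponent X b) a :=
  (hX.analyticAt_gradComponent ha _).sub (analyticAt_const.mul (hX.analyticAt_gradComponent ha _))

theorem IsBranchedMinimal.analyticAt_gaussMap (hX : IsBranchedMinimal P X) {a : ℂ}
    (ha : (a : OnePoint ℂ) ∉ P) (b : OrthonormalBasis (Fin 3) ℝ E3)
    (hB : isotropicComponent X b a ≠ 0) : AnalyticAt ℂ (gaussMap X b) a :=
  (hX.analyticAt_gradComponent ha _).div (hX.analyticAt_isotropicComponent ha b) hB

/-- The curvature form is the pullback of the spherical area by the Gauss map, up to the factor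
`-4`. -/
theorem IsBranchedMinimal.gaussCurvature_mul_metricFactor (hX : IsBranchedMinimal P X) {a : ℂ}
    (ha : (a : OnePoint ℂ) ∉ P) (b : OrthonormalBasis (Fin 3) ℝ E3)
    (hB : isotropicComponent X b a ≠ 0) :
    gaussCurvature X a * metricFactor X a =
      -4 * (‖deriv (gaussMap X b) a‖ ^ 2 / (1 + ‖gaussMap X b a‖ ^ 2) ^ 2) := by
  have hBan := hX.analyticAt_isotropicComponent ha b
  have hGan := hX.analyticAt_gaussMap ha b hB
  -- `log λ = 2 log |B| + 2 log (1 + |G|²) - log 4`, where `log |B|` is harmonic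
  have hev : (fun z => Real.log (metricFactor X z)) =ᶠ[𝓝 a]
      ((2 : ℝ) • (fun z => Real.log ‖isotropicComponent X b z‖) +
        (2 : ℝ) • (fun z => Real.log (1 + ‖gaussMap X b z‖ ^ 2))) + fun _ => -Real.log 4 := by
    filter_upwards [eventually_coe_notMem P ha, hBan.continuousAt.eventually_ne hB] with z hz hBz
    have h1 : ‖isotropicComponent X b z‖ ^ 2 ≠ 0 := pow_ne_zero 2 (norm_ne_zero_iff.mpr hBz)
    have h2 : (1 + ‖gaussMap X b z‖ ^ 2) ^ 2 ≠ 0 := by positivity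
    rw [hX.metricFactor_eq_gaussMap hz b hBz, Real.log_div (mul_ne_zero h1 h2) (by norm_num),
      Real.log_mul h1 h2, Real.log_pow, Real.log_pow]
    simp [smul_eq_mul]
    ring
  have hharm := hBan.harmonicAt_log_norm hB
  have hcd := contDiffAt_log_one_add_norm_sq hGan
  have h2B : ContDiffAt ℝ 2 ((2 : ℝ) • fun z => Real.log ‖isotropicComponent X b z‖) a :=
    hharm.1.const_smul (2 : ℝ)
  have h2G : ContDiffAt ℝ 2 ((2 : ℝ) • fun z => Real.log (1 + ‖gaussMap X b z‖ ^ 2)) a :=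
    hcd.const_smul (2 : ℝ)
  have hlap : Δ (fun z => Real.log (metricFactor X z)) a =
      8 * (‖deriv (gaussMap X b) a‖ ^ 2 / (1 + ‖gaussMap X b a‖ ^ 2) ^ 2) := by
    rw [(InnerProductSpace.laplacian_congr_nhds hev).eq_of_nhds,
      ContDiffAt.laplacian_add (f₁ := _ + _) (h2B.add h2G) contDiffAt_const,
      h2B.laplacian_add h2G,
      InnerProductSpace.laplacian_smul _ hharm.1, InnerProductSpace.laplacian_smul _ hcd,
      laplacian_log_one_add_norm_sq hGan, hharm.2.eq_of_nhds, InnerProductSpace.laplacian_const]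
    simp only [Pi.zero_apply, add_zero, smul_eq_mul]
    ring
  have hpos : metricFactor X a ≠ 0 := by
    rw [hX.metricFactor_eq_gaussMap ha b hB]
    have := norm_ne_zero_iff.mpr hB
    positivity
  rw [gaussCurvature, hlap]
  field_simp
  ring

theorem IsBranchedMinimal.lintegral_gaussMap_ne_top (hX : IsBranchedMinimal P X)
    (hcurv : FiniteTotalCurvature P X) (b : OrthonormalBasis (Fin 3) ℝ E3) {s : Set ℂ}
    (hs : MeasurableSet s)
    (hsP : ∀ z ∈ s, (z : OnePoint ℂ) ∉ P ∧ isotropicComponent X b z ≠ 0) :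
    ∫⁻ z in s, ENNReal.ofReal (‖deriv (gaussMap X b) z‖ ^ 2 / (1 + ‖gaussMap X b z‖ ^ 2) ^ 2) ≠
      ⊤ := by
  have h1 : IntegrableOn (fun z : ℂ => gaussCurvature X z * metricFactor X z) s :=
    hcurv.mono_set fun z hz => (hsP z hz).1
  have h2 : IntegrableOn (fun z : ℂ =>
      ‖deriv (gaussMap X b) z‖ ^ 2 / (1 + ‖gaussMap X b z‖ ^ 2) ^ 2) s := by
    refine IntegrableOn.congr_fun (f := fun z => -4⁻¹ * (gaussCurvature X z * metricFactor X z))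
      (Integrable.const_mul h1 _) (fun z hz => ?_) hs
    simp only
    rw [hX.gaussCurvature_mul_metricFactor (hsP z hz).1 b (hsP z hz).2]
    ring
  exact h2.lintegral_lt_top.ne

/-- At an embedded planar end the complex gradient has a double pole without residue. -/
theorem IsPlanarEndedSurface.gradComponent_expansion (hX : IsPlanarEndedSurface P X)
    {p : OnePoint ℂ} (hp : p ∈ P) :
    ∃ v : E3 →ₗ[ℝ] ℂ, (∀ u, ∃ k : ℂ → ℂ, AnalyticAt ℂ k 0 ∧
      ∀ᶠ ζ in 𝓝[≠] 0, gradComponent (localRep X p) u ζ = v u / ζ ^ 2 + k ζ) ∧ v ≠ 0 := by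
  have hM := hX.minimal
  obtain ⟨⟨r₁, hr₁, hinj, -⟩, hinf, ν, c, hν, hplane⟩ := hX.ends p hp
  obtain ⟨r₂, hr₂, hP⟩ := exists_puncturedBall_of_eventually (eventually_param_notMem P p)
  have hsub : ∀ ζ ∈ Metric.ball (0 : ℂ) (min r₁ r₂) \ {0}, ζ ≠ 0 ∧ param p ζ ∉ P := fun ζ hζ =>
    ⟨hζ.2, hP ζ ⟨Metric.ball_subset_ball (min_le_right _ _) hζ.1, hζ.2⟩⟩
  have hgrad : ∀ ζ ∈ Metric.ball (0 : ℂ) (min r₁ r₂) \ {0}, ∀ u,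
      gradComponent (localRep X p) u ζ =
        gradComponent (planeRep X) u (chartMap p ζ) * chartDeriv p ζ := fun ζ hζ u =>
    hM.gradComponent_localRep p (hsub ζ hζ).1 (hsub ζ hζ).2 u
  have hchart : ∀ ζ ∈ Metric.ball (0 : ℂ) (min r₁ r₂) \ {0},
      (chartMap p ζ : OnePoint ℂ) ∉ P := fun ζ hζ => by
    rw [← param_eq_chartMap p (hsub ζ hζ).1]; exact (hsub ζ hζ).2
  refine gradComponent_expansion_at_end (r := min r₁ r₂) (lt_min hr₁ hr₂)
    (fun u ζ hζ => hM.harmonicAt_inner_localRep p (hsub ζ hζ).1 (hsub ζ hζ).2 u)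
    (fun ζ hζ b => ?_) (fun b δ hδ hδr g hg hgB => ?_)
    (hinj.mono (sdiff_subset_sdiff_left (Metric.ball_subset_ball (min_le_left _ _)))) hinf hν hplane
  · rw [hgrad ζ hζ, hgrad ζ hζ, hgrad ζ hζ]
    linear_combination (chartDeriv p ζ) ^ 2 * hM.sum_sq_gradComponent (hchart ζ hζ) b
  · set s : Set ℂ := Metric.ball (0 : ℂ) δ \ {0} with hs
    have hss : s ⊆ Metric.ball (0 : ℂ) (min r₁ r₂) \ {0} :=
      sdiff_subset_sdiff_left (Metric.ball_subset_ball hδr)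
    have hopen : IsOpen s := isOpen_puncturedBall δ
    have hB : ∀ ζ ∈ s, isotropicComponent X b (chartMap p ζ) ≠ 0 := fun ζ hζ h0 => by
      have := (hgB ζ hζ).1
      rw [hgrad ζ (hss hζ), hgrad ζ (hss hζ)] at this
      apply this
      rw [isotropicComponent] at h0
      linear_combination chartDeriv p ζ * h0
    have hgG : ∀ ζ ∈ s, g ζ = gaussMap X b (chartMap p ζ) := fun ζ hζ => by
      have h1 := (hgB ζ hζ).2
      rw [hgrad ζ (hss hζ), hgrad ζ (hss hζ), hgrad ζ (hss hζ)] at h1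
      rw [gaussMap, eq_div_iff (hB ζ hζ)]
      refine mul_right_cancel₀ (chartDeriv_ne_zero p hζ.2) ?_
      rw [isotropicComponent, ← h1]
      ring
    have hderiv : ∀ ζ ∈ s, deriv g ζ = deriv (gaussMap X b) (chartMap p ζ) * chartDeriv p ζ :=
      fun ζ hζ => by
        have h1 : g =ᶠ[𝓝 ζ] gaussMap X b ∘ chartMap p := by
          filter_upwards [hopen.mem_nhds hζ] with x hx using hgG x hx
        rw [h1.deriv_eq]
        exact ((hM.analyticAt_gaussMap (hchart ζ (hss hζ)) b
          (hB ζ hζ)).differentiableAt.hasDerivAt.comp ζ (hasDerivAt_chartMap p hζ.2)).deriv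
    have hder : ∀ ζ ∈ s, HasFDerivWithinAt (chartMap p)
        ((ContinuousLinearMap.toSpanSingleton ℂ (chartDeriv p ζ)).restrictScalars ℝ) s ζ :=
      fun ζ hζ =>
        ((hasDerivAt_chartMap p hζ.2).hasFDerivAt.restrictScalars ℝ).hasFDerivWithinAt
    -- the spherical area of `g` is invariant under the change of coordinates
    have himage := lintegral_image_eq_lintegral_abs_det_fderiv_mul volume hopen.measurableSet hder
      (chartMap_injective p).injOn fun z =>
        ENNReal.ofReal (‖deriv (gaussMap X b) z‖ ^ 2 / (1 + ‖gaussMap X b z‖ ^ 2) ^ 2)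
    have hmeas : MeasurableSet (chartMap p '' s) :=
      hopen.measurableSet.image_of_continuousOn_injOn
        (fun ζ hζ => (hder ζ hζ).continuousWithinAt) (chartMap_injective p).injOn
    have hfin := hM.lintegral_gaussMap_ne_top hX.finiteCurvature b hmeas (by
      rintro _ ⟨ζ, hζ, rfl⟩
      exact ⟨hchart ζ (hss hζ), hB ζ hζ⟩)
    rw [himage] at hfin
    convert hfin using 1
    refine setLIntegral_congr_fun hopen.measurableSet fun ζ hζ => ?_
    rw [hderiv ζ hζ, hgG ζ hζ, det_mul_restrictScalars, abs_of_nonneg (by positivity),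
      ← ENNReal.ofReal_mul (by positivity), norm_mul]
    congr 1
    ring

end Minimal

end RiemannSphere

/-! ### Square roots of polynomials -/

open Polynomial in
theorem Polynomial.pow_dvd_iff_isBigO {p : ℂ[X]} {z₀ : ℂ} {m : ℕ} :
    (X - C z₀) ^ m ∣ p ↔ (fun ζ => p.eval (z₀ + ζ)) =O[𝓝 0] fun ζ : ℂ => ζ ^ m := by
  constructor
  · rintro ⟨r, rfl⟩
    have h1 : (fun ζ => r.eval (z₀ + ζ)) =O[𝓝 0] fun _ : ℂ => (1 : ℂ) := by
      have hc : ContinuousAt (fun ζ => r.eval (z₀ + ζ)) 0 := by fun_prop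
      exact hc.tendsto.isBigO_one ℂ
    simpa using (isBigO_refl (fun ζ : ℂ => ζ ^ m) (𝓝 0)).mul h1
  · intro h
    by_cases hp : p = 0
    · rw [hp]; exact dvd_zero _
    obtain ⟨r, hr, hnd⟩ := exists_eq_pow_rootMultiplicity_mul_and_not_dvd p hp z₀
    rw [dvd_iff_isRoot, IsRoot] at hnd
    by_contra hcon
    have hlt : p.rootMultiplicity z₀ < m := by
      by_contra hle
      exact hcon ((pow_dvd_pow _ (not_lt.mp hle)).trans (pow_rootMultiplicity_dvd p z₀))
    have h1 : (fun ζ : ℂ => ζ ^ p.rootMultiplicity z₀) =O[𝓝 0] fun ζ => p.eval (z₀ + ζ) := by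
      have h2 : (fun _ : ℂ => (1 : ℂ)) =O[𝓝 0] fun ζ => r.eval (z₀ + ζ) := by
        have hc : ContinuousAt (fun ζ => r.eval (z₀ + ζ)) 0 := by fun_prop
        refine isBigO_const_left_iff_pos_le_norm one_ne_zero |>.mpr ?_
        have h3 : 0 < ‖r.eval (z₀ + 0)‖ := by simpa using hnd
        exact ⟨_, half_pos h3, (hc.norm.eventually (lt_mem_nhds (half_lt_self h3))).mono
          fun ζ hζ => hζ.le⟩
      have h4 := (isBigO_refl (fun ζ : ℂ => ζ ^ p.rootMultiplicity z₀) (𝓝 0)).mul h2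
      have h5 : ∀ ζ, p.eval (z₀ + ζ) = ζ ^ p.rootMultiplicity z₀ * r.eval (z₀ + ζ) := fun ζ => by
        conv_lhs => rw [hr]
        simp
      simpa [h5] using h4
    refine (isLittleO_pow_pow hlt).not_isBigO ?_ (h1.trans h)
    have hne : ∃ᶠ x in 𝓝[≠] (0 : ℂ), x ^ m ≠ 0 :=
      Eventually.frequently (eventually_nhdsWithin_of_forall fun x hx => pow_ne_zero m hx)
    exact hne.filter_mono nhdsWithin_le_nhds

open Polynomial in
theorem Polynomial.isSquare_of_even_rootMultiplicity {g : ℂ[X]}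
    (h : ∀ z, Even (g.rootMultiplicity z)) : ∃ q : ℂ[X], g = q ^ 2 := by
  obtain ⟨c, hc⟩ := IsAlgClosed.exists_pow_nat_eq g.leadingCoeff two_pos
  refine ⟨C c * ∏ z ∈ g.roots.toFinset, (X - C z) ^ (g.rootMultiplicity z / 2), ?_⟩
  have h1 := (IsAlgClosed.splits g).eq_prod_roots
  rw [Finset.prod_multiset_map_count] at h1
  conv_lhs => rw [h1]
  rw [mul_pow, ← C_pow, hc, ← Finset.prod_pow]
  congr 1
  refine Finset.prod_congr rfl fun z _ => ?_
  rw [← pow_mul, Nat.div_mul_cancel (h z).two_dvd, count_roots]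

open Polynomial in
/-- Two polynomials whose product is a square, and whose common vanishing order is even at each
point, are squares. -/
theorem Polynomial.exists_eq_sq_of_mul_eq_sq {a b e : ℂ[X]} (hab : a * b = e ^ 2)
    (hord : ∀ z, ∃ k, ((X - C z) ^ (2 * k) ∣ a ∧ (X - C z) ^ (2 * k) ∣ b) ∧
      ¬((X - C z) ^ (2 * k + 1) ∣ a ∧ (X - C z) ^ (2 * k + 1) ∣ b)) :
    ∃ q₁ q₂ : ℂ[X], a = q₁ ^ 2 ∧ b = q₂ ^ 2 ∧ e = q₁ * q₂ := by
  classical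
  obtain ⟨g, hg⟩ : ∃ g, g = EuclideanDomain.gcd a b := ⟨_, rfl⟩
  have hg0 : g ≠ 0 := fun h => by
    obtain ⟨h1, h2⟩ := EuclideanDomain.gcd_eq_zero_iff.mp (hg ▸ h)
    obtain ⟨k, -, hk⟩ := hord 0
    exact hk ⟨h1 ▸ dvd_zero _, h2 ▸ dvd_zero _⟩
  obtain ⟨s, hs⟩ : ∃ s, g = s ^ 2 := by
    refine isSquare_of_even_rootMultiplicity fun z => ?_
    obtain ⟨k, ⟨h1, h2⟩, h3⟩ := hord z
    have h4 : g.rootMultiplicity z = 2 * k := by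
      refine le_antisymm ?_ ((le_rootMultiplicity_iff hg0).mpr (hg ▸ EuclideanDomain.dvd_gcd h1 h2))
      by_contra hlt
      have h5 := (le_rootMultiplicity_iff hg0).mp 
        (show 2 * k + 1 ≤ g.rootMultiplicity z by omega)
      rw [hg] at h5
      exact h3 ⟨h5.trans (EuclideanDomain.gcd_dvd_left a b),
        h5.trans (EuclideanDomain.gcd_dvd_right a b)⟩
    exact h4 ▸ even_two_mul k
  obtain ⟨a', ha'⟩ := EuclideanDomain.gcd_dvd_left a b
  obtain ⟨b', hb'⟩ := EuclideanDomain.gcd_dvd_right a b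
  rw [← hg] at ha' hb'
  have hcop : IsCoprime a' b' := by
    refine ⟨EuclideanDomain.gcdA a b, EuclideanDomain.gcdB a b, mul_left_cancel₀ hg0 ?_⟩
    have h1 := EuclideanDomain.gcd_eq_gcd_ab a b
    rw [← hg] at h1
    linear_combination -h1 - EuclideanDomain.gcdA a b * ha' - EuclideanDomain.gcdB a b * hb'
  have hge : g ∣ e := by
    rw [← IsIntegrallyClosed.pow_dvd_pow_iff two_ne_zero, ← hab]
    exact ⟨a' * b', by rw [ha', hb']; ring⟩
  obtain ⟨e', he'⟩ := hge
  have hab' : a' * b' = e' ^ 2 := by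
    refine mul_left_cancel₀ (pow_ne_zero 2 hg0) ?_
    linear_combination hab - b * ha' - g * a' * hb' + (e + g * e') * he'
  have hsq : ∀ {x : ℂ[X]}, (∃ d, Associated (d ^ 2) x) → ∃ q, x = q ^ 2 := by
    rintro x ⟨d, u, hu⟩
    obtain ⟨r, hr, hru⟩ := Polynomial.isUnit_iff.mp u.isUnit
    obtain ⟨c, hc⟩ := IsAlgClosed.exists_pow_nat_eq r two_pos
    exact ⟨d * C c, by rw [← hu, ← hru, ← hc, C_pow]; ring⟩
  obtain ⟨q₁, h1⟩ := hsq (exists_associated_pow_of_mul_eq_pow' hcop hab')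
  obtain ⟨q₂, h2⟩ := hsq (exists_associated_pow_of_mul_eq_pow' hcop.symm (mul_comm a' b' ▸ hab'))
  have h3 : e' ^ 2 = (q₁ * q₂) ^ 2 := by rw [← hab', h1, h2]; ring
  rcases sq_eq_sq_iff_eq_or_eq_neg.mp h3 with h4 | h4
  · exact ⟨s * q₁, s * q₂, by rw [ha', hs, h1]; ring, by rw [hb', hs, h2]; ring,
      by rw [he', hs, h4]; ring⟩
  · exact ⟨s * q₁, -(s * q₂), by rw [ha', hs, h1]; ring, by rw [hb', hs, h2]; ring,
      by rw [he', hs, h4]; ring⟩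

/-! ### Sections given by rational functions -/

namespace RiemannSphere

/-- The denominator `∏ (z - p)` over the finite points of `P`. -/
noncomputable def denom (P : Finset (OnePoint ℂ)) : Polynomial ℂ :=
  Lagrange.nodal (finitePoints P) id

theorem eval_denom (P : Finset (OnePoint ℂ)) (z : ℂ) :
    (denom P).eval z = ∏ p ∈ finitePoints P, (z - p) := Lagrange.eval_nodal

theorem eval_denom_ne_zero {P : Finset (OnePoint ℂ)} {z : ℂ} (hz : (z : OnePoint ℂ) ∉ P) :
    (denom P).eval z ≠ 0 := by
  rw [eval_denom, Finset.prod_ne_zero_iff]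
  intro p hp h
  rw [sub_eq_zero] at h
  exact hz (h ▸ mem_finitePoints.mp hp)

open Classical in
theorem card_eq_card_finitePoints (P : Finset (OnePoint ℂ)) :
    P.card = (finitePoints P).card + if ∞ ∈ P then 1 else 0 := by
  have := sum_eq_sum_finitePoints P (fun _ => 1)
  simpa using this

/-- Partial fractions of a rational function with simple poles, by Lagrange interpolation. -/
theorem eval_div_eval_nodal (S : Finset ℂ) {q : Polynomial ℂ} (hq : q.degree < S.card) {z : ℂ}
    (hz : z ∉ S) :
    q.eval z / (Lagrange.nodal S id).eval z =
      ∑ p ∈ S, Lagrange.nodalWeight S id p * q.eval p * (z - p)⁻¹ := by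
  have hzne : ∀ p ∈ S, z ≠ id p := fun p hp h => hz (h ▸ hp)
  have h1 := Lagrange.eval_interpolate_not_at_node (s := S) (v := id)
    (fun p => q.eval p) hzne
  have h2 : q = Lagrange.interpolate S id fun p => q.eval p :=
    Lagrange.eq_interpolate (injOn_id _) hq
  rw [← h2] at h1
  rw [h1, mul_div_cancel_left₀ _ (Lagrange.eval_nodal_not_at_node hzne)]
  refine Finset.sum_congr rfl fun p _ => ?_
  simp only [id]
  ring

/-- A rational function `q / ∏ (z - p)` with `deg q < |P|` is, by its partial fraction expansion, a
section in `F`. -/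
theorem exists_mem_spinorF_eq_div {P : Finset (OnePoint ℂ)} {q : Polynomial ℂ}
    (hq : q.natDegree < P.card) :
    ∃ s ∈ spinorF P, ∀ z : ℂ, (z : OnePoint ℂ) ∉ P → s z = q.eval z / (denom P).eval z := by
  classical
  set S := finitePoints P with hS
  set κ : ℂ := q.coeff S.card with hκ
  have hdeg : (q - Polynomial.C κ * denom P).degree < S.card := by
    rw [Polynomial.degree_lt_iff_coeff_zero]
    intro m hm
    have hdD : (denom P).natDegree = S.card := Lagrange.natDegree_nodal
    rcases hm.eq_or_lt with h | h
    · have hmon : (denom P).coeff S.card = 1 := by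
        rw [← hdD]; exact (Lagrange.nodal_monic : (denom P).Monic)
      rw [Polynomial.coeff_sub, Polynomial.coeff_C_mul, ← h, hmon, mul_one, sub_self]
    · rw [Polynomial.coeff_sub, Polynomial.coeff_C_mul,
        Polynomial.coeff_eq_zero_of_natDegree_lt (p := denom P) (hdD.trans_lt h), mul_zero, sub_zero]
      refine Polynomial.coeff_eq_zero_of_natDegree_lt ?_
      have := card_eq_card_finitePoints P
      rw [← hS] at this
      split_ifs at this <;> omega
  set c : OnePoint ℂ → ℂ := fun x => OnePoint.elim x κ fun p =>
    Lagrange.nodalWeight S id p * (q - Polynomial.C κ * denom P).eval p with hc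
  refine ⟨sectionOfResidues P fun x => c x, sectionOfResidues_mem P _, fun z hz => ?_⟩
  have hzS : z ∉ S := by simpa [hS] using hz
  have hD := eval_denom_ne_zero hz
  have h1 := eval_div_eval_nodal S hdeg hzS
  change _ / (denom P).eval z = _ at h1
  have h2 : ∑ x : P, c x * cauchyKernel z x = ∑ x ∈ P, c x * cauchyKernel z x :=
    Finset.sum_coe_sort P fun x => c x * cauchyKernel z x
  have h3 : (if ∞ ∈ P then c ∞ * cauchyKernel z ∞ else 0) = κ := by
    split_ifs with h
    · simp [hc]
    · symm
      refine Polynomial.coeff_eq_zero_of_natDegree_lt ?_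
      have := card_eq_card_finitePoints P
      rw [if_neg h, ← hS] at this
      omega
  rw [sectionOfResidues_of_notMem _ hz, h2, sum_eq_sum_finitePoints, h3]
  simp only [frameFactor, OnePoint.elim_some, one_mul, cauchyKernel_coe_coe, hc]
  rw [← h1, Polynomial.eval_sub, Polynomial.eval_mul, Polynomial.eval_C]
  field_simp
  ring

/-- Products of spinors transform as differentials: `(√dz)² = dz`. -/
theorem coeff_mul_coeff {s t : OnePoint ℂ → ℂ} (p : OnePoint ℂ) {ζ : ℂ} (h : ζ ≠ 0) :
    coeff s p ζ * coeff t p ζ =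
      s (chartMap p ζ : OnePoint ℂ) * t (chartMap p ζ : OnePoint ℂ) * chartDeriv p ζ := by
  induction p using OnePoint.rec with
  | infty =>
    rw [coeff_infty _ h, coeff_infty _ h]
    simp only [chartMap, chartDeriv, OnePoint.elim_infty]
    field_simp
    rw [Complex.I_sq]
    ring
  | coe a => simp [chartMap, chartDeriv]

/-- If a product of two sections with simple poles has no residue, then the mixed products of the
residues and the constant terms cancel. -/
theorem residue_mul_eq_of_double_pole {c₁ c₂ α : ℂ} {h₁ h₂ k : ℂ → ℂ} (hh₁ : AnalyticAt ℂ h₁ 0)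
    (hh₂ : AnalyticAt ℂ h₂ 0) (hk : AnalyticAt ℂ k 0)
    (he : ∀ᶠ ζ in 𝓝[≠] (0 : ℂ), (c₁ / ζ + h₁ ζ) * (c₂ / ζ + h₂ ζ) = α / ζ ^ 2 + k ζ) :
    c₁ * c₂ = α ∧ c₁ * h₂ 0 + c₂ * h₁ 0 = 0 := by
  have c1 := hh₁.continuousAt
  have c2 := hh₂.continuousAt
  have c3 := hk.continuousAt
  have hα : c₁ * c₂ = α := by
    have t1 : Tendsto (fun ζ => (c₁ + ζ * h₁ ζ) * (c₂ + ζ * h₂ ζ)) (𝓝[≠] 0) (𝓝 (c₁ * c₂)) := by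
      have : ContinuousAt (fun ζ => (c₁ + ζ * h₁ ζ) * (c₂ + ζ * h₂ ζ)) 0 := by fun_prop
      simpa using this.tendsto.mono_left nhdsWithin_le_nhds
    have t2 : Tendsto (fun ζ => α + ζ ^ 2 * k ζ) (𝓝[≠] 0) (𝓝 α) := by
      have : ContinuousAt (fun ζ => α + ζ ^ 2 * k ζ) 0 := by fun_prop
      simpa using this.tendsto.mono_left nhdsWithin_le_nhds
    refine tendsto_nhds_unique_of_eventuallyEq t1 t2 ?_
    filter_upwards [he, self_mem_nhdsWithin] with ζ hζ h0
    have h0 : ζ ≠ 0 := h0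
    field_simp at hζ
    linear_combination hζ
  refine ⟨hα, ?_⟩
  have t1 : Tendsto (fun ζ => c₁ * h₂ ζ + c₂ * h₁ ζ + ζ * (h₁ ζ * h₂ ζ)) (𝓝[≠] 0)
      (𝓝 (c₁ * h₂ 0 + c₂ * h₁ 0)) := by
    have : ContinuousAt (fun ζ => c₁ * h₂ ζ + c₂ * h₁ ζ + ζ * (h₁ ζ * h₂ ζ)) 0 := by fun_prop
    simpa using this.tendsto.mono_left nhdsWithin_le_nhds
  have t2 : Tendsto (fun ζ => ζ * k ζ) (𝓝[≠] 0) (𝓝 0) := by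
    have : ContinuousAt (fun ζ => ζ * k ζ) 0 := by fun_prop
    simpa using this.tendsto.mono_left nhdsWithin_le_nhds
  refine tendsto_nhds_unique_of_eventuallyEq t1 t2 ?_
  filter_upwards [he, self_mem_nhdsWithin] with ζ hζ h0
  have h0 : ζ ≠ 0 := h0
  refine mul_left_cancel₀ h0 ?_
  field_simp at hζ
  linear_combination hζ - hα

/-- If the squares and the product of two sections in `F` have no residues, and at each point of `P`
one of the squares has a pole, then both sections lie in `K`. -/
theorem mem_spinorK_of_double_poles {P : Finset (OnePoint ℂ)} {s t : OnePoint ℂ → ℂ}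
    (hs : s ∈ spinorF P) (ht : t ∈ spinorF P)
    (h : ∀ p ∈ P, ∃ (α β γ : ℂ) (k₁ k₂ k₃ : ℂ → ℂ), AnalyticAt ℂ k₁ 0 ∧ AnalyticAt ℂ k₂ 0 ∧
      AnalyticAt ℂ k₃ 0 ∧ ¬(α = 0 ∧ β = 0) ∧ ∀ᶠ ζ in 𝓝[≠] (0 : ℂ),
        coeff s p ζ * coeff s p ζ = α / ζ ^ 2 + k₁ ζ ∧
        coeff t p ζ * coeff t p ζ = β / ζ ^ 2 + k₂ ζ ∧
        coeff s p ζ * coeff t p ζ = γ / ζ ^ 2 + k₃ ζ) :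
    s ∈ spinorK P ∧ t ∈ spinorK P := by
  have hmul : ∀ {x y : ℂ}, x ≠ 0 → x * y = 0 → y = 0 := fun hx h =>
    (mul_eq_zero.mp h).resolve_left hx
  have key : ∀ p ∈ P, ∃ (c d : ℂ) (f g : ℂ → ℂ), AnalyticAt ℂ f 0 ∧ AnalyticAt ℂ g 0 ∧
      f 0 = 0 ∧ g 0 = 0 ∧ (∀ᶠ ζ in 𝓝[≠] (0 : ℂ), coeff s p ζ = c / ζ + f ζ) ∧
      ∀ᶠ ζ in 𝓝[≠] (0 : ℂ), coeff t p ζ = d / ζ + g ζ := by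
    intro p hp
    obtain ⟨-, c, f, hf, hcf⟩ := hs.2 p hp
    obtain ⟨-, d, g, hg, hdg⟩ := ht.2 p hp
    obtain ⟨α, β, γ, k₁, k₂, k₃, hk₁, hk₂, hk₃, hne, he⟩ := h p hp
    obtain ⟨e1, e2⟩ := residue_mul_eq_of_double_pole (c₁ := c) (c₂ := c) (α := α) hf hf hk₁ (by
      filter_upwards [he, hcf] with ζ h1 h2
      rw [← h2]; exact h1.1)
    obtain ⟨e3, e4⟩ := residue_mul_eq_of_double_pole (c₁ := d) (c₂ := d) (α := β) hg hg hk₂ (by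
      filter_upwards [he, hdg] with ζ h1 h2
      rw [← h2]; exact h1.2.1)
    obtain ⟨-, e6⟩ := residue_mul_eq_of_double_pole (c₁ := c) (c₂ := d) (α := γ) hf hg hk₃ (by
      filter_upwards [he, hcf, hdg] with ζ h1 h2 h3
      rw [← h2, ← h3]; exact h1.2.2)
    refine ⟨c, d, f, g, hf, hg, ?_, ?_, hcf, hdg⟩
    all_goals
      by_cases hc : c = 0
      · have hd : d ≠ 0 := fun hd => hne ⟨by rw [← e1, hc, mul_zero], by rw [← e3, hd, mul_zero]⟩
        have hg0 : g 0 = 0 := hmul hd (by linear_combination e4 / 2)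
        first
        | exact hg0
        | exact hmul hd (by linear_combination e6 - c * hg0)
      · have hf0 : f 0 = 0 := hmul hc (by linear_combination e2 / 2)
        first
        | exact hf0
        | exact hmul hc (by linear_combination e6 - d * hf0)
  refine ⟨⟨hs, fun p hp => ?_⟩, ⟨ht, fun p hp => ?_⟩⟩
  · obtain ⟨c, d, f, g, hf, hg, hf0, hg0, h1, h2⟩ := key p hp
    exact ⟨c, f, hf, hf0, h1⟩
  · obtain ⟨c, d, f, g, hf, hg, hf0, hg0, h1, h2⟩ := key p hp
    exact ⟨d, g, hg, hg0, h2⟩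

end RiemannSphere

/-! ### Global Weierstrass data -/

namespace RiemannSphere

section Minimal

variable {P : Finset (OnePoint ℂ)} {X : OnePoint ℂ → E3}

theorem IsBranchedMinimal.liesInPlane_of_gradComponent_eq_zero (hX : IsBranchedMinimal P X)
    {ν : E3} (hν : ν ≠ 0)
    (h : ∀ z : ℂ, (z : OnePoint ℂ) ∉ P → gradComponent (planeRep X) ν z = 0) :
    LiesInPlane P X := by
  set f : ℂ → ℝ := fun z => inner ℝ ν (planeRep X z) with hf
  have hS : ∀ z, z ∈ ((finitePoints P : Set ℂ))ᶜ ↔ (z : OnePoint ℂ) ∉ P := fun z => by simp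
  have hopen : IsOpen ((finitePoints P : Set ℂ))ᶜ :=
    (finitePoints P).finite_toSet.isClosed.isOpen_compl
  have hconn : IsConnected ((finitePoints P : Set ℂ))ᶜ :=
    (finitePoints P).countable_toSet.isConnected_compl_of_one_lt_rank (by
      rw [Complex.rank_real_complex]; exact Cardinal.one_lt_two)
  have hd : ∀ z : ℂ, (z : OnePoint ℂ) ∉ P → DifferentiableAt ℝ f z := fun z hz =>
    (hX.harmonicAt_inner hz ν).1.differentiableAt two_ne_zero
  obtain ⟨c, hc⟩ := hopen.exists_is_const_of_fderiv_eq_zero hconn.isPreconnected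
    (fun z hz => (hd z ((hS z).mp hz)).differentiableWithinAt) (fun z hz => by
      refine ContinuousLinearMap.ext fun v => ?_
      have h1 : complexGradient f z = 0 := h z ((hS z).mp hz)
      rw [← re_complexGradient_mul f z v, h1]
      simp)
  refine ⟨ν, c, hν, fun p hp => ?_⟩
  induction p using OnePoint.rec with
  | coe a => exact hc a ((hS a).mpr hp)
  | infty =>
    have h1 : ContinuousAt (localRep X ∞) 0 := (hX.harmonic ∞ hp).1.continuousAt
    have h2 : Tendsto (fun ζ => inner ℝ ν (localRep X ∞ ζ)) (𝓝[≠] 0)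
        (𝓝 (inner ℝ ν (localRep X ∞ 0))) :=
      ((innerSL ℝ ν).continuous.continuousAt.comp h1).tendsto.mono_left nhdsWithin_le_nhds
    have h3 : Tendsto (fun ζ => inner ℝ ν (localRep X ∞ ζ)) (𝓝[≠] 0) (𝓝 c) := by
      refine tendsto_const_nhds.congr' ?_
      filter_upwards [eventually_param_notMem P ∞, self_mem_nhdsWithin] with ζ hζ h0
      rw [param_infty h0] at hζ
      rw [localRep, param_infty h0]
      exact (hc ζ⁻¹ ((hS _).mpr hζ)).symm
    have h4 := tendsto_nhds_unique h2 h3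
    rwa [localRep, param_zero] at h4

/-- The principal parts of the complex gradient at the ends: `v p u` is the coefficient of `ζ⁻²` in
the derivative of the component of `X` in the direction `u`. -/
def HasDoublePoles (P : Finset (OnePoint ℂ)) (X : OnePoint ℂ → E3)
    (v : OnePoint ℂ → E3 →ₗ[ℝ] ℂ) : Prop :=
  ∀ p ∈ P, v p ≠ 0 ∧ ∀ u, ∃ k : ℂ → ℂ, AnalyticAt ℂ k 0 ∧
    ∀ᶠ ζ in 𝓝[≠] 0, gradComponent (localRep X p) u ζ = v p u / ζ ^ 2 + k ζ

theorem IsPlanarEndedSurface.exists_hasDoublePoles (hX : IsPlanarEndedSurface P X) :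
    ∃ v, HasDoublePoles P X v := by
  classical
  have h := fun p (hp : p ∈ P) => hX.gradComponent_expansion hp
  choose v hv1 hv2 using h
  refine ⟨fun p => if hp : p ∈ P then v p hp else 0, fun p hp => ?_⟩
  simp only [dif_pos hp]
  exact ⟨hv2 p hp, hv1 p hp⟩

variable {v : OnePoint ℂ → E3 →ₗ[ℝ] ℂ}

theorem HasDoublePoles.tendsto (hv : HasDoublePoles P X v) {p : OnePoint ℂ} (hp : p ∈ P) (u : E3) :
    Tendsto (fun ζ => ζ ^ 2 * gradComponent (localRep X p) u ζ) (𝓝[≠] 0) (𝓝 (v p u)) := by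
  obtain ⟨k, hk, he⟩ := (hv p hp).2 u
  have hc := hk.continuousAt
  have h1 : Tendsto (fun ζ => v p u + ζ ^ 2 * k ζ) (𝓝[≠] 0) (𝓝 (v p u)) := by
    have : ContinuousAt (fun ζ => v p u + ζ ^ 2 * k ζ) 0 := by fun_prop
    simpa using this.tendsto.mono_left nhdsWithin_le_nhds
  refine h1.congr' ?_
  filter_upwards [he, self_mem_nhdsWithin] with ζ hζ h0
  have h0 : ζ ≠ 0 := h0
  rw [hζ]
  field_simp

/-- The principal part of an isotropic gradient is isotropic. -/
theorem HasDoublePoles.sum_sq (hv : HasDoublePoles P X v) (hX : IsBranchedMinimal P X)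
    {p : OnePoint ℂ} (hp : p ∈ P) (b : OrthonormalBasis (Fin 3) ℝ E3) :
    v p (b 0) ^ 2 + v p (b 1) ^ 2 + v p (b 2) ^ 2 = 0 := by
  have h1 := (((hv.tendsto hp (b 0)).pow 2).add ((hv.tendsto hp (b 1)).pow 2)).add
    ((hv.tendsto hp (b 2)).pow 2)
  refine tendsto_nhds_unique h1 (tendsto_const_nhds.congr' ?_)
  filter_upwards [eventually_param_notMem P p, self_mem_nhdsWithin] with ζ hζ h0
  have h0 : ζ ≠ 0 := h0
  have h2 := hζ
  rw [param_eq_chartMap p h0] at h2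
  simp only [hX.gradComponent_localRep p h0 hζ]
  linear_combination -ζ ^ 4 * chartDeriv p ζ ^ 2 * hX.sum_sq_gradComponent h2 b

/-- The residue vector at an end is isotropic and nonzero, so its first two components do not both
vanish. -/
theorem HasDoublePoles.not_and (hv : HasDoublePoles P X v) (hX : IsBranchedMinimal P X)
    {p : OnePoint ℂ} (hp : p ∈ P) (b : OrthonormalBasis (Fin 3) ℝ E3) :
    ¬(v p (b 0) + Complex.I * v p (b 1) = 0 ∧ v p (b 0) - Complex.I * v p (b 1) = 0) := by
  rintro ⟨h1, h2⟩
  have h3 : v p (b 0) = 0 := by linear_combination h1 / 2 + h2 / 2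
  have h4 : v p (b 1) = 0 := by
    linear_combination -Complex.I * h1 / 2 + Complex.I * h2 / 2 + v p (b 1) * Complex.I_sq
  have h5 : v p (b 2) = 0 := by
    have := hv.sum_sq hX hp b
    rw [h3, h4] at this
    simpa using this
  refine (hv p hp).1 (b.toBasis.ext fun i => ?_)
  fin_cases i
  · simpa using h3
  · simpa using h4
  · simpa using h5

/-- The gradient with respect to `z` has a limit at `∞`, because `dz = - w⁻² dw` turns a double pole
at `w = 0` into a finite value; the limit vanishes if the surface extends over `∞`. -/
theorem HasDoublePoles.exists_tendsto_cobounded (hv : HasDoublePoles P X v) (hX : IsBranchedMinimal P X)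
    (u : E3) : ∃ κ, Tendsto (gradComponent (planeRep X) u) (Bornology.cobounded ℂ) (𝓝 κ) ∧
      (∞ ∉ P → κ = 0) := by
  have hloc : ∀ᶠ w in 𝓝[≠] (0 : ℂ), gradComponent (planeRep X) u w⁻¹ =
      -(w ^ 2 * gradComponent (localRep X ∞) u w) := by
    filter_upwards [eventually_param_notMem P ∞, self_mem_nhdsWithin] with w hw h0
    have h0 : w ≠ 0 := h0
    rw [hX.gradComponent_localRep ∞ h0 hw]
    simp only [chartMap, chartDeriv, OnePoint.elim_infty]
    field_simp
  by_cases hinf : ∞ ∈ P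
  · exact ⟨-v ∞ u, tendsto_cobounded_of_tendsto_inv
      ((hv.tendsto hinf u).neg.congr' (hloc.mono fun w h => h.symm)), fun h => absurd hinf h⟩
  · refine ⟨0, tendsto_cobounded_of_tendsto_inv ?_, fun _ => rfl⟩
    have h1 := ((hX.harmonic ∞ hinf).comp_CLM (innerSL ℝ u))
    have h2 : ContinuousAt (gradComponent (localRep X ∞) u) 0 :=
      (HarmonicAt.differentiableAt_complex_partial h1).continuousAt
    have h3 : Tendsto (fun w => -(w ^ 2 * gradComponent (localRep X ∞) u w)) (𝓝[≠] 0) (𝓝 0) := by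
      have : ContinuousAt (fun w => -(w ^ 2 * gradComponent (localRep X ∞) u w)) 0 := by fun_prop
      simpa using this.tendsto.mono_left nhdsWithin_le_nhds
    exact h3.congr' (hloc.mono fun w h => h.symm)

/-- The complex gradient is a rational function with denominator `∏ (z - p) ^ 2`. -/
theorem HasDoublePoles.exists_numerator (hv : HasDoublePoles P X v) (hX : IsBranchedMinimal P X)
    (hP : 2 ≤ P.card) (u : E3) :
    ∃ N : Polynomial ℂ, N.natDegree ≤ 2 * (P.card - 1) ∧
      (∀ z : ℂ, (z : OnePoint ℂ) ∉ P →
        N.eval z = gradComponent (planeRep X) u z * (denom P).eval z ^ 2) ∧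
      ∀ p ∈ finitePoints P, N.eval p = v p u * ∏ q ∈ (finitePoints P).erase p, (p - q) ^ 2 := by
  classical
  set S := finitePoints P with hS
  obtain ⟨κ', hκ', hκ0⟩ := hv.exists_tendsto_cobounded hX u
  obtain ⟨κ, hκ⟩ := exists_eq_const_add_sum_principal_parts S (gradComponent (planeRep X) u)
    (fun p => v p u) 2 two_ne_zero
    (fun z hz => hX.analyticAt_gradComponent (by simpa [hS] using hz) u)
    (fun p hp => by
      have hpP : (p : OnePoint ℂ) ∈ P := mem_finitePoints.mp hp
      obtain ⟨k, hk, he⟩ := (hv p hpP).2 u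
      refine ⟨k, hk, ?_⟩
      filter_upwards [he, eventually_param_notMem P p, self_mem_nhdsWithin] with ζ h1 h2 h0
      rw [← h1, hX.gradComponent_localRep p h0 h2]
      simp [chartMap, chartDeriv])
    (hκ'.isBigO_one ℝ)
  -- the constant term of the partial fraction expansion is the limit at `∞`
  have hκκ : κ' = κ := by
    have h1 : Tendsto (fun z => κ + ∑ p ∈ S, v p u / (z - p) ^ 2) (Bornology.cobounded ℂ)
        (𝓝 (κ + ∑ p ∈ S, 0)) := by
      refine tendsto_const_nhds.add (tendsto_finsetSum _ fun p _ => ?_)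
      have h2 : Tendsto (fun z : ℂ => z - p) (Bornology.cobounded ℂ) (Bornology.cobounded ℂ) := by
        simp [sub_eq_add_neg, tendsto_add_const_cobounded (-p)]
      have h3 := ((tendsto_inv₀_cobounded.comp h2).pow 2).const_mul (v p u)
      simpa [Function.comp_def, div_eq_mul_inv] using h3
    rw [Finset.sum_const_zero, add_zero] at h1
    refine tendsto_nhds_unique hκ' (h1.congr' ?_)
    have hfin : ∀ᶠ z in Bornology.cobounded ℂ, z ∉ S := S.finite_toSet.isBounded
    filter_upwards [hfin] with z hz using (hκ z hz).symm
  have hcard := card_eq_card_finitePoints P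
  rw [← hS] at hcard
  have hdD : (denom P).natDegree = S.card := Lagrange.natDegree_nodal
  refine ⟨Polynomial.C κ * denom P ^ 2 +
    ∑ p ∈ S, Polynomial.C (v p u) * Lagrange.nodal (S.erase p) id ^ 2, ?_, fun z hz => ?_,
    fun p hp => ?_⟩
  · refine Polynomial.natDegree_add_le_of_degree_le ?_ (Polynomial.natDegree_sum_le_of_forall_le _ _
      fun p hp => ?_)
    · by_cases hinf : ∞ ∈ P
      · rw [if_pos hinf] at hcard
        refine (Polynomial.natDegree_C_mul_le _ _).trans (Polynomial.natDegree_pow_le.trans ?_)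
        rw [hdD]; omega
      · rw [← hκκ, hκ0 hinf]; simp
    · refine (Polynomial.natDegree_C_mul_le _ _).trans (Polynomial.natDegree_pow_le.trans ?_)
      rw [Lagrange.natDegree_nodal, Finset.card_erase_of_mem hp]
      split_ifs at hcard <;> omega
  · have hzS : z ∉ S := by simpa [hS] using hz
    rw [hκ z hzS, add_mul, Finset.sum_mul, Polynomial.eval_add, Polynomial.eval_finsetSum]
    congr 1
    · simp
    · refine Finset.sum_congr rfl fun p hp => ?_
      have hzp : z - p ≠ 0 := sub_ne_zero.mpr fun h => hzS (h ▸ hp)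
      have h1 : (denom P).eval z = (z - p) * (Lagrange.nodal (S.erase p) id).eval z := by
        rw [eval_denom, Lagrange.eval_nodal]
        exact (Finset.mul_prod_erase S (fun q => z - q) hp).symm
      rw [h1, Polynomial.eval_mul, Polynomial.eval_C, Polynomial.eval_pow]
      field_simp
  · have h1 : (denom P).eval p = 0 := Lagrange.eval_nodal_at_node (v := id) hp
    rw [Polynomial.eval_add, Polynomial.eval_finsetSum, Finset.sum_eq_single p]
    · simp [h1, Lagrange.eval_nodal, Finset.prod_pow]
    · intro q hq hqp
      have h2 : (Lagrange.nodal (S.erase q) id).eval p = 0 :=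
        Lagrange.eval_nodal_at_node (v := id) (Finset.mem_erase.mpr ⟨hqp.symm, hp⟩)
      simp [h2]
    · exact fun h => absurd hp h

end Minimal

end RiemannSphere

/-! ### Spinors of a surface with planar ends -/

namespace RiemannSphere

section Minimal

variable {P : Finset (OnePoint ℂ)} {X : OnePoint ℂ → E3}

theorem IsBranchedMinimal.norm_add_norm (hX : IsBranchedMinimal P X) {a : ℂ}
    (ha : (a : OnePoint ℂ) ∉ P) (b : OrthonormalBasis (Fin 3) ℝ E3) :
    ‖gradComponent (planeRep X) (b 0) a + Complex.I * gradComponent (planeRep X) (b 1) a‖ +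
      ‖gradComponent (planeRep X) (b 0) a - Complex.I * gradComponent (planeRep X) (b 1) a‖ =
      2 * ‖fderiv ℝ (planeRep X) a 1‖ := by
  have h1 := hX.metricFactor_eq ha b
  change ‖fderiv ℝ (planeRep X) a 1‖ ^ 2 = _ at h1
  refine (sq_eq_sq₀ (by positivity) (by positivity)).mp ?_
  linarith

theorem IsBranchedMinimal.norm_fderiv_le (hX : IsBranchedMinimal P X) {a : ℂ}
    (ha : (a : OnePoint ℂ) ∉ P) :
    ‖fderiv ℝ (planeRep X) a‖ ≤ 2 * ‖fderiv ℝ (planeRep X) a 1‖ := by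
  refine ContinuousLinearMap.opNorm_le_bound _ (by positivity) fun w => ?_
  have hw : w = w.re • (1 : ℂ) + w.im • Complex.I := by
    simp [Complex.real_smul, Complex.re_add_im]
  have h1 : ‖fderiv ℝ (planeRep X) a w‖ ≤
      |w.re| * ‖fderiv ℝ (planeRep X) a 1‖ + |w.im| * ‖fderiv ℝ (planeRep X) a 1‖ := by
    conv_lhs => rw [hw, map_add, map_smul, map_smul]
    refine (norm_add_le _ _).trans ?_
    rw [norm_smul, norm_smul, ← hX.norm_fderiv_planeRep ha]
    exact le_rfl
  nlinarith [Complex.abs_re_le_norm w, Complex.abs_im_le_norm w,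
    norm_nonneg (fderiv ℝ (planeRep X) a 1)]

theorem norm_fderiv_le_sum_gradComponent {Y : ℂ → E3} {ζ : ℂ} (hY : DifferentiableAt ℝ Y ζ)
    (b : OrthonormalBasis (Fin 3) ℝ E3) :
    ‖fderiv ℝ Y ζ‖ ≤ ∑ i, ‖gradComponent Y (b i) ζ‖ := by
  refine ContinuousLinearMap.opNorm_le_bound _ (by positivity) fun w => ?_
  have h1 : ∀ i, ‖inner ℝ (b i) (fderiv ℝ Y ζ w)‖ ≤ ‖gradComponent Y (b i) ζ‖ * ‖w‖ := fun i => by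
    have h2 : fderiv ℝ (fun ζ => inner ℝ (b i) (Y ζ)) ζ = (innerSL ℝ (b i)).comp (fderiv ℝ Y ζ) :=
      ((innerSL ℝ (b i)).hasFDerivAt.comp ζ hY.hasFDerivAt).fderiv
    have h3 := re_complexGradient_mul (fun ζ => inner ℝ (b i) (Y ζ)) ζ w
    rw [h2] at h3
    simp only [ContinuousLinearMap.comp_apply, innerSL_apply_apply] at h3
    rw [← h3, Real.norm_eq_abs, ← norm_mul]
    exact Complex.abs_re_le_norm _
  rw [← b.sum_repr' (fderiv ℝ Y ζ w), Finset.sum_mul]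
  refine (norm_sum_le _ _).trans (Finset.sum_le_sum fun i _ => ?_)
  rw [norm_smul, b.norm_eq_one, mul_one]
  exact h1 i

open Polynomial in
/-- The branch order at a point is the common vanishing order of the numerators of the isotropic
components of the complex gradient. -/
theorem IsBranchedMinimal.pow_dvd_of_hasBranchOrder (hX : IsBranchedMinimal P X) {z : ℂ}
    (hz : (z : OnePoint ℂ) ∉ P) {m : ℕ} (hm : HasBranchOrder X z m)
    (b : OrthonormalBasis (Fin 3) ℝ E3) {p q : ℂ[X]}
    (hp : ∀ z : ℂ, (z : OnePoint ℂ) ∉ P → p.eval z = (gradComponent (planeRep X) (b 0) z +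
      Complex.I * gradComponent (planeRep X) (b 1) z) * (denom P).eval z ^ 2)
    (hq : ∀ z : ℂ, (z : OnePoint ℂ) ∉ P → q.eval z = -(gradComponent (planeRep X) (b 0) z -
      Complex.I * gradComponent (planeRep X) (b 1) z) * (denom P).eval z ^ 2) :
    ((Polynomial.X - C z) ^ m ∣ p ∧ (Polynomial.X - C z) ^ m ∣ q) ∧
      ¬((Polynomial.X - C z) ^ (m + 1) ∣ p ∧ (Polynomial.X - C z) ^ (m + 1) ∣ q) := by
  have hT : Tendsto (fun ζ : ℂ => z + ζ) (𝓝 0) (𝓝 z) := by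
    have : ContinuousAt (fun ζ : ℂ => z + ζ) 0 := by fun_prop
    simpa using this.tendsto
  have hev : ∀ᶠ ζ in 𝓝 (0 : ℂ), ((z + ζ : ℂ) : OnePoint ℂ) ∉ P :=
    hT.eventually (eventually_coe_notMem P hz)
  have hD0 := eval_denom_ne_zero hz
  have hm' : (fun ζ => fderiv ℝ (planeRep X) (z + ζ)) =Θ[𝓝 0] fun ζ : ℂ => ζ ^ m := by
    simpa only [HasBranchOrder, fderiv_localRep_coe] using hm
  have hDc : ContinuousAt (fun ζ => (denom P).eval (z + ζ) ^ 2) 0 := by fun_prop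
  have hDO : (fun ζ => (denom P).eval (z + ζ) ^ 2) =O[𝓝 0] fun _ : ℂ => (1 : ℂ) :=
    hDc.tendsto.isBigO_one ℂ
  have hDO' : (fun _ : ℂ => (1 : ℂ)) =O[𝓝 0] fun ζ => (denom P).eval (z + ζ) ^ 2 := by
    refine isBigO_const_left_iff_pos_le_norm one_ne_zero |>.mpr ?_
    have h3 : 0 < ‖(denom P).eval (z + 0) ^ 2‖ := by
      rw [add_zero]; exact norm_pos_iff.mpr (pow_ne_zero 2 hD0)
    exact ⟨_, half_pos h3, (hDc.norm.eventually (lt_mem_nhds (half_lt_self h3))).mono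
      fun ζ hζ => hζ.le⟩
  -- both sides are now growth conditions on `|p| + |q|`, which is comparable to `|dX|`
  simp only [pow_dvd_iff_isBigO]
  have hle : ∀ᶠ ζ in 𝓝 (0 : ℂ),
      ‖p.eval (z + ζ)‖ + ‖q.eval (z + ζ)‖ =
        2 * ‖fderiv ℝ (planeRep X) (z + ζ) 1‖ * ‖(denom P).eval (z + ζ) ^ 2‖ := by
    filter_upwards [hev] with ζ hζ
    rw [hp _ hζ, hq _ hζ, norm_mul, norm_mul, norm_neg, ← add_mul, hX.norm_add_norm hζ b]
  have hone : ∀ w : ℂ, ‖fderiv ℝ (planeRep X) w 1‖ ≤ ‖fderiv ℝ (planeRep X) w‖ := fun w => by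
    simpa using (fderiv ℝ (planeRep X) w).le_opNorm 1
  have hup : (fun ζ => ‖fderiv ℝ (planeRep X) (z + ζ)‖ * ‖(denom P).eval (z + ζ) ^ 2‖) =O[𝓝 0]
      fun ζ : ℂ => ζ ^ m := by
    simpa using hm'.1.norm_left.mul hDO.norm_left
  refine ⟨⟨IsBigO.trans (IsBigO.of_bound 2 ?_) hup, IsBigO.trans (IsBigO.of_bound 2 ?_) hup⟩, ?_⟩
  · filter_upwards [hle] with ζ hζ
    rw [Real.norm_of_nonneg (by positivity)]
    nlinarith [norm_nonneg (q.eval (z + ζ)), hone (z + ζ), norm_nonneg ((denom P).eval (z + ζ) ^ 2)]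
  · filter_upwards [hle] with ζ hζ
    rw [Real.norm_of_nonneg (by positivity)]
    nlinarith [norm_nonneg (p.eval (z + ζ)), hone (z + ζ), norm_nonneg ((denom P).eval (z + ζ) ^ 2)]
  · rintro ⟨h1, h2⟩
    have h3 : (fun ζ => fderiv ℝ (planeRep X) (z + ζ)) =O[𝓝 0]
        fun ζ => ‖p.eval (z + ζ)‖ + ‖q.eval (z + ζ)‖ := by
      have h4 : (fun ζ => ‖fderiv ℝ (planeRep X) (z + ζ)‖ * ‖(1 : ℂ)‖) =O[𝓝 0]
          fun ζ => ‖fderiv ℝ (planeRep X) (z + ζ)‖ * ‖(denom P).eval (z + ζ) ^ 2‖ :=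
        (isBigO_refl _ _).mul hDO'.norm_norm
      simp only [norm_one, mul_one] at h4
      refine (isBigO_norm_left.mp h4).trans (IsBigO.of_bound 1 ?_)
      filter_upwards [hle, hev] with ζ hζ hζP
      rw [hζ, Real.norm_of_nonneg (by positivity), Real.norm_of_nonneg (by positivity), one_mul]
      exact mul_le_mul_of_nonneg_right (hX.norm_fderiv_le hζP) (norm_nonneg _)
    have h5 := (hm'.2.trans h3).trans (h1.norm_left.add h2.norm_left)
    refine (isLittleO_pow_pow (𝕜 := ℂ) (Nat.lt_succ_self m)).not_isBigO ?_ h5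
    have hne : ∃ᶠ x in 𝓝[≠] (0 : ℂ), x ^ (m + 1) ≠ 0 :=
      Eventually.frequently (eventually_nhdsWithin_of_forall fun x hx => pow_ne_zero _ hx)
    exact hne.filter_mono nhdsWithin_le_nhds

theorem eq_of_eval_eq {P : Finset (OnePoint ℂ)} {p q : Polynomial ℂ}
    (h : ∀ z : ℂ, (z : OnePoint ℂ) ∉ P → p.eval z = q.eval z) : p = q := by
  refine Polynomial.eq_of_infinite_eval_eq p q (Set.Infinite.mono ?_
    (finitePoints P).finite_toSet.infinite_compl)
  intro z hz
  exact h z (by simpa using hz)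

variable {v : OnePoint ℂ → E3 →ₗ[ℝ] ℂ}

/-- The spinor representation: if all branch points have even order, then the isotropic components
of the complex gradient are squares of rational functions. -/
theorem HasDoublePoles.exists_spinors (hv : HasDoublePoles P X v) (hX : IsBranchedMinimal P X)
    (hP : 2 ≤ P.card) (hev : EvenBranching P X) (b : OrthonormalBasis (Fin 3) ℝ E3) :
    ∃ q₁ q₂ : Polynomial ℂ, q₁.natDegree < P.card ∧ q₂.natDegree < P.card ∧
      (∀ z : ℂ, (z : OnePoint ℂ) ∉ P →
        gradComponent (planeRep X) (b 0) z + Complex.I * gradComponent (planeRep X) (b 1) z =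
          q₁.eval z ^ 2 / (denom P).eval z ^ 2 ∧
        gradComponent (planeRep X) (b 0) z - Complex.I * gradComponent (planeRep X) (b 1) z =
          -(q₂.eval z ^ 2 / (denom P).eval z ^ 2) ∧
        gradComponent (planeRep X) (b 2) z =
          q₁.eval z * q₂.eval z / (denom P).eval z ^ 2) ∧
      (Unbranched P X → ∀ z, ¬(q₁.eval z = 0 ∧ q₂.eval z = 0)) := by
  choose N hNdeg hN hNp using hv.exists_numerator hX hP
  set p₁ : Polynomial ℂ := N (b 0) + Polynomial.C Complex.I * N (b 1) with hp₁
  set p₂ : Polynomial ℂ := -(N (b 0) - Polynomial.C Complex.I * N (b 1)) with hp₂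
  have e₁ : ∀ z : ℂ, (z : OnePoint ℂ) ∉ P → p₁.eval z = (gradComponent (planeRep X) (b 0) z +
      Complex.I * gradComponent (planeRep X) (b 1) z) * (denom P).eval z ^ 2 := fun z hz => by
    simp only [hp₁, Polynomial.eval_add, Polynomial.eval_mul, Polynomial.eval_C, hN _ z hz]
    ring
  have e₂ : ∀ z : ℂ, (z : OnePoint ℂ) ∉ P → p₂.eval z = -(gradComponent (planeRep X) (b 0) z -
      Complex.I * gradComponent (planeRep X) (b 1) z) * (denom P).eval z ^ 2 := fun z hz => by
    simp only [hp₂, Polynomial.eval_neg, Polynomial.eval_sub, Polynomial.eval_mul,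
      Polynomial.eval_C, hN _ z hz]
    ring
  have hprod : p₁ * p₂ = N (b 2) ^ 2 := by
    refine eq_of_eval_eq (P := P) fun z hz => ?_
    rw [Polynomial.eval_mul, Polynomial.eval_pow, e₁ z hz, e₂ z hz, hN _ z hz]
    linear_combination -(denom P).eval z ^ 4 * hX.sum_sq_gradComponent hz b +
      (denom P).eval z ^ 4 * gradComponent (planeRep X) (b 1) z ^ 2 * Complex.I_sq
  -- the numerators have no common zero at the finite ends
  have hends : ∀ z : ℂ, (z : OnePoint ℂ) ∈ P → ¬(p₁.eval z = 0 ∧ p₂.eval z = 0) := by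
    rintro z hz ⟨h1, h2⟩
    have hzS := mem_finitePoints.mpr hz
    have hne : ∏ q ∈ (finitePoints P).erase z, (z - q) ^ 2 ≠ 0 := by
      refine Finset.prod_ne_zero_iff.mpr fun q hq => pow_ne_zero 2 ?_
      exact sub_ne_zero.mpr (Finset.ne_of_mem_erase hq).symm
    simp only [hp₁, hp₂, Polynomial.eval_add, Polynomial.eval_neg, Polynomial.eval_sub,
      Polynomial.eval_mul, Polynomial.eval_C, hNp _ z hzS] at h1 h2
    refine hv.not_and hX hz b ⟨mul_right_cancel₀ hne ?_, mul_right_cancel₀ hne ?_⟩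
    · linear_combination h1
    · linear_combination -h2
  have hendsdvd : ∀ z : ℂ, (z : OnePoint ℂ) ∈ P →
      ((Polynomial.X - Polynomial.C z) ^ 0 ∣ p₁ ∧ (Polynomial.X - Polynomial.C z) ^ 0 ∣ p₂) ∧
      ¬((Polynomial.X - Polynomial.C z) ^ (0 + 1) ∣ p₁ ∧
        (Polynomial.X - Polynomial.C z) ^ (0 + 1) ∣ p₂) := fun z hz => by
    refine ⟨by simp, ?_⟩
    rw [zero_add, pow_one, Polynomial.dvd_iff_isRoot, Polynomial.dvd_iff_isRoot]
    exact hends z hz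
  obtain ⟨q₁, q₂, h1, h2, h3⟩ := Polynomial.exists_eq_sq_of_mul_eq_sq hprod fun z => by
    by_cases hz : (z : OnePoint ℂ) ∈ P
    · exact ⟨0, hendsdvd z hz⟩
    · obtain ⟨k, hk⟩ := hev z hz
      exact ⟨k, hX.pow_dvd_of_hasBranchOrder hz hk b e₁ e₂⟩
  have hCdeg : ∀ u, (Polynomial.C Complex.I * N u).natDegree ≤ 2 * (P.card - 1) := fun u =>
    (Polynomial.natDegree_C_mul_le _ _).trans (hNdeg u)
  have hd₁ : p₁.natDegree ≤ 2 * (P.card - 1) :=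
    Polynomial.natDegree_add_le_of_degree_le (hNdeg _) (hCdeg _)
  have hd₂ : p₂.natDegree ≤ 2 * (P.card - 1) := by
    rw [hp₂, Polynomial.natDegree_neg]
    exact (Polynomial.natDegree_sub_le _ _).trans (max_le (hNdeg _) (hCdeg _))
  rw [h1, Polynomial.natDegree_pow] at hd₁
  rw [h2, Polynomial.natDegree_pow] at hd₂
  refine ⟨q₁, q₂, by omega, by omega, fun z hz => ?_, fun hun z hz0 => ?_⟩
  · have hD := pow_ne_zero 2 (eval_denom_ne_zero hz)
    have f₁ := e₁ z hz
    have f₂ := e₂ z hz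
    have f₃ := hN (b 2) z hz
    rw [h1, Polynomial.eval_pow] at f₁
    rw [h2, Polynomial.eval_pow] at f₂
    rw [h3, Polynomial.eval_mul] at f₃
    refine ⟨?_, ?_, ?_⟩
    · rw [eq_div_iff hD, f₁]
    · rw [← neg_div, eq_div_iff hD, f₂]; ring
    · rw [eq_div_iff hD, f₃]
  · have g₁ : p₁.eval z = 0 := by rw [h1, Polynomial.eval_pow, hz0.1, zero_pow two_ne_zero]
    have g₂ : p₂.eval z = 0 := by rw [h2, Polynomial.eval_pow, hz0.2, zero_pow two_ne_zero]
    by_cases hz : (z : OnePoint ℂ) ∈ P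
    · exact hends z hz ⟨g₁, g₂⟩
    · refine (hX.pow_dvd_of_hasBranchOrder (m := 0) hz (hun z hz) b e₁ e₂).2 ?_
      rw [zero_add, pow_one, Polynomial.dvd_iff_isRoot, Polynomial.dvd_iff_isRoot]
      exact ⟨g₁, g₂⟩

end Minimal

end RiemannSphere

/-! ### The two spinors are linearly independent -/

namespace RiemannSphere

/-- Three complex numbers are linearly dependent over `ℝ`. -/
theorem exists_real_combination_eq_zero (w : Fin 3 → ℂ) :
    ∃ a : Fin 3 → ℝ, a ≠ 0 ∧ ∑ i, (a i : ℂ) * w i = 0 := by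
  let L : (Fin 3 → ℝ) →ₗ[ℝ] ℂ := Fintype.linearCombination ℝ w
  have hL : ¬Function.Injective L := fun h => by
    have := LinearMap.finrank_le_finrank_of_injective h
    simp [Complex.finrank_real_complex] at this
  rw [← LinearMap.ker_eq_bot, Submodule.eq_bot_iff] at hL
  push Not at hL
  obtain ⟨a, ha, ha0⟩ := hL
  refine ⟨a, ha0, ?_⟩
  have h1 : L a = 0 := ha
  simpa [L, Fintype.linearCombination_apply] using h1

theorem tendsto_pow_mul_eval_denom_inv (P : Finset (OnePoint ℂ)) :
    Tendsto (fun w : ℂ => w ^ (finitePoints P).card * (denom P).eval w⁻¹) (𝓝[≠] 0) (𝓝 1) := by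
  have h1 : Tendsto (fun w : ℂ => ∏ p ∈ finitePoints P, (1 - p * w)) (𝓝[≠] 0) (𝓝 1) := by
    have : ContinuousAt (fun w : ℂ => ∏ p ∈ finitePoints P, (1 - p * w)) 0 := by fun_prop
    simpa using this.tendsto.mono_left nhdsWithin_le_nhds
  refine h1.congr' ?_
  filter_upwards [self_mem_nhdsWithin] with w hw
  have hw : w ≠ 0 := hw
  rw [eval_denom, ← Finset.prod_const, ← Finset.prod_mul_distrib]
  refine Finset.prod_congr rfl fun p _ => ?_
  field_simp

section Minimal

variable {P : Finset (OnePoint ℂ)} {X : OnePoint ℂ → E3} {v : OnePoint ℂ → E3 →ₗ[ℝ] ℂ}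

/-- The square roots of the isotropic components of the complex gradient are spinors in `K`, since
the double poles of the gradient have no residue. -/
theorem HasDoublePoles.mem_spinorK (hv : HasDoublePoles P X v) (hX : IsBranchedMinimal P X)
    (b : OrthonormalBasis (Fin 3) ℝ E3) {s t : OnePoint ℂ → ℂ} (hs : s ∈ spinorF P)
    (ht : t ∈ spinorF P)
    (hst : ∀ z : ℂ, (z : OnePoint ℂ) ∉ P →
      gradComponent (planeRep X) (b 0) z + Complex.I * gradComponent (planeRep X) (b 1) z =
        s z * s z ∧
      gradComponent (planeRep X) (b 0) z - Complex.I * gradComponent (planeRep X) (b 1) z =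
        -(t z * t z) ∧
      gradComponent (planeRep X) (b 2) z = s z * t z) :
    s ∈ spinorK P ∧ t ∈ spinorK P := by
  refine mem_spinorK_of_double_poles hs ht fun p hp => ?_
  choose k hk he using (hv p hp).2
  refine ⟨v p (b 0) + Complex.I * v p (b 1), -(v p (b 0) - Complex.I * v p (b 1)), v p (b 2),
    fun ζ => k (b 0) ζ + Complex.I * k (b 1) ζ, fun ζ => -(k (b 0) ζ - Complex.I * k (b 1) ζ),
    k (b 2), (hk _).add (analyticAt_const.mul (hk _)),
    ((hk _).sub (analyticAt_const.mul (hk _))).neg, hk _, ?_, ?_⟩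
  · rw [neg_eq_zero]
    exact hv.not_and hX hp b
  · filter_upwards [he (b 0), he (b 1), he (b 2), eventually_param_notMem P p,
      self_mem_nhdsWithin] with ζ h0 h1 h2 hζ hne
    have hζ' := hζ
    rw [param_eq_chartMap p hne] at hζ'
    obtain ⟨e1, e2, e3⟩ := hst _ hζ'
    rw [hX.gradComponent_localRep p hne hζ] at h0 h1 h2
    rw [coeff_mul_coeff p hne, coeff_mul_coeff p hne, coeff_mul_coeff p hne, ← e1, ← e3]
    refine ⟨?_, ?_, h2⟩
    · linear_combination h0 + Complex.I * h1
    · linear_combination -h0 + Complex.I * h1 + chartDeriv p ζ * e2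

/-- If the complex gradient is a constant vector divided by `(∏ (z - p)) ^ 2`, then it vanishes at
`∞` to too high an order for a surface without branch points and with at least two ends. -/
theorem HasDoublePoles.false_of_constant_direction (hv : HasDoublePoles P X v)
    (hX : IsBranchedMinimal P X) (hP : 2 ≤ P.card) (hun : Unbranched P X)
    (b : OrthonormalBasis (Fin 3) ℝ E3) {w : Fin 3 → ℂ}
    (h : ∀ z : ℂ, (z : OnePoint ℂ) ∉ P → ∀ i,
      gradComponent (planeRep X) (b i) z = w i / (denom P).eval z ^ 2) : False := by
  set N := (finitePoints P).card with hN
  have hcard := card_eq_card_finitePoints P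
  rw [← hN] at hcard
  have hE := tendsto_pow_mul_eval_denom_inv P
  rw [← hN] at hE
  -- `dz = - ζ⁻² dζ`, so the gradient in the coordinate `ζ = 1 / z` is `- ζ⁻² w / D(1 / ζ)²`, where
  -- `ζ ^ N * D(1 / ζ)` tends to `1`: it has order `2 N - 2` at `ζ = 0`
  have hloc : ∀ m : ℕ, m + 1 ≤ N → ∀ i, ∀ᶠ ζ in 𝓝[≠] (0 : ℂ),
      ζ ^ 2 * gradComponent (localRep X ∞) (b i) ζ =
        ζ ^ (2 * m) * ζ ^ 2 * (ζ ^ (2 * (N - (m + 1))) *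
          (-w i / (ζ ^ N * (denom P).eval ζ⁻¹) ^ 2)) := by
    intro m hm i
    filter_upwards [eventually_param_notMem P ∞, self_mem_nhdsWithin] with ζ hζ h0
    have h0 : ζ ≠ 0 := h0
    rw [hX.gradComponent_localRep ∞ h0 hζ]
    rw [param_infty h0] at hζ
    have hD := eval_denom_ne_zero hζ
    simp only [chartMap, chartDeriv, OnePoint.elim_infty]
    rw [h _ hζ i]
    have hpow : ζ ^ (2 * m) * ζ ^ 2 * ζ ^ (2 * (N - (m + 1))) = (ζ ^ N) ^ 2 := by
      rw [← pow_add, ← pow_add, ← pow_mul]; congr 1; omega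
    rw [← mul_assoc (ζ ^ (2 * m) * ζ ^ 2), hpow]
    field_simp
  have hlim : ∀ (j : ℕ) i, Tendsto (fun ζ : ℂ => ζ ^ j *
      (-w i / (ζ ^ N * (denom P).eval ζ⁻¹) ^ 2)) (𝓝[≠] 0) (𝓝 (0 ^ j * (-w i / 1 ^ 2))) :=
    fun j i => by
      have h1 : Tendsto (fun ζ : ℂ => ζ ^ j) (𝓝[≠] 0) (𝓝 (0 ^ j)) :=
        ((continuous_pow j).tendsto 0).mono_left nhdsWithin_le_nhds
      exact h1.mul (tendsto_const_nhds.div (hE.pow 2) (by simp))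
  have hid : ∀ j : ℕ, j ≠ 0 → Tendsto (fun ζ : ℂ => ζ ^ j) (𝓝[≠] 0) (𝓝 0) := fun j hj => by
    simpa [hj] using ((continuous_pow j).tendsto (0 : ℂ)).mono_left nhdsWithin_le_nhds
  by_cases hinf : ∞ ∈ P
  · rw [if_pos hinf] at hcard
    refine (hv ∞ hinf).1 (b.toBasis.ext fun i => ?_)
    have h1 := (hid 2 two_ne_zero).mul (hlim (2 * (N - (0 + 1))) i)
    have h2 := tendsto_nhds_unique (hv.tendsto hinf (b i)) (h1.congr' (by
      filter_upwards [hloc 0 (by omega) i] with ζ hζ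
      rw [hζ]; ring))
    simpa using h2
  · rw [if_neg hinf] at hcard
    have hg : ∀ i, Tendsto (gradComponent (localRep X ∞) (b i)) (𝓝[≠] 0) (𝓝 0) := fun i => by
      have h1 := (hid 2 two_ne_zero).mul (hlim (2 * (N - (1 + 1))) i)
      rw [zero_mul] at h1
      refine h1.congr' ?_
      filter_upwards [hloc 1 (by omega) i, self_mem_nhdsWithin] with ζ hζ h0
      have h0 : ζ ≠ 0 := h0
      refine mul_left_cancel₀ (pow_ne_zero 2 h0) ?_
      rw [hζ]; ring
    have hdiff : ∀ᶠ ζ in 𝓝[≠] (0 : ℂ), DifferentiableAt ℝ (localRep X ∞) ζ := by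
      have h1 : ∀ᶠ ζ in 𝓝 (0 : ℂ), ContDiffAt ℝ 2 (localRep X ∞) ζ :=
        (hX.harmonic ∞ hinf).1.eventually (by simp)
      exact (h1.mono fun ζ h => h.differentiableAt two_ne_zero).filter_mono nhdsWithin_le_nhds
    have hf : Tendsto (fun ζ => fderiv ℝ (localRep X ∞) ζ) (𝓝[≠] 0) (𝓝 0) := by
      have h1 : Tendsto (fun ζ => ∑ i, ‖gradComponent (localRep X ∞) (b i) ζ‖) (𝓝[≠] 0)
          (𝓝 (∑ i : Fin 3, ‖(0 : ℂ)‖)) := tendsto_finsetSum _ fun i _ => (hg i).norm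
      simp only [norm_zero, Finset.sum_const_zero] at h1
      exact squeeze_zero_norm' (hdiff.mono fun ζ hζ => norm_fderiv_le_sum_gradComponent hζ b) h1
    have hone : (fun _ : ℂ => (1 : ℂ)) =O[𝓝[≠] 0] fun ζ => fderiv ℝ (localRep X ∞) ζ := by
      have := (hun ∞ hinf).2
      simp only [pow_zero] at this
      exact this.mono nhdsWithin_le_nhds
    have h2 := hone.trans_tendsto hf
    exact one_ne_zero (tendsto_nhds_unique tendsto_const_nhds h2)

/-- A linear relation between the two spinors makes the direction of the complex gradient constant,
so that the surface is planar; without branch points this is impossible. -/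
theorem IsPlanarEndedSurface.two_le_finrank (hX : IsPlanarEndedSurface P X) (hP : 2 ≤ P.card)
    (h : Unbranched P X ∨ (EvenBranching P X ∧ ¬LiesInPlane P X)) :
    2 ≤ Module.finrank ℂ (spinorK P) := by
  have hM := hX.minimal
  have hev : EvenBranching P X := by
    rcases h with h | h
    · exact fun p hp => ⟨0, h p hp⟩
    · exact h.1
  obtain ⟨v, hv⟩ := hX.exists_hasDoublePoles
  set b := EuclideanSpace.basisFun (Fin 3) ℝ with hb
  obtain ⟨q₁, q₂, hd₁, hd₂, hq, hroot⟩ := hv.exists_spinors hM hP hev b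
  obtain ⟨s, hs, hsq⟩ := exists_mem_spinorF_eq_div hd₁
  obtain ⟨t, ht, htq⟩ := exists_mem_spinorF_eq_div hd₂
  obtain ⟨hsK, htK⟩ := hv.mem_spinorK hM b hs ht fun z hz => by
    obtain ⟨h1, h2, h3⟩ := hq z hz
    have hD := eval_denom_ne_zero hz
    rw [h1, h2, h3, hsq z hz, htq z hz]
    refine ⟨?_, ?_, ?_⟩ <;> field_simp
  suffices hli : LinearIndependent ℂ ![(⟨s, hsK⟩ : spinorK P), ⟨t, htK⟩] by
    have := finiteDimensional_spinorK P
    simpa using hli.fintype_card_le_finrank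
  rw [LinearIndependent.pair_iff]
  intro x y hxy
  by_contra hne
  have hpoly : Polynomial.C x * q₁ + Polynomial.C y * q₂ = 0 := by
    refine eq_of_eval_eq (P := P) fun z hz => ?_
    have h1 := congrFun (congrArg Subtype.val hxy) (z : OnePoint ℂ)
    have hD := eval_denom_ne_zero hz
    simp only [Submodule.coe_add, Submodule.coe_smul, Pi.add_apply, Pi.smul_apply, smul_eq_mul,
      hsq z hz, htq z hz, Submodule.coe_zero, Pi.zero_apply] at h1
    field_simp at h1
    simpa using h1
  obtain ⟨μ₁, μ₂, r, hr₁, hr₂⟩ : ∃ (μ₁ μ₂ : ℂ) (r : Polynomial ℂ),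
      q₁ = Polynomial.C μ₁ * r ∧ q₂ = Polynomial.C μ₂ * r := by
    have hinv : ∀ c : ℂ, c ≠ 0 → Polynomial.C c⁻¹ * Polynomial.C c = 1 := fun c hc => by
      rw [← Polynomial.C_mul, inv_mul_cancel₀ hc, Polynomial.C_1]
    by_cases hx : x = 0
    · have hy : y ≠ 0 := fun hy => hne ⟨hx, hy⟩
      refine ⟨1, -(y⁻¹ * x), q₁, by simp, ?_⟩
      rw [Polynomial.C_neg, Polynomial.C_mul]
      linear_combination Polynomial.C y⁻¹ * hpoly - q₂ * hinv y hy
    · refine ⟨-(x⁻¹ * y), 1, q₂, ?_, by simp⟩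
      rw [Polynomial.C_neg, Polynomial.C_mul]
      linear_combination Polynomial.C x⁻¹ * hpoly - q₁ * hinv x hx
  -- the isotropic vector of the spinor pair `(μ₁, μ₂)`
  set w : Fin 3 → ℂ := ![(μ₁ ^ 2 - μ₂ ^ 2) / 2, -Complex.I * (μ₁ ^ 2 + μ₂ ^ 2) / 2, μ₁ * μ₂] with hw
  have hgrad : ∀ z : ℂ, (z : OnePoint ℂ) ∉ P → ∀ i,
      gradComponent (planeRep X) (b i) z = w i * (r.eval z ^ 2 / (denom P).eval z ^ 2) := by
    intro z hz i
    obtain ⟨h1, h2, h3⟩ := hq z hz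
    rw [hr₁, hr₂, Polynomial.eval_mul, Polynomial.eval_C] at *
    simp only [Polynomial.eval_mul, Polynomial.eval_C] at h1 h2 h3
    fin_cases i
    · simp only [hw, Fin.zero_eta, Matrix.cons_val_zero]
      linear_combination h1 / 2 + h2 / 2
    · simp only [hw, Fin.mk_one, Matrix.cons_val_one, Matrix.cons_val_zero]
      linear_combination -Complex.I * h1 / 2 + Complex.I * h2 / 2 +
        gradComponent (planeRep X) (b 1) z * Complex.I_sq
    · simp only [hw, Fin.reduceFinMk, Matrix.cons_val]
      linear_combination h3
  rcases h with hun | ⟨-, hplane⟩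
  · -- without branch points `r` has no zero
    have hdeg : r.degree = 0 := by
      by_contra hdeg
      obtain ⟨z, hz⟩ := IsAlgClosed.exists_root r hdeg
      refine hroot hun z ?_
      rw [hr₁, hr₂, Polynomial.eval_mul, Polynomial.eval_mul, hz.eq_zero, mul_zero, mul_zero]
      exact ⟨rfl, rfl⟩
    obtain ⟨ρ, hρ⟩ : ∃ ρ, r = Polynomial.C ρ := ⟨_, Polynomial.eq_C_of_degree_eq_zero hdeg⟩
    refine hv.false_of_constant_direction hM hP hun b (w := fun i => w i * ρ ^ 2) fun z hz i => ?_
    rw [hgrad z hz i, hρ, Polynomial.eval_C]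
    ring
  · -- a real vector orthogonal to the real and imaginary parts of `w` is normal to the surface
    obtain ⟨a, ha0, ha⟩ := exists_real_combination_eq_zero w
    have hν : ∑ i, a i • b i ≠ 0 := fun h0 => ha0 (funext fun i =>
      Fintype.linearIndependent_iff.mp b.orthonormal.linearIndependent a h0 i)
    refine hplane (hM.liesInPlane_of_gradComponent_eq_zero hν fun z hz => ?_)
    rw [gradComponent_eq_of_eq_sum
      (fun u => (hM.harmonicAt_inner hz u).1.differentiableAt two_ne_zero)
      (Fin.sum_univ_three fun i => a i • b i), hgrad z hz, hgrad z hz, hgrad z hz]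
    rw [Fin.sum_univ_three] at ha
    linear_combination (r.eval z ^ 2 / (denom P).eval z ^ 2) * ha

end Minimal

end RiemannSphere

theorem mainTheorem2 (P : Finset (OnePoint ℂ)) (hP : 2 ≤ P.card) :
    FiniteDimensional ℂ (RiemannSphere.spinorK P) ∧
    Even ((P.card : ℤ) - (Module.finrank ℂ (RiemannSphere.spinorK P) : ℤ)) ∧
    ((∃ X : OnePoint ℂ → RiemannSphere.E3,
        RiemannSphere.IsPlanarEndedSurface P X ∧
        (RiemannSphere.Unbranched P X ∨
          (RiemannSphere.EvenBranching P X ∧ ¬ RiemannSphere.LiesInPlane P X))) →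
      2 ≤ Module.finrank ℂ (RiemannSphere.spinorK P) ∧
      (Module.finrank ℂ (RiemannSphere.spinorK P) : ℝ) ≤ √(P.card : ℝ)) := by
  classical
  refine ⟨RiemannSphere.finiteDimensional_spinorK P, ?_, ?_⟩
  · have h := Matrix.even_card_sub_finrank_ker_of_skew (RiemannSphere.cauchyMatrix P)
      (RiemannSphere.cauchyMatrix_transpose P)
    rwa [Fintype.card_coe, ← RiemannSphere.finrank_spinorK] at h
  · rintro ⟨X, hX, h⟩
    refine ⟨hX.two_le_finrank hP h, Real.le_sqrt_of_sq_le ?_⟩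
    have h2 := RiemannSphere.sq_finrank_ker_cauchyMatrix_le P
    rw [← RiemannSphere.finrank_spinorK] at h2
    exact_mod_cast h2
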